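/- **Theorem (Completeness of the linear-logic semantics for CHR$^\vee$).** *Syntax.* Fix function symbols, user-defined constraint symbols $c_u$ and built-in constraint symbols $c_b$ (each with an arity; the built-in constraints include $\bot$ and equations $t\doteq t'$). Built-in constraints $\mathbb B$ (user-defined constraints $\mathbb U$) are possibly empty conjunctions of built-in (user-defined) atoms; goals are $\mathbb G::=\top\mid c_u(\bar t)\mid c_b(\bar t)\mid \mathbb G\wedge\mathbb G\mid\mathbb G\vee\mathbb G$, with $\equiv_G$ the congruence generated by associativity and commutativity of $\wedge$, neutrality of $\top$ and distributivity of $\wedge$ over $\vee$. A state is $\langle\mathbb G;\mathbb V\rangle$ with $\mathbb V$ a finite set of (global) variables; a configuration $\bar S$ is a finite, possibly empty ($\varepsilon$) disjunction $S_1\vee\dots\vee S_n$ of states. A rule $H_1\setminus H_2\Leftrightarrow G\mid B$ has user-defined constraints $H_1,H_2$, a built-in guard $G$ and a goal $B$ as body; its local variables are $\bar y_r=vars(B,G)\setminus vars(H_1,H_2)$; its variants arise by renaming its variables to pairwise distinct variables. A program $\mathbb P$ is a set of rules. A constraint theory $CT$ is a set of closed formulas $\forall(\exists\bar x.\mathbb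 B\to\exists\bar x'.\mathbb B')$; $CT\models\varphi$ means derivability of the universal closure of $\varphi$ from $CT$ in intuitionistic logic with equality $\doteq$. $CT$ is *complete* if for every built-in constraint $\mathbb B$, $CT\models\exists\,\mathbb B$ or $CT\models\neg\exists\,\mathbb B$. *Equivalences.* For $\langle\mathbb U\wedge\mathbb B;\mathbb V\rangle$ and $\langle\mathbb U\wedge\mathbb B';\mathbb V\rangle$ let $\bar s,\bar s'$ be the variables of $\mathbb B$, resp. $\mathbb B'$, that are neither in $\mathbb V$ nor in $\mathbb U$. State equivalence $\equiv_e$ is the least equivalence relation with: $\langle\mathbb G;\mathbb V\rangle\equiv_e\langle\mathbb G';\mathbb V\rangle$ if $\mathbb G\equiv_G\mathbb G'$; $\langle\mathbb U\wedge x\doteq t\wedge\mathbb B;\mathbb V\rangle\equiv_e\langle\mathbb U[x/t]\wedge x\doteq t\wedge\mathbb B;\mathbb V\rangle$; $\langle\mathbb U\wedge\mathbb B;\mathbb V\rangle\equiv_e\langle\mathbb U\wedge\mathbb B';\mathbb V\rangle$ if $CT\models\exists\bar s.\mathbb B\leftrightarrow\exists\bar s'.\mathbb B'$; $\langle\mathbb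 G;\{x\}\cup\mathbb V\rangle\equiv_e\langle\mathbb G;\mathbb V\rangle$ if $x\notin vars(\mathbb G)$; $\langle\mathbb G\wedge\bot;\mathbb V\rangle\equiv_e\langle\mathbb G'\wedge\bot;\mathbb V'\rangle$. Configuration equivalence $\equiv_\vee$ is the least congruence for $\vee$ making $\vee$ associative and commutative with neutral elements $\varepsilon$ and $S_\bot=\langle\top\wedge\bot;\emptyset\rangle$, containing $\equiv_e$, and with $\langle\mathbb G_1\vee\mathbb G_2;\mathbb V\rangle\equiv_\vee\langle\mathbb G_1;\mathbb V\rangle\vee\langle\mathbb G_2;\mathbb V\rangle$. Classes are written $[\cdot]$. *Transitions.* For every variant of a rule of $\mathbb P$ with $\bar y_r$ disjoint from $vars(H_1,H_2,\mathbb G)\cup\mathbb V$ and with $CT\models\exists(G\wedge\mathbb B)$, where $\mathbb B$ is the built-in part of $\mathbb G$ (user-defined atoms replaced by $\top$): $[\langle H_1\wedge H_2\wedge G\wedge\mathbb G;\mathbb V\rangle\vee\bar T]\mapsto[\langle H_1\wedge G\wedge B\wedge\mathbb G;\mathbb V\rangle\vee\bar T]$. $\mapsto^*$ is the reflexive-transitive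 closure. *Entailment.* State entailment $\rhd$ is the least reflexive-transitive relation on classes of states with $[\langle\mathbb U\wedge\mathbb B;\mathbb V\rangle]\rhd[\langle\mathbb U\wedge\mathbb B';\mathbb V\rangle]$ if $CT\models\exists\bar s.\mathbb B\to\exists\bar s'.\mathbb B'$, and $[\langle\mathbb U\wedge\mathbb B;\{x\}\cup\mathbb V\rangle]\rhd[\langle\mathbb U\wedge\mathbb B;\mathbb V\rangle]$. Configuration entailment $\rhd_\vee$ is the least reflexive-transitive relation on classes of configurations with $[\bar T]\rhd_\vee[S\vee\bar T]$, and $[S_1\vee S_2\vee\bar T]\rhd_\vee[S_2\vee\bar T]$ whenever $[S_1]\rhd[S_2]$. *Linear logic.* $c_u(\bar t)^L=c_u(\bar t)$, $c_b(\bar t)^L={!c_b(\bar t)}$, $\bot^L=\mathbf 0$, $\top^L=\mathbf 1$, $(\mathbb G\wedge\mathbb G')^L=\mathbb G^L\otimes\mathbb G'^L$, $(\mathbb G\vee\mathbb G')^L=\mathbb G^L\oplus\mathbb G'^L$, $\langle\mathbb G;\mathbb V\rangle^L=\exists\bar l.\,\mathbb G^L$ with $\bar l=vars(\mathbb G)\setminus\mathbb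 V$, $(S\vee\bar T)^L=S^L\oplus\bar T^L$, $\varepsilon^L=\mathbf 0$. The proper axioms are: $\Sigma_{CT}$, all $\exists\bar x.\mathbb B^L\vdash\exists\bar x'.\mathbb B'^L$ with $CT\models\exists\bar x.\mathbb B\to\exists\bar x'.\mathbb B'$; $\Sigma_{\doteq}$, all $c_u(\dots,t_j,\dots)\otimes{!(t_j\doteq u)}\vdash c_u(\dots,u,\dots)\otimes{!(t_j\doteq u)}$; $\Sigma_{\mathbb P}$, all $H_1^L\otimes H_2^L\otimes G^L\vdash H_1^L\otimes\exists\bar y_r.(B^L\otimes G^L)$ for variants of rules of $\mathbb P$. *Claim.* Let $CT$ be a complete constraint theory, $\mathbb P$ a program, $\bar S,\bar T$ configurations, and $\Sigma=\Sigma_{CT}\cup\Sigma_{\doteq}\cup\Sigma_{\mathbb P}$. Then $\bar S^L\vdash\bar T^L$ is provable in the sequent calculus (with cut) of first-order intuitionistic linear logic with proper axioms $\Sigma$ if and only if there is a configuration $\bar U$ with $[\bar S]\mapsto^*[\bar U]$ and $[\bar U]\rhd_\vee[\bar T]$. -/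

import Mathlib

/-! Constraint Handling Rules with disjunction, and a first-order intuitionistic linear logic.

Conventions.  `L : FirstOrder.Language` supplies the function symbols (`L.Functions n`) and the
built-in constraint symbols (`L.Relations n`), `User n` is the type of `n`-ary user-defined
constraint symbols.  Program variables are named by natural numbers.  In logical formulas free
variables carry their names and bound variables are de Bruijn indices: a formula of type `_ n`
lives under `n` binders, its terms are elements of `L.Term (ℕ ⊕ Fin n)`. -/

universe u v w

namespace CHRV

open FirstOrder.Language (Term)

variable {L : FirstOrder.Language.{u, v}} {User : ℕ → Type w}

/-! ### Terms under binders -/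

/-- Substitutions for the free and the bound variables, from `n` to `m` enclosing binders. -/
abbrev Sub (L : FirstOrder.Language.{u, v}) (n m : ℕ) : Type u := ℕ ⊕ Fin n → L.Term (ℕ ⊕ Fin m)

/-- Extend a substitution under one more binder; index `0` is the innermost binder. -/
def Sub.lift {n m : ℕ} (σ : Sub L n m) : Sub L (n + 1) (m + 1)
  | Sum.inl x => (σ (Sum.inl x)).relabel (Sum.map id Fin.succ)
  | Sum.inr i =>
      Fin.cases (motive := fun _ => L.Term (ℕ ⊕ Fin (m + 1))) (Term.var (Sum.inr 0))
        (fun j => (σ (Sum.inr j)).relabel (Sum.map id Fin.succ)) i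

/-- Put `t` for the only bound variable of a formula under one binder. -/
def Sub.inst (t : L.Term (ℕ ⊕ Fin 0)) : Sub L 1 0
  | Sum.inl x => Term.var (Sum.inl x)
  | Sum.inr _ => t

/-- Turn the free variable `x` into the bound variable of a new outermost binder. -/
def Sub.close (x : ℕ) : Sub L 0 1
  | Sum.inl y => if y = x then Term.var (Sum.inr 0) else Term.var (Sum.inl y)
  | Sum.inr i => i.elim0

/-- A free variable, as a term outside all binders. -/
def freeVar (x : ℕ) : L.Term (ℕ ⊕ Fin 0) := Term.var (Sum.inl x)

/-- An ordinary term (with named variables), as a term outside all binders. -/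
def emb (t : L.Term ℕ) : L.Term (ℕ ⊕ Fin 0) := t.relabel Sum.inl

/-! ### Intuitionistic first-order logic with equality, over the built-in constraints -/

/-- Formulas of intuitionistic first-order logic with equality. -/
inductive IForm (L : FirstOrder.Language.{u, v}) : ℕ → Type (max u v)
  | falsum {n : ℕ} : IForm L n
  | truth {n : ℕ} : IForm L n
  | eq {n : ℕ} (t s : L.Term (ℕ ⊕ Fin n)) : IForm L n
  | rel {n k : ℕ} (R : L.Relations k) (ts : Fin k → L.Term (ℕ ⊕ Fin n)) : IForm L n
  | and {n : ℕ} (φ ψ : IForm L n) : IForm L n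
  | or {n : ℕ} (φ ψ : IForm L n) : IForm L n
  | imp {n : ℕ} (φ ψ : IForm L n) : IForm L n
  | all {n : ℕ} (φ : IForm L (n + 1)) : IForm L n
  | ex {n : ℕ} (φ : IForm L (n + 1)) : IForm L n

namespace IForm

/-- Capture-free substitution. -/
def subst : {n : ℕ} → IForm L n → {m : ℕ} → Sub L n m → IForm L m
  | _, falsum, _, _ => falsum
  | _, truth, _, _ => truth
  | _, eq t s, _, σ => eq (t.subst σ) (s.subst σ)
  | _, rel R ts, _, σ => rel R fun i => (ts i).subst σ
  | _, and φ ψ, _, σ => and (φ.subst σ) (ψ.subst σ)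
  | _, or φ ψ, _, σ => or (φ.subst σ) (ψ.subst σ)
  | _, imp φ ψ, _, σ => imp (φ.subst σ) (ψ.subst σ)
  | _, all φ, _, σ => all (φ.subst σ.lift)
  | _, ex φ, _, σ => ex (φ.subst σ.lift)

/-- Free variables. -/
def fv : {n : ℕ} → IForm L n → Finset ℕ
  | _, falsum => ∅
  | _, truth => ∅
  | _, eq t s => t.varFinsetLeft ∪ s.varFinsetLeft
  | _, rel _ ts => Finset.univ.biUnion fun i => (ts i).varFinsetLeft
  | _, and φ ψ => φ.fv ∪ ψ.fv
  | _, or φ ψ => φ.fv ∪ ψ.fv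
  | _, imp φ ψ => φ.fv ∪ ψ.fv
  | _, all φ => φ.fv
  | _, ex φ => φ.fv

/-- The instance `φ[t]` of a formula under one binder. -/
def inst (φ : IForm L 1) (t : L.Term (ℕ ⊕ Fin 0)) : IForm L 0 := φ.subst (Sub.inst t)

/-- `∃ x. φ` for a named variable `x`. -/
def exVar (x : ℕ) (φ : IForm L 0) : IForm L 0 := ex (φ.subst (Sub.close x))

/-- `∀ x. φ` for a named variable `x`. -/
def allVar (x : ℕ) (φ : IForm L 0) : IForm L 0 := all (φ.subst (Sub.close x))

/-- `∃ x̄. φ` for a finite set `x̄` of named variables. -/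
def exSet (s : Finset ℕ) (φ : IForm L 0) : IForm L 0 := (s.sort (· ≤ ·)).foldr exVar φ

/-- `∀ x̄. φ` for a finite set `x̄` of named variables. -/
def allSet (s : Finset ℕ) (φ : IForm L 0) : IForm L 0 := (s.sort (· ≤ ·)).foldr allVar φ

/-- The existential closure `∃ φ`. -/
def exClosure (φ : IForm L 0) : IForm L 0 := exSet φ.fv φ

/-- The universal closure `∀ φ`. -/
def allClosure (φ : IForm L 0) : IForm L 0 := allSet φ.fv φ

end IForm

/-- Natural deduction for intuitionistic first-order logic with equality: `IL Γ φ` says that `φ`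
is derivable from the set `Γ` of assumptions. -/
inductive IL : Set (IForm L 0) → IForm L 0 → Prop
  | hyp {Γ : Set (IForm L 0)} {φ : IForm L 0} : φ ∈ Γ → IL Γ φ
  | truthI {Γ : Set (IForm L 0)} : IL Γ IForm.truth
  | falsumE {Γ : Set (IForm L 0)} {φ : IForm L 0} : IL Γ IForm.falsum → IL Γ φ
  | andI {Γ : Set (IForm L 0)} {φ ψ : IForm L 0} : IL Γ φ → IL Γ ψ → IL Γ (φ.and ψ)
  | andE1 {Γ : Set (IForm L 0)} {φ ψ : IForm L 0} : IL Γ (φ.and ψ) → IL Γ φ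
  | andE2 {Γ : Set (IForm L 0)} {φ ψ : IForm L 0} : IL Γ (φ.and ψ) → IL Γ ψ
  | orI1 {Γ : Set (IForm L 0)} {φ ψ : IForm L 0} : IL Γ φ → IL Γ (φ.or ψ)
  | orI2 {Γ : Set (IForm L 0)} {φ ψ : IForm L 0} : IL Γ ψ → IL Γ (φ.or ψ)
  | orE {Γ : Set (IForm L 0)} {φ ψ χ : IForm L 0} :
      IL Γ (φ.or ψ) → IL (insert φ Γ) χ → IL (insert ψ Γ) χ → IL Γ χ
  | impI {Γ : Set (IForm L 0)} {φ ψ : IForm L 0} : IL (insert φ Γ) ψ → IL Γ (φ.imp ψ)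
  | impE {Γ : Set (IForm L 0)} {φ ψ : IForm L 0} : IL Γ (φ.imp ψ) → IL Γ φ → IL Γ ψ
  | allI {Γ : Set (IForm L 0)} {φ : IForm L 1} (a : ℕ) :
      a ∉ φ.fv → (∀ ψ ∈ Γ, a ∉ ψ.fv) → IL Γ (φ.inst (freeVar a)) → IL Γ φ.all
  | allE {Γ : Set (IForm L 0)} {φ : IForm L 1} (t : L.Term (ℕ ⊕ Fin 0)) :
      IL Γ φ.all → IL Γ (φ.inst t)
  | exI {Γ : Set (IForm L 0)} {φ : IForm L 1} (t : L.Term (ℕ ⊕ Fin 0)) :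
      IL Γ (φ.inst t) → IL Γ φ.ex
  | exE {Γ : Set (IForm L 0)} {φ : IForm L 1} {χ : IForm L 0} (a : ℕ) :
      a ∉ φ.fv → a ∉ χ.fv → (∀ ψ ∈ Γ, a ∉ ψ.fv) →
      IL Γ φ.ex → IL (insert (φ.inst (freeVar a)) Γ) χ → IL Γ χ
  | eqRefl {Γ : Set (IForm L 0)} (t : L.Term (ℕ ⊕ Fin 0)) : IL Γ (IForm.eq t t)
  | eqSubst {Γ : Set (IForm L 0)} (φ : IForm L 1) {t s : L.Term (ℕ ⊕ Fin 0)} :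
      IL Γ (IForm.eq t s) → IL Γ (φ.inst t) → IL Γ (φ.inst s)

/-! ### Intuitionistic linear logic -/

/-- Formulas of first-order intuitionistic linear logic.  Atoms are the user-defined atoms
`user`, the built-in atoms `rel`, and equations `eq`. -/
inductive LForm (L : FirstOrder.Language.{u, v}) (User : ℕ → Type w) : ℕ → Type (max u v w)
  | user {n k : ℕ} (c : User k) (ts : Fin k → L.Term (ℕ ⊕ Fin n)) : LForm L User n
  | rel {n k : ℕ} (R : L.Relations k) (ts : Fin k → L.Term (ℕ ⊕ Fin n)) : LForm L User n
  | eq {n : ℕ} (t s : L.Term (ℕ ⊕ Fin n)) : LForm L User n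
  | one {n : ℕ} : LForm L User n
  | zero {n : ℕ} : LForm L User n
  | top {n : ℕ} : LForm L User n
  | tensor {n : ℕ} (α β : LForm L User n) : LForm L User n
  | lolli {n : ℕ} (α β : LForm L User n) : LForm L User n
  | amp {n : ℕ} (α β : LForm L User n) : LForm L User n
  | plus {n : ℕ} (α β : LForm L User n) : LForm L User n
  | bang {n : ℕ} (α : LForm L User n) : LForm L User n
  | all {n : ℕ} (α : LForm L User (n + 1)) : LForm L User n
  | ex {n : ℕ} (α : LForm L User (n + 1)) : LForm L User n

namespace LForm

/-- Capture-free substitution. -/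
def subst : {n : ℕ} → LForm L User n → {m : ℕ} → Sub L n m → LForm L User m
  | _, user c ts, _, σ => user c fun i => (ts i).subst σ
  | _, rel R ts, _, σ => rel R fun i => (ts i).subst σ
  | _, eq t s, _, σ => eq (t.subst σ) (s.subst σ)
  | _, one, _, _ => one
  | _, zero, _, _ => zero
  | _, top, _, _ => top
  | _, tensor α β, _, σ => tensor (α.subst σ) (β.subst σ)
  | _, lolli α β, _, σ => lolli (α.subst σ) (β.subst σ)
  | _, amp α β, _, σ => amp (α.subst σ) (β.subst σ)
  | _, plus α β, _, σ => plus (α.subst σ) (β.subst σ)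
  | _, bang α, _, σ => bang (α.subst σ)
  | _, all α, _, σ => all (α.subst σ.lift)
  | _, ex α, _, σ => ex (α.subst σ.lift)

/-- Free variables. -/
def fv : {n : ℕ} → LForm L User n → Finset ℕ
  | _, user _ ts => Finset.univ.biUnion fun i => (ts i).varFinsetLeft
  | _, rel _ ts => Finset.univ.biUnion fun i => (ts i).varFinsetLeft
  | _, eq t s => t.varFinsetLeft ∪ s.varFinsetLeft
  | _, one => ∅
  | _, zero => ∅
  | _, top => ∅
  | _, tensor α β => α.fv ∪ β.fv
  | _, lolli α β => α.fv ∪ β.fv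
  | _, amp α β => α.fv ∪ β.fv
  | _, plus α β => α.fv ∪ β.fv
  | _, bang α => α.fv
  | _, all α => α.fv
  | _, ex α => α.fv

/-- The instance `α[t]` of a formula under one binder. -/
def inst (α : LForm L User 1) (t : L.Term (ℕ ⊕ Fin 0)) : LForm L User 0 := α.subst (Sub.inst t)

/-- `∃ x. α` for a named variable `x`. -/
def exVar (x : ℕ) (α : LForm L User 0) : LForm L User 0 := ex (α.subst (Sub.close x))

/-- `∃ x̄. α` for a finite set `x̄` of named variables. -/
def exSet (s : Finset ℕ) (α : LForm L User 0) : LForm L User 0 :=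
  (s.sort (· ≤ ·)).foldr exVar α

end LForm

/-- A sequent `Γ ⊢ α` of intuitionistic linear logic; `Γ` is a multiset. -/
abbrev Sequent (L : FirstOrder.Language.{u, v}) (User : ℕ → Type w) : Type (max u v w) :=
  Multiset (LForm L User 0) × LForm L User 0

/-- Provability `Γ ⊢_P α` in the sequent calculus of first-order intuitionistic linear logic
(with cut) with the set `P` of proper axioms. -/
inductive ILL (P : Set (Sequent L User)) : Multiset (LForm L User 0) → LForm L User 0 → Prop
  | proper {Γ : Multiset (LForm L User 0)} {α : LForm L User 0} : (Γ, α) ∈ P → ILL P Γ α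
  | id (α : LForm L User 0) : ILL P {α} α
  | cut {Γ Δ : Multiset (LForm L User 0)} {α β : LForm L User 0} :
      ILL P Γ α → ILL P (α ::ₘ Δ) β → ILL P (Γ + Δ) β
  | tensorL {Γ : Multiset (LForm L User 0)} {α β γ : LForm L User 0} :
      ILL P (α ::ₘ β ::ₘ Γ) γ → ILL P (α.tensor β ::ₘ Γ) γ
  | tensorR {Γ Δ : Multiset (LForm L User 0)} {α β : LForm L User 0} :
      ILL P Γ α → ILL P Δ β → ILL P (Γ + Δ) (α.tensor β)
  | oneL {Γ : Multiset (LForm L User 0)} {α : LForm L User 0} :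
      ILL P Γ α → ILL P (LForm.one ::ₘ Γ) α
  | oneR : ILL P 0 LForm.one
  | lolliL {Γ Δ : Multiset (LForm L User 0)} {α β γ : LForm L User 0} :
      ILL P Γ α → ILL P (β ::ₘ Δ) γ → ILL P (α.lolli β ::ₘ (Γ + Δ)) γ
  | lolliR {Γ : Multiset (LForm L User 0)} {α β : LForm L User 0} :
      ILL P (α ::ₘ Γ) β → ILL P Γ (α.lolli β)
  | bangR {Γ : Multiset (LForm L User 0)} {α : LForm L User 0} :
      ILL P (Γ.map LForm.bang) α → ILL P (Γ.map LForm.bang) α.bang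
  | dereliction {Γ : Multiset (LForm L User 0)} {α β : LForm L User 0} :
      ILL P (α ::ₘ Γ) β → ILL P (α.bang ::ₘ Γ) β
  | contraction {Γ : Multiset (LForm L User 0)} {α β : LForm L User 0} :
      ILL P (α.bang ::ₘ α.bang ::ₘ Γ) β → ILL P (α.bang ::ₘ Γ) β
  | weakening {Γ : Multiset (LForm L User 0)} {α β : LForm L User 0} :
      ILL P Γ β → ILL P (α.bang ::ₘ Γ) β
  | ampL1 {Γ : Multiset (LForm L User 0)} {α β γ : LForm L User 0} :
      ILL P (α ::ₘ Γ) γ → ILL P (α.amp β ::ₘ Γ) γ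
  | ampL2 {Γ : Multiset (LForm L User 0)} {α β γ : LForm L User 0} :
      ILL P (β ::ₘ Γ) γ → ILL P (α.amp β ::ₘ Γ) γ
  | ampR {Γ : Multiset (LForm L User 0)} {α β : LForm L User 0} :
      ILL P Γ α → ILL P Γ β → ILL P Γ (α.amp β)
  | topR {Γ : Multiset (LForm L User 0)} : ILL P Γ LForm.top
  | plusL {Γ : Multiset (LForm L User 0)} {α β γ : LForm L User 0} :
      ILL P (α ::ₘ Γ) γ → ILL P (β ::ₘ Γ) γ → ILL P (α.plus β ::ₘ Γ) γ
  | plusR1 {Γ : Multiset (LForm L User 0)} {α β : LForm L User 0} :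
      ILL P Γ α → ILL P Γ (α.plus β)
  | plusR2 {Γ : Multiset (LForm L User 0)} {α β : LForm L User 0} :
      ILL P Γ β → ILL P Γ (α.plus β)
  | zeroL (α : LForm L User 0) : ILL P {LForm.zero} α
  | allL {Γ : Multiset (LForm L User 0)} {α : LForm L User 1} {β : LForm L User 0}
      (t : L.Term (ℕ ⊕ Fin 0)) :
      ILL P (α.inst t ::ₘ Γ) β → ILL P (α.all ::ₘ Γ) β
  | allR {Γ : Multiset (LForm L User 0)} {β : LForm L User 1} (a : ℕ) :
      a ∉ β.fv → (∀ γ ∈ Γ, a ∉ γ.fv) → ILL P Γ (β.inst (freeVar a)) → ILL P Γ β.all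
  | exL {Γ : Multiset (LForm L User 0)} {α : LForm L User 1} {β : LForm L User 0} (a : ℕ) :
      a ∉ α.fv → a ∉ β.fv → (∀ γ ∈ Γ, a ∉ γ.fv) →
      ILL P (α.inst (freeVar a) ::ₘ Γ) β → ILL P (α.ex ::ₘ Γ) β
  | exR {Γ : Multiset (LForm L User 0)} {β : LForm L User 1} (t : L.Term (ℕ ⊕ Fin 0)) :
      ILL P Γ (β.inst t) → ILL P Γ β.ex

/-! ### Goals, states, configurations, rules -/

/-- Goals with disjunction: `⊤`, user-defined atoms, built-in atoms (among them `⊥` and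
equations), `∧` and `∨`. -/
inductive Goal (L : FirstOrder.Language.{u, v}) (User : ℕ → Type w) : Type (max u v w)
  | top : Goal L User
  | user {k : ℕ} (c : User k) (ts : Fin k → L.Term ℕ) : Goal L User
  | bot : Goal L User
  | eq (t s : L.Term ℕ) : Goal L User
  | rel {k : ℕ} (R : L.Relations k) (ts : Fin k → L.Term ℕ) : Goal L User
  | and (G G' : Goal L User) : Goal L User
  | or (G G' : Goal L User) : Goal L User

namespace Goal

/-- `G` is a user-defined constraint: a possibly empty conjunction of user-defined atoms. -/
def IsUser : Goal L User → Prop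
  | top => True
  | user _ _ => True
  | and G G' => G.IsUser ∧ G'.IsUser
  | _ => False

/-- `G` is a built-in constraint: a possibly empty conjunction of built-in atoms. -/
def IsBuiltin : Goal L User → Prop
  | top => True
  | bot => True
  | eq _ _ => True
  | rel _ _ => True
  | and G G' => G.IsBuiltin ∧ G'.IsBuiltin
  | _ => False

/-- The variables occurring in a goal. -/
def vars : Goal L User → Finset ℕ
  | top => ∅
  | user _ ts => Finset.univ.biUnion fun i => (ts i).varFinset
  | bot => ∅
  | eq t s => t.varFinset ∪ s.varFinset
  | rel _ ts => Finset.univ.biUnion fun i => (ts i).varFinset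
  | and G G' => G.vars ∪ G'.vars
  | or G G' => G.vars ∪ G'.vars

/-- Simultaneous substitution. -/
def subst (σ : ℕ → L.Term ℕ) : Goal L User → Goal L User
  | top => top
  | user c ts => user c fun i => (ts i).subst σ
  | bot => bot
  | eq t s => eq (t.subst σ) (s.subst σ)
  | rel R ts => rel R fun i => (ts i).subst σ
  | and G G' => and (G.subst σ) (G'.subst σ)
  | or G G' => or (G.subst σ) (G'.subst σ)

/-- Replace the variable `x` by the term `t` everywhere. -/
def subst1 (x : ℕ) (t : L.Term ℕ) (G : Goal L User) : Goal L User :=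
  G.subst (Function.update Term.var x t)

/-- Rename the variables. -/
def rename (ρ : ℕ → ℕ) (G : Goal L User) : Goal L User := G.subst fun x => Term.var (ρ x)

theorem IsUser.subst {σ : ℕ → L.Term ℕ} : ∀ {G : Goal L User}, G.IsUser → (G.subst σ).IsUser
  | top, _ => trivial
  | user _ _, _ => trivial
  | and _ _, h => ⟨IsUser.subst h.1, IsUser.subst h.2⟩

theorem IsBuiltin.subst {σ : ℕ → L.Term ℕ} :
    ∀ {G : Goal L User}, G.IsBuiltin → (G.subst σ).IsBuiltin
  | top, _ => trivial
  | bot, _ => trivial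
  | eq _ _, _ => trivial
  | rel _ _, _ => trivial
  | and _ _, h => ⟨IsBuiltin.subst h.1, IsBuiltin.subst h.2⟩

/-- The built-in content of a goal as a formula of intuitionistic logic: user-defined atoms are
read as `⊤`.  A built-in constraint is read as itself. -/
def toI : Goal L User → IForm L 0
  | top => IForm.truth
  | user _ _ => IForm.truth
  | bot => IForm.falsum
  | eq t s => IForm.eq (emb t) (emb s)
  | rel R ts => IForm.rel R fun i => emb (ts i)
  | and G G' => IForm.and G.toI G'.toI
  | or G G' => IForm.or G.toI G'.toI

/-- The translation of goals into linear logic. -/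
def toL : Goal L User → LForm L User 0
  | top => LForm.one
  | user c ts => LForm.user c fun i => emb (ts i)
  | bot => LForm.zero
  | eq t s => LForm.bang (LForm.eq (emb t) (emb s))
  | rel R ts => LForm.bang (LForm.rel R fun i => emb (ts i))
  | and G G' => LForm.tensor G.toL G'.toL
  | or G G' => LForm.plus G.toL G'.toL

end Goal

/-- Goal equivalence: the congruence generated by associativity and commutativity of `∧`,
neutrality of `⊤`, and distributivity of `∧` over `∨`. -/
inductive GoalEquiv : Goal L User → Goal L User → Prop
  | refl (G : Goal L User) : GoalEquiv G G
  | symm {G G' : Goal L User} : GoalEquiv G G' → GoalEquiv G' G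
  | trans {G G' G'' : Goal L User} : GoalEquiv G G' → GoalEquiv G' G'' → GoalEquiv G G''
  | andCongr {G₁ G₂ G₁' G₂' : Goal L User} :
      GoalEquiv G₁ G₁' → GoalEquiv G₂ G₂' → GoalEquiv (G₁.and G₂) (G₁'.and G₂')
  | orCongr {G₁ G₂ G₁' G₂' : Goal L User} :
      GoalEquiv G₁ G₁' → GoalEquiv G₂ G₂' → GoalEquiv (G₁.or G₂) (G₁'.or G₂')
  | assoc (G₁ G₂ G₃ : Goal L User) : GoalEquiv ((G₁.and G₂).and G₃) (G₁.and (G₂.and G₃))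
  | comm (G₁ G₂ : Goal L User) : GoalEquiv (G₁.and G₂) (G₂.and G₁)
  | topAnd (G : Goal L User) : GoalEquiv (Goal.top.and G) G
  | distrib (G₁ G₂ G₃ : Goal L User) :
      GoalEquiv (G₁.and (G₂.or G₃)) ((G₁.and G₂).or (G₁.and G₃))

/-- A constraint theory: a set of closed formulas `∀ (∃ x̄. B → ∃ x̄'. B')` with built-in
constraints `B`, `B'`. -/
structure ConstraintTheory (L : FirstOrder.Language.{u, v}) (User : ℕ → Type w) where
  sentences : Set (IForm L 0)
  form : ∀ φ ∈ sentences, ∃ (x x' : Finset ℕ) (B B' : Goal L User),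
    B.IsBuiltin ∧ B'.IsBuiltin ∧
      φ = ((IForm.exSet x B.toI).imp (IForm.exSet x' B'.toI)).allClosure

namespace ConstraintTheory

/-- `CT ⊨ φ`: derivability in intuitionistic logic with equality from the sentences of `CT`.
Since these are closed, free variables of `φ` are implicitly universally quantified. -/
def Entails (CT : ConstraintTheory L User) (φ : IForm L 0) : Prop := IL CT.sentences φ

/-- Completeness: every built-in constraint is satisfiable or unsatisfiable according to `CT`. -/
def Complete (CT : ConstraintTheory L User) : Prop :=
  ∀ B : Goal L User, B.IsBuiltin →
    CT.Entails B.toI.exClosure ∨ CT.Entails (B.toI.exClosure.imp IForm.falsum)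

end ConstraintTheory

/-- A state `⟨G; V⟩`. -/
structure State (L : FirstOrder.Language.{u, v}) (User : ℕ → Type w) where
  goal : Goal L User
  globals : Finset ℕ

/-- The local variables of a state. -/
def State.locals (S : State L User) : Finset ℕ := S.goal.vars \ S.globals

/-- The translation of states: `∃_{-V}. G`. -/
def State.toL (S : State L User) : LForm L User 0 := LForm.exSet S.locals S.goal.toL

/-- The strictly local variables of `⟨U ∧ B; V⟩`. -/
def strictLocals (U B : Goal L User) (V : Finset ℕ) : Finset ℕ :=
  ((U.vars ∪ B.vars) \ V) \ U.vars

/-- The failed state `⟨⊤ ∧ ⊥; ∅⟩`. -/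
def failedState : State L User := ⟨Goal.top.and Goal.bot, ∅⟩

/-- Equivalence of states. -/
inductive StateEquiv (CT : ConstraintTheory L User) : State L User → State L User → Prop
  | refl (S : State L User) : StateEquiv CT S S
  | symm {S T : State L User} : StateEquiv CT S T → StateEquiv CT T S
  | trans {S T U : State L User} : StateEquiv CT S T → StateEquiv CT T U → StateEquiv CT S U
  | goal {G G' : Goal L User} (V : Finset ℕ) :
      GoalEquiv G G' → StateEquiv CT ⟨G, V⟩ ⟨G', V⟩
  | eqSubst {U B : Goal L User} (x : ℕ) (t : L.Term ℕ) (V : Finset ℕ) :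
      U.IsUser → B.IsBuiltin →
      StateEquiv CT ⟨(U.and (Goal.eq (Term.var x) t)).and B, V⟩
        ⟨((U.subst1 x t).and (Goal.eq (Term.var x) t)).and B, V⟩
  | applyCT {U B B' : Goal L User} (V : Finset ℕ) :
      U.IsUser → B.IsBuiltin → B'.IsBuiltin →
      CT.Entails ((IForm.exSet (strictLocals U B V) B.toI).imp
        (IForm.exSet (strictLocals U B' V) B'.toI)) →
      CT.Entails ((IForm.exSet (strictLocals U B' V) B'.toI).imp
        (IForm.exSet (strictLocals U B V) B.toI)) →
      StateEquiv CT ⟨U.and B, V⟩ ⟨U.and B', V⟩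
  | redundantGlobal {G : Goal L User} {x : ℕ} (V : Finset ℕ) :
      x ∉ G.vars → StateEquiv CT ⟨G, insert x V⟩ ⟨G, V⟩
  | failed (G G' : Goal L User) (V V' : Finset ℕ) :
      StateEquiv CT ⟨G.and Goal.bot, V⟩ ⟨G'.and Goal.bot, V'⟩

/-- State equivalence as a setoid. -/
def stateSetoid (CT : ConstraintTheory L User) : Setoid (State L User) where
  r := StateEquiv CT
  iseqv := ⟨StateEquiv.refl, StateEquiv.symm, StateEquiv.trans⟩

/-- Equivalence classes of states. -/
abbrev StateClass (CT : ConstraintTheory L User) := Quotient (stateSetoid CT)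

/-- The class `[S]`. -/
def State.cls (CT : ConstraintTheory L User) (S : State L User) : StateClass CT :=
  Quotient.mk (stateSetoid CT) S

/-- The generating instances of state entailment. -/
inductive StateEntailStep (CT : ConstraintTheory L User) :
    StateClass CT → StateClass CT → Prop
  | weaken {U B B' : Goal L User} (V : Finset ℕ) :
      U.IsUser → B.IsBuiltin → B'.IsBuiltin →
      CT.Entails ((IForm.exSet (strictLocals U B V) B.toI).imp
        (IForm.exSet (strictLocals U B' V) B'.toI)) →
      StateEntailStep CT (State.cls CT ⟨U.and B, V⟩) (State.cls CT ⟨U.and B', V⟩)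
  | omitGlobal {U B : Goal L User} (x : ℕ) (V : Finset ℕ) :
      U.IsUser → B.IsBuiltin →
      StateEntailStep CT (State.cls CT ⟨U.and B, insert x V⟩) (State.cls CT ⟨U.and B, V⟩)

/-- State entailment, on equivalence classes of states. -/
def StateEntails (CT : ConstraintTheory L User) : StateClass CT → StateClass CT → Prop :=
  Relation.ReflTransGen (StateEntailStep CT)

/-- A configuration `S₁ ∨ ⋯ ∨ Sₙ`.  The empty list is the empty configuration `ε`, and `∨` is
concatenation. -/
abbrev Config (L : FirstOrder.Language.{u, v}) (User : ℕ → Type w) := List (State L User)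

/-- The translation of configurations: `ε` is `0`, and `S ∨ T̄` is `S ⊕ T̄`. -/
def Config.toL : Config L User → LForm L User 0
  | [] => LForm.zero
  | [S] => S.toL
  | S :: S' :: T => LForm.plus S.toL (Config.toL (S' :: T))

/-- Equivalence of configurations.  `congr` lets the laws be used inside a configuration
(together with `comm`); associativity of `∨` holds by definition. -/
inductive ConfigEquiv (CT : ConstraintTheory L User) : Config L User → Config L User → Prop
  | refl (S : Config L User) : ConfigEquiv CT S S
  | symm {S T : Config L User} : ConfigEquiv CT S T → ConfigEquiv CT T S
  | trans {S T U : Config L User} :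
      ConfigEquiv CT S T → ConfigEquiv CT T U → ConfigEquiv CT S U
  | congr {S S' : Config L User} (T : Config L User) :
      ConfigEquiv CT S S' → ConfigEquiv CT (S ++ T) (S' ++ T)
  | comm (S T : Config L User) : ConfigEquiv CT (S ++ T) (T ++ S)
  | state {S S' : State L User} (T : Config L User) :
      StateEquiv CT S S' → ConfigEquiv CT (S :: T) (S' :: T)
  | failed (T : Config L User) : ConfigEquiv CT (failedState :: T) T
  | split (G₁ G₂ : Goal L User) (V : Finset ℕ) (T : Config L User) :
      ConfigEquiv CT (⟨G₁.or G₂, V⟩ :: T) (⟨G₁, V⟩ :: ⟨G₂, V⟩ :: T)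

/-- Configuration equivalence as a setoid. -/
def configSetoid (CT : ConstraintTheory L User) : Setoid (Config L User) where
  r := ConfigEquiv CT
  iseqv := ⟨ConfigEquiv.refl, ConfigEquiv.symm, ConfigEquiv.trans⟩

/-- Equivalence classes of configurations. -/
abbrev ConfigClass (CT : ConstraintTheory L User) := Quotient (configSetoid CT)

/-- The class `[S̄]`. -/
def Config.cls (CT : ConstraintTheory L User) (S : Config L User) : ConfigClass CT :=
  Quotient.mk (configSetoid CT) S

/-- The generating instances of configuration entailment. -/
inductive ConfigEntailStep (CT : ConstraintTheory L User) :
    ConfigClass CT → ConfigClass CT → Prop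
  | weaken (S : State L User) (T : Config L User) :
      ConfigEntailStep CT (Config.cls CT T) (Config.cls CT (S :: T))
  | stronger {S₁ S₂ : State L User} (T : Config L User) :
      StateEntails CT (S₁.cls CT) (S₂.cls CT) →
      ConfigEntailStep CT (Config.cls CT (S₁ :: S₂ :: T)) (Config.cls CT (S₂ :: T))

/-- Configuration entailment, on equivalence classes of configurations. -/
def ConfigEntails (CT : ConstraintTheory L User) : ConfigClass CT → ConfigClass CT → Prop :=
  Relation.ReflTransGen (ConfigEntailStep CT)

/-- A rule `H₁ \ H₂ ⇔ G | B`: kept head, removed head, guard, body. -/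
structure Rule (L : FirstOrder.Language.{u, v}) (User : ℕ → Type w) where
  kept : Goal L User
  removed : Goal L User
  guard : Goal L User
  body : Goal L User
  kept_user : kept.IsUser
  removed_user : removed.IsUser
  guard_builtin : guard.IsBuiltin

namespace Rule

/-- All variables of a rule. -/
def vars (r : Rule L User) : Finset ℕ :=
  r.kept.vars ∪ r.removed.vars ∪ r.guard.vars ∪ r.body.vars

/-- The local variables of a rule. -/
def locals (r : Rule L User) : Finset ℕ :=
  (r.body.vars ∪ r.guard.vars) \ (r.kept.vars ∪ r.removed.vars)

/-- Rename the variables of a rule. -/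
def rename (ρ : ℕ → ℕ) (r : Rule L User) : Rule L User where
  kept := r.kept.rename ρ
  removed := r.removed.rename ρ
  guard := r.guard.rename ρ
  body := r.body.rename ρ
  kept_user := r.kept_user.subst
  removed_user := r.removed_user.subst
  guard_builtin := r.guard_builtin.subst

/-- `r'` is a variant of `r`: its variables are replaced by pairwise distinct variables. -/
def IsVariant (r' r : Rule L User) : Prop :=
  ∃ ρ : ℕ → ℕ, Set.InjOn ρ r.vars ∧ r' = r.rename ρ

end Rule

/-- A program is a set of rules. -/
abbrev Program (L : FirstOrder.Language.{u, v}) (User : ℕ → Type w) := Set (Rule L User)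

/-- The transition relation of a program, on equivalence classes of configurations:
`[⟨H₁ ∧ H₂ ∧ G ∧ K; V⟩ ∨ T̄] ↦ [⟨H₁ ∧ G ∧ B ∧ K; V⟩ ∨ T̄]` for a variant `r` of a rule whose local
variables occur neither in the heads nor in `K` nor in `V`, provided that the guard together with
the built-in content of `K` is satisfiable. -/
inductive Step (CT : ConstraintTheory L User) (P : Program L User) :
    ConfigClass CT → ConfigClass CT → Prop
  | apply (r₀ r : Rule L User) (K : Goal L User) (V : Finset ℕ) (T : Config L User) :
      r₀ ∈ P → r.IsVariant r₀ →
      Disjoint r.locals (r.kept.vars ∪ r.removed.vars ∪ K.vars ∪ V) →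
      CT.Entails (r.guard.and K).toI.exClosure →
      Step CT P
        (Config.cls CT (⟨((r.kept.and r.removed).and r.guard).and K, V⟩ :: T))
        (Config.cls CT (⟨((r.kept.and r.guard).and r.body).and K, V⟩ :: T))

/-- The proper axioms of the constraint theory: `∃ x̄. B ⊢ ∃ x̄'. B'` whenever
`CT ⊨ ∃ x̄. B → ∃ x̄'. B'`. -/
def sigmaCT (CT : ConstraintTheory L User) : Set (Sequent L User) :=
  {q | ∃ (x x' : Finset ℕ) (B B' : Goal L User), B.IsBuiltin ∧ B'.IsBuiltin ∧
    CT.Entails ((IForm.exSet x B.toI).imp (IForm.exSet x' B'.toI)) ∧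
    q = ({LForm.exSet x B.toL}, LForm.exSet x' B'.toL)}

/-- The proper axioms for equality and user-defined constraints:
`c(…, tⱼ, …) ⊗ !(tⱼ ≐ s) ⊢ c(…, s, …) ⊗ !(tⱼ ≐ s)`. -/
def sigmaEq (L : FirstOrder.Language.{u, v}) (User : ℕ → Type w) : Set (Sequent L User) :=
  {q | ∃ (k : ℕ) (c : User k) (ts : Fin k → L.Term ℕ) (j : Fin k) (s : L.Term ℕ),
    q = ({((Goal.user c ts).and (Goal.eq (ts j) s)).toL},
      ((Goal.user c (Function.update ts j s)).and (Goal.eq (ts j) s)).toL)}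

/-- The proper axioms of a program: `H₁ ⊗ H₂ ⊗ G ⊢ H₁ ⊗ ∃ ȳ. (B ⊗ G)` for every variant of a
rule with local variables `ȳ`. -/
def sigmaP (P : Program L User) : Set (Sequent L User) :=
  {q | ∃ r₀ ∈ P, ∃ r : Rule L User, r.IsVariant r₀ ∧
    q = ({LForm.tensor (LForm.tensor r.kept.toL r.removed.toL) r.guard.toL},
      LForm.tensor r.kept.toL
        (LForm.exSet r.locals (LForm.tensor r.body.toL r.guard.toL)))}

end CHRV

namespace CHRV

open FirstOrder.Language (Term)

variable {L : FirstOrder.Language.{u, v}} {User : ℕ → Type w}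

/-! ### Terms -/

section Terms

variable {α β γ : Type*}

/-! From runs to proofs the argument is direct. Every law generating the equivalences, every
transition and every entailment step is a derivable sequent: Σ_CT handles the built-in constraints,
Σ_≐ the replacement of arguments, Σ_P the rules, and the freshness conditions are those needed to
move `∃` across `⊗`. Cut composes the steps (`ILL.Le.steps`, `ILL.Le.configEntails`).

From proofs to runs no cut elimination is performed; a phase semantics is built whose points carry
the operational meaning. A point is a store, a pair of multisets of user-defined and built-in
constraints. The inductive relation `Cov CT P X m` says that all branches of some computation tree
starting from the store `m` end in `X` up to superfluous built-in constraints, or fail. Its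
constructors mirror the proper axioms. By `Cov.bind'`, derivations can be grafted and can carry a
context along, so `cl X = {m | Cov CT P X m}` is a closure operator compatible with addition of
stores. Formulas are interpreted by closed sets (`sem`), with `!` generated by stores that have no
user-defined constraints, and all sequent rules, cut included, are valid (`ILL.sound`).

A goal denotes the closure of its disjunctive normal form (`sem_toL`). Evaluating a derivable `S ⊢
T` at the identity valuation therefore places each disjunct of `S`, with its local variables renamed
apart, in the closure of the substitution instances of the disjuncts of `T`. `Cov.reach` then reads
the covering derivation as a run: all constructors but the one for rules become state equivalences
or failure, and an instance of a disjunct of `T` entails that disjunct (`Reach.of_instance`).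

The rule constructor rewrites an arbitrary instance of the heads, whereas a transition needs the
heads of a variant verbatim. The gap is closed by trading a substitution for equations on fresh
variables (`StateEquiv.subst`) before and after the transition (`Reach.rule`). This is also the only
place where completeness of the theory enters: a transition requires satisfiable built-ins, and when
satisfiability is not derivable the theory refutes them, so the state is failed and can be dropped.
-/

theorem term_subst_subst (t : L.Term α) (f : α → L.Term β) (g : β → L.Term γ) :
    (t.subst f).subst g = t.subst fun x => (f x).subst g := by
  induction t with
  | var => rfl
  | func f ts ih => simp [ih]

theorem term_subst_var (t : L.Term α) : t.subst Term.var = t := by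
  induction t with
  | var => rfl
  | func f ts ih => simp [ih]

theorem term_relabel_subst (t : L.Term α) (f : α → β) (g : β → L.Term γ) :
    (t.relabel f).subst g = t.subst fun x => g (f x) := by
  induction t with
  | var => rfl
  | func f ts ih => simp [ih]

theorem term_subst_relabel (t : L.Term α) (f : α → L.Term β) (g : β → γ) :
    (t.subst f).relabel g = t.subst fun x => (f x).relabel g := by
  induction t with
  | var => rfl
  | func f ts ih => simp [ih]

theorem term_subst_congr [DecidableEq α] {t : L.Term α} {f g : α → L.Term β}
    (h : ∀ x ∈ t.varFinset, f x = g x) : t.subst f = t.subst g := by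
  induction t with
  | var => exact h _ (by simp)
  | func F ts ih =>
    simp only [Term.subst, Term.func.injEq, heq_eq_eq, true_and]
    funext i
    exact ih i fun x hx => h x (by simpa using ⟨i, hx⟩)

theorem term_subst_congr_left [DecidableEq α] {t : L.Term (α ⊕ β)} {f g : α ⊕ β → L.Term γ}
    (h : ∀ x ∈ t.varFinsetLeft, f (Sum.inl x) = g (Sum.inl x))
    (h' : ∀ i, f (Sum.inr i) = g (Sum.inr i)) : t.subst f = t.subst g := by
  induction t with
  | var x =>
    cases x with
    | inl x => exact h _ (by simp)
    | inr i => exact h' i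
  | func F ts ih =>
    simp only [Term.subst, Term.func.injEq, heq_eq_eq, true_and]
    funext i
    exact ih i fun x hx => h x (by simpa using ⟨i, hx⟩)

theorem mem_varFinset_subst [DecidableEq α] [DecidableEq β] {t : L.Term α} {f : α → L.Term β}
    {y : β} : y ∈ (t.subst f).varFinset ↔ ∃ x ∈ t.varFinset, y ∈ (f x).varFinset := by
  induction t with
  | var => simp
  | func F ts ih => simp only [Term.subst, Term.varFinset, Finset.mem_biUnion, ih]; aesop

theorem mem_varFinsetLeft_subst [DecidableEq α] [DecidableEq γ] {δ : Type*}
    {t : L.Term (α ⊕ β)} {f : α ⊕ β → L.Term (γ ⊕ δ)} {y : γ} :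
    y ∈ (t.subst f).varFinsetLeft → (∃ x ∈ t.varFinsetLeft, y ∈ (f (Sum.inl x)).varFinsetLeft) ∨
      ∃ i, y ∈ (f (Sum.inr i)).varFinsetLeft := by
  induction t with
  | var x =>
    cases x with
    | inl x => intro h; left; exact ⟨x, by simp, h⟩
    | inr i => intro h; right; exact ⟨i, h⟩
  | func F ts ih =>
    simp only [Term.subst, Term.varFinsetLeft, Finset.mem_biUnion, Finset.mem_univ, true_and]
    rintro ⟨i, hi⟩
    rcases ih i hi with ⟨x, hx, hy⟩ | h
    · exact Or.inl ⟨x, ⟨i, hx⟩, hy⟩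
    · exact Or.inr h

theorem varFinsetLeft_relabel_map [DecidableEq α] {δ : Type*} (t : L.Term (α ⊕ β)) (f : β → δ) :
    (t.relabel (Sum.map id f)).varFinsetLeft = t.varFinsetLeft := by
  induction t with
  | var x => cases x <;> simp
  | func F ts ih => simp [ih]

theorem varFinsetLeft_emb (t : L.Term ℕ) : (emb t).varFinsetLeft = t.varFinset := by
  induction t with
  | var x => simp [emb]
  | func F ts ih => simp only [emb] at ih; simp [emb, ih]

theorem emb_subst_emb (t : L.Term ℕ) (σ : ℕ → L.Term ℕ) (τ : ℕ ⊕ Fin 0 → L.Term (ℕ ⊕ Fin 0))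
    (h : ∀ x ∈ t.varFinset, τ (Sum.inl x) = emb (σ x)) : (emb t).subst τ = emb (t.subst σ) := by
  rw [emb, term_relabel_subst, emb, term_subst_relabel]
  exact term_subst_congr h

end Terms

/-! ### Substitutions -/

namespace Sub

variable {n m k : ℕ}

/-- Composition of substitutions. -/
def comp (σ : Sub L n m) (τ : Sub L m k) : Sub L n k := fun x => (σ x).subst τ

theorem comp_assoc {l : ℕ} (σ : Sub L n m) (τ : Sub L m k) (υ : Sub L k l) :
    (σ.comp τ).comp υ = σ.comp (τ.comp υ) := by
  funext x
  exact term_subst_subst _ _ _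

/-- The identity substitution. -/
def ident (n : ℕ) : Sub L n n := Term.var

theorem relabel_lift (t : L.Term (ℕ ⊕ Fin m)) (τ : Sub L m k) :
    (t.relabel (Sum.map id Fin.succ)).subst τ.lift =
      (t.subst τ).relabel (Sum.map id Fin.succ) := by
  rw [term_relabel_subst, term_subst_relabel]
  congr 1
  funext x
  cases x <;> rfl

theorem lift_comp (σ : Sub L n m) (τ : Sub L m k) : (σ.comp τ).lift = σ.lift.comp τ.lift := by
  funext x
  cases x with
  | inl x => exact (relabel_lift _ _).symm
  | inr i =>
    refine Fin.cases rfl (fun j => ?_) i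
    exact (relabel_lift _ _).symm

theorem lift_ident : (ident n : Sub L n n).lift = ident (n + 1) := by
  funext x
  cases x with
  | inl x => rfl
  | inr i => exact Fin.cases rfl (fun j => rfl) i

theorem relabel_inst (t : L.Term (ℕ ⊕ Fin 0)) (s : L.Term (ℕ ⊕ Fin 0)) :
    (t.relabel (Sum.map id Fin.succ)).subst (inst s) = t := by
  rw [term_relabel_subst]
  conv_rhs => rw [← term_subst_var t]
  congr 1
  funext x
  cases x with
  | inl x => rfl
  | inr i => exact i.elim0

theorem lift_inst (σ : Sub L 0 0) (t : L.Term (ℕ ⊕ Fin 0)) (x : ℕ) :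
    (σ.lift.comp (inst t)) (Sum.inl x) = σ (Sum.inl x) := relabel_inst _ _

theorem mem_left_lift_inl {σ : Sub L n m} {x y : ℕ} :
    y ∈ (σ.lift (Sum.inl x)).varFinsetLeft ↔ y ∈ (σ (Sum.inl x)).varFinsetLeft := by
  rw [lift, varFinsetLeft_relabel_map]

theorem mem_left_lift_inr {σ : Sub L n m} {i : Fin (n + 1)} {y : ℕ} :
    y ∈ (σ.lift (Sum.inr i)).varFinsetLeft → ∃ j, y ∈ (σ (Sum.inr j)).varFinsetLeft := by
  refine Fin.cases (fun h => ?_) (fun j h => ?_) i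
  · simp [lift] at h
  · refine ⟨j, ?_⟩
    simpa [lift, varFinsetLeft_relabel_map] using h

/-- Change the value of a substitution at one free variable. -/
def upd (σ : Sub L 0 0) (x : ℕ) (t : L.Term (ℕ ⊕ Fin 0)) : Sub L 0 0 :=
  Function.update σ (Sum.inl x) t

@[simp] theorem upd_self (σ : Sub L 0 0) (x : ℕ) (t : L.Term (ℕ ⊕ Fin 0)) :
    σ.upd x t (Sum.inl x) = t := by simp [upd]

theorem upd_of_ne (σ : Sub L 0 0) {x y : ℕ} (t : L.Term (ℕ ⊕ Fin 0)) (h : y ≠ x) :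
    σ.upd x t (Sum.inl y) = σ (Sum.inl y) := by simp [upd, h]

/-- Binding `x`, pushing `σ` under the binder and instantiating amounts to redirecting `σ` at `x`.
With this, quantifiers over named variables can be treated without mentioning de Bruijn indices. -/
theorem close_lift_inst (σ : Sub L 0 0) (x : ℕ) (t : L.Term (ℕ ⊕ Fin 0)) :
    ((close x).comp σ.lift).comp (inst t) = σ.upd x t := by
  funext y
  cases y with
  | inr i => exact i.elim0
  | inl y =>
    by_cases h : y = x
    · subst h; simp [comp, close, lift, inst]
    · rw [upd_of_ne _ _ h, ← lift_inst σ t y]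
      simp [comp, close, h]

theorem close_inst (x : ℕ) (t : L.Term (ℕ ⊕ Fin 0)) :
    (close x).comp (inst t) = (ident 0 : Sub L 0 0).upd x t := by
  rw [← close_lift_inst, lift_ident]
  congr 1
  funext y
  exact (term_subst_var _).symm

theorem upd_ident (x : ℕ) : (ident 0 : Sub L 0 0).upd x (freeVar x) = ident 0 := by
  funext y
  cases y with
  | inr i => exact i.elim0
  | inl y =>
    by_cases h : y = x
    · subst h; simp [freeVar, ident]
    · rw [upd_of_ne _ _ h]

/-- The substitution of formulas given by a substitution of terms. -/
def ofTerms (σ : ℕ → L.Term ℕ) : Sub L 0 0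
  | Sum.inl x => emb (σ x)
  | Sum.inr i => i.elim0

@[simp] theorem ofTerms_inl (σ : ℕ → L.Term ℕ) (x : ℕ) :
    ofTerms σ (Sum.inl x) = emb (σ x) := rfl

end Sub

theorem emb_var (x : ℕ) : emb (Term.var x : L.Term ℕ) = freeVar x := rfl

/-! ### Formulas of intuitionistic logic -/

namespace IForm

theorem subst_subst : ∀ {n : ℕ} (φ : IForm L n) {m k : ℕ} (σ : Sub L n m) (τ : Sub L m k),
    (φ.subst σ).subst τ = φ.subst (σ.comp τ)
  | _, falsum, _, _, _, _ => rfl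
  | _, truth, _, _, _, _ => rfl
  | _, eq t s, _, _, σ, τ => by simp only [subst, term_subst_subst]; rfl
  | _, rel R ts, _, _, σ, τ => by simp only [subst, term_subst_subst]; rfl
  | _, and φ ψ, _, _, σ, τ => by simp [subst, subst_subst φ, subst_subst ψ]
  | _, or φ ψ, _, _, σ, τ => by simp [subst, subst_subst φ, subst_subst ψ]
  | _, imp φ ψ, _, _, σ, τ => by simp [subst, subst_subst φ, subst_subst ψ]
  | _, all φ, _, _, σ, τ => by simp [subst, subst_subst φ, Sub.lift_comp]
  | _, ex φ, _, _, σ, τ => by simp [subst, subst_subst φ, Sub.lift_comp]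

theorem subst_ident : ∀ {n : ℕ} (φ : IForm L n), φ.subst (Sub.ident n) = φ
  | _, falsum => rfl
  | _, truth => rfl
  | _, eq t s => by simp [subst, Sub.ident, term_subst_var]
  | _, rel R ts => by simp [subst, Sub.ident, term_subst_var]
  | _, and φ ψ => by simp [subst, subst_ident φ, subst_ident ψ]
  | _, or φ ψ => by simp [subst, subst_ident φ, subst_ident ψ]
  | _, imp φ ψ => by simp [subst, subst_ident φ, subst_ident ψ]
  | _, all φ => by simp [subst, Sub.lift_ident, subst_ident φ]
  | _, ex φ => by simp [subst, Sub.lift_ident, subst_ident φ]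

theorem lift_agree {n m : ℕ} {σ τ : Sub L n m} (h' : ∀ i, σ (Sum.inr i) = τ (Sum.inr i)) :
    ∀ i, σ.lift (Sum.inr i) = τ.lift (Sum.inr i) := by
  intro i
  refine Fin.cases rfl (fun j => ?_) i
  simp [Sub.lift, h']

theorem subst_congr : ∀ {n : ℕ} (φ : IForm L n) {m : ℕ} {σ τ : Sub L n m},
    (∀ x ∈ φ.fv, σ (Sum.inl x) = τ (Sum.inl x)) → (∀ i, σ (Sum.inr i) = τ (Sum.inr i)) →
    φ.subst σ = φ.subst τ
  | _, falsum, _, _, _, _, _ => rfl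
  | _, truth, _, _, _, _, _ => rfl
  | _, eq t s, _, σ, τ, h, h' => by
      rw [subst, subst, term_subst_congr_left (fun x hx => h x (by simp [fv, hx])) h',
        term_subst_congr_left (fun x hx => h x (by simp [fv, hx])) h']
  | _, rel R ts, _, σ, τ, h, h' => by
      rw [subst, subst]
      congr 1
      funext i
      exact term_subst_congr_left (fun x hx => h x (by simpa [fv] using ⟨i, hx⟩)) h'
  | _, and φ ψ, _, σ, τ, h, h' => by
      rw [subst, subst, subst_congr φ (fun x hx => h x (by simp [fv, hx])) h',
        subst_congr ψ (fun x hx => h x (by simp [fv, hx])) h']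
  | _, or φ ψ, _, σ, τ, h, h' => by
      rw [subst, subst, subst_congr φ (fun x hx => h x (by simp [fv, hx])) h',
        subst_congr ψ (fun x hx => h x (by simp [fv, hx])) h']
  | _, imp φ ψ, _, σ, τ, h, h' => by
      rw [subst, subst, subst_congr φ (fun x hx => h x (by simp [fv, hx])) h',
        subst_congr ψ (fun x hx => h x (by simp [fv, hx])) h']
  | _, all φ, _, σ, τ, h, h' => by
      rw [subst, subst, subst_congr φ (fun x hx => by simp [Sub.lift, h x hx]) (lift_agree h')]
  | _, ex φ, _, σ, τ, h, h' => by
      rw [subst, subst, subst_congr φ (fun x hx => by simp [Sub.lift, h x hx]) (lift_agree h')]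

theorem subst_congr₀ (φ : IForm L 0) {m : ℕ} {σ τ : Sub L 0 m}
    (h : ∀ x ∈ φ.fv, σ (Sum.inl x) = τ (Sum.inl x)) : φ.subst σ = φ.subst τ :=
  subst_congr φ h fun i => i.elim0

theorem mem_fv_subst : ∀ {n : ℕ} {φ : IForm L n} {m : ℕ} {σ : Sub L n m} {y : ℕ},
    y ∈ (φ.subst σ).fv → (∃ x ∈ φ.fv, y ∈ (σ (Sum.inl x)).varFinsetLeft) ∨
      ∃ i, y ∈ (σ (Sum.inr i)).varFinsetLeft
  | _, falsum, _, _, _, h => by simp [subst, fv] at h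
  | _, truth, _, _, _, h => by simp [subst, fv] at h
  | _, eq t s, _, σ, y, h => by
      simp only [subst, fv, Finset.mem_union] at h ⊢
      rcases h with h | h <;> rcases mem_varFinsetLeft_subst h with ⟨x, hx, hy⟩ | h
      exacts [Or.inl ⟨x, Or.inl hx, hy⟩, Or.inr h, Or.inl ⟨x, Or.inr hx, hy⟩, Or.inr h]
  | _, rel R ts, _, σ, y, h => by
      simp only [subst, fv, Finset.mem_biUnion, Finset.mem_univ, true_and] at h ⊢
      obtain ⟨i, h⟩ := h
      rcases mem_varFinsetLeft_subst h with ⟨x, hx, hy⟩ | h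
      exacts [Or.inl ⟨x, ⟨i, hx⟩, hy⟩, Or.inr h]
  | _, and φ ψ, _, σ, y, h => by
      simp only [subst, fv, Finset.mem_union] at h ⊢
      rcases h with h | h <;> rcases mem_fv_subst h with ⟨x, hx, hy⟩ | h
      exacts [Or.inl ⟨x, Or.inl hx, hy⟩, Or.inr h, Or.inl ⟨x, Or.inr hx, hy⟩, Or.inr h]
  | _, or φ ψ, _, σ, y, h => by
      simp only [subst, fv, Finset.mem_union] at h ⊢
      rcases h with h | h <;> rcases mem_fv_subst h with ⟨x, hx, hy⟩ | h
      exacts [Or.inl ⟨x, Or.inl hx, hy⟩, Or.inr h, Or.inl ⟨x, Or.inr hx, hy⟩, Or.inr h]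
  | _, imp φ ψ, _, σ, y, h => by
      simp only [subst, fv, Finset.mem_union] at h ⊢
      rcases h with h | h <;> rcases mem_fv_subst h with ⟨x, hx, hy⟩ | h
      exacts [Or.inl ⟨x, Or.inl hx, hy⟩, Or.inr h, Or.inl ⟨x, Or.inr hx, hy⟩, Or.inr h]
  | _, all φ, _, σ, y, h => by
      simp only [subst, fv] at h ⊢
      rcases mem_fv_subst h with ⟨x, hx, hy⟩ | ⟨i, h⟩
      exacts [Or.inl ⟨x, hx, Sub.mem_left_lift_inl.1 hy⟩, Or.inr (Sub.mem_left_lift_inr h)]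
  | _, ex φ, _, σ, y, h => by
      simp only [subst, fv] at h ⊢
      rcases mem_fv_subst h with ⟨x, hx, hy⟩ | ⟨i, h⟩
      exacts [Or.inl ⟨x, hx, Sub.mem_left_lift_inl.1 hy⟩, Or.inr (Sub.mem_left_lift_inr h)]

theorem fv_subst_close {x y : ℕ} {φ : IForm L 0} (h : y ∈ (φ.subst (Sub.close x)).fv) :
    y ∈ φ.fv ∧ y ≠ x := by
  rcases mem_fv_subst h with ⟨z, hz, hy⟩ | ⟨i, _⟩
  · by_cases hzx : z = x
    · simp [Sub.close, hzx] at hy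
    · simp [Sub.close, hzx] at hy
      subst hy
      exact ⟨hz, hzx⟩
  · exact i.elim0

theorem fv_foldr_exVar {l : List ℕ} {φ : IForm L 0} {y : ℕ} (h : y ∈ (l.foldr exVar φ).fv) :
    y ∈ φ.fv ∧ y ∉ l := by
  induction l with
  | nil => exact ⟨h, by simp⟩
  | cons x l ih =>
    obtain ⟨h, hx⟩ := fv_subst_close h
    have := ih h
    exact ⟨this.1, by simp [hx, this.2]⟩

theorem fv_foldr_allVar {l : List ℕ} {φ : IForm L 0} {y : ℕ} (h : y ∈ (l.foldr allVar φ).fv) :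
    y ∈ φ.fv ∧ y ∉ l := by
  induction l with
  | nil => exact ⟨h, by simp⟩
  | cons x l ih =>
    obtain ⟨h, hx⟩ := fv_subst_close h
    have := ih h
    exact ⟨this.1, by simp [hx, this.2]⟩

theorem fv_exSet {s : Finset ℕ} {φ : IForm L 0} {y : ℕ} (h : y ∈ (exSet s φ).fv) :
    y ∈ φ.fv ∧ y ∉ s := by
  have := fv_foldr_exVar h
  simpa using this

theorem fv_allClosure (φ : IForm L 0) : φ.allClosure.fv = ∅ := by
  refine Finset.eq_empty_of_forall_notMem fun y hy => ?_
  have := fv_foldr_allVar hy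
  simp at this

theorem fv_exClosure (φ : IForm L 0) : φ.exClosure.fv = ∅ := by
  refine Finset.eq_empty_of_forall_notMem fun y hy => ?_
  have := fv_exSet hy
  simp at this

theorem inst_subst (φ : IForm L 1) (t : L.Term (ℕ ⊕ Fin 0)) (σ : Sub L 0 0) :
    (φ.inst t).subst σ = (φ.subst σ.lift).inst (t.subst σ) := by
  rw [inst, inst, subst_subst, subst_subst]
  congr 1
  funext x
  cases x with
  | inl x => exact (Sub.lift_inst σ _ x).symm
  | inr i => rw [Subsingleton.elim i 0]; rfl

/-- As `a` does not occur in `φ`, the substitution may be redirected at `a` freely. This renames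
eigenvariables when a substitution is pushed through a quantifier rule. -/
theorem inst_freeVar_subst {φ : IForm L 1} {a : ℕ} (ha : a ∉ φ.fv) (σ : Sub L 0 0)
    (t : L.Term (ℕ ⊕ Fin 0)) :
    (φ.inst (freeVar a)).subst (σ.upd a t) = (φ.subst σ.lift).inst t := by
  rw [inst, inst, subst_subst, subst_subst]
  apply subst_congr
  · intro x hx
    have : x ≠ a := fun h => ha (h ▸ hx)
    rw [Sub.lift_inst]
    simp [Sub.comp, Sub.inst, Sub.upd_of_ne _ _ this]
  · intro i
    rw [Subsingleton.elim i 0]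
    simp [Sub.comp, Sub.inst, freeVar, Sub.lift]

theorem exVar_subst_inst (φ : IForm L 0) (x : ℕ) (σ : Sub L 0 0) (t : L.Term (ℕ ⊕ Fin 0)) :
    ((φ.subst (Sub.close x)).subst σ.lift).inst t = φ.subst (σ.upd x t) := by
  rw [inst, subst_subst, subst_subst, ← Sub.comp_assoc, Sub.close_lift_inst]

end IForm

/-! ### Derived rules of intuitionistic logic -/

theorem exists_fresh (F : Finset ℕ) : ∃ a, a ∉ F := Infinite.exists_notMem_finset F

/-- Weakening together with substitution. -/
theorem IL.subst {Γ : Set (IForm L 0)} {φ : IForm L 0} (h : IL Γ φ) :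
    ∀ (σ : Sub L 0 0) (Δ : Set (IForm L 0)) (F : Finset ℕ), (∀ ψ ∈ Γ, ψ.subst σ ∈ Δ) →
      (∀ ψ ∈ Δ, ψ.fv ⊆ F) → IL Δ (φ.subst σ) := by
  have ins : ∀ {Γ Δ : Set (IForm L 0)} {σ : Sub L 0 0} (φ : IForm L 0),
      (∀ ψ ∈ Γ, ψ.subst σ ∈ Δ) → ∀ ψ ∈ insert φ Γ, ψ.subst σ ∈ insert (φ.subst σ) Δ := by
    intro Γ Δ σ φ h ψ hψ
    rcases hψ with rfl | hψ
    exacts [Or.inl rfl, Or.inr (h ψ hψ)]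
  have fin : ∀ {Δ : Set (IForm L 0)} {F : Finset ℕ} (φ : IForm L 0),
      (∀ ψ ∈ Δ, ψ.fv ⊆ F) → ∀ ψ ∈ insert φ Δ, ψ.fv ⊆ φ.fv ∪ F := by
    intro Δ F φ h ψ hψ
    rcases hψ with rfl | hψ
    exacts [Finset.subset_union_left, (h ψ hψ).trans Finset.subset_union_right]
  have upd : ∀ {Γ Δ : Set (IForm L 0)} {σ : Sub L 0 0} {a : ℕ} (t : L.Term (ℕ ⊕ Fin 0)),
      (∀ ψ ∈ Γ, a ∉ ψ.fv) → (∀ ψ ∈ Γ, ψ.subst σ ∈ Δ) → ∀ ψ ∈ Γ, ψ.subst (σ.upd a t) ∈ Δ := by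
    intro Γ Δ σ a t ha h ψ hψ
    rw [IForm.subst_congr₀ (τ := σ)]
    · exact h ψ hψ
    · intro x hx
      exact Sub.upd_of_ne _ _ fun e => ha ψ hψ (e ▸ hx)
  induction h with
  | hyp h => exact fun σ Δ F hΔ _ => .hyp (hΔ _ h)
  | truthI => exact fun σ Δ F _ _ => .truthI
  | falsumE _ ih => exact fun σ Δ F h₁ h₂ => .falsumE (ih σ Δ F h₁ h₂)
  | andI _ _ ih₁ ih₂ => exact fun σ Δ F h₁ h₂ => .andI (ih₁ σ Δ F h₁ h₂) (ih₂ σ Δ F h₁ h₂)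
  | andE1 _ ih => exact fun σ Δ F h₁ h₂ => .andE1 (ih σ Δ F h₁ h₂)
  | andE2 _ ih => exact fun σ Δ F h₁ h₂ => .andE2 (ih σ Δ F h₁ h₂)
  | orI1 _ ih => exact fun σ Δ F h₁ h₂ => .orI1 (ih σ Δ F h₁ h₂)
  | orI2 _ ih => exact fun σ Δ F h₁ h₂ => .orI2 (ih σ Δ F h₁ h₂)
  | orE _ _ _ ih ih₁ ih₂ =>
    exact fun σ Δ F h₁ h₂ => .orE (ih σ Δ F h₁ h₂) (ih₁ σ _ _ (ins _ h₁) (fin _ h₂))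
      (ih₂ σ _ _ (ins _ h₁) (fin _ h₂))
  | impI _ ih => exact fun σ Δ F h₁ h₂ => .impI (ih σ _ _ (ins _ h₁) (fin _ h₂))
  | impE _ _ ih₁ ih₂ => exact fun σ Δ F h₁ h₂ => .impE (ih₁ σ Δ F h₁ h₂) (ih₂ σ Δ F h₁ h₂)
  | @allI Γ φ a ha hΓ _ ih =>
    intro σ Δ F h₁ h₂
    -- `Δ` may be infinite; the finite bound `F` on its free variables guarantees a new
    -- eigenvariable.
    obtain ⟨b, hb⟩ := exists_fresh (F ∪ (φ.subst σ.lift).fv)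
    rw [Finset.mem_union, not_or] at hb
    refine .allI b hb.2 (fun ψ hψ h => hb.1 (h₂ ψ hψ h)) ?_
    rw [← IForm.inst_freeVar_subst ha]
    exact ih _ _ F (upd _ hΓ h₁) h₂
  | allE t _ ih =>
    intro σ Δ F h₁ h₂
    rw [IForm.inst_subst]
    exact .allE _ (ih σ Δ F h₁ h₂)
  | exI t _ ih =>
    intro σ Δ F h₁ h₂
    refine .exI (t.subst σ) ?_
    rw [← IForm.inst_subst]
    exact ih σ Δ F h₁ h₂
  | @exE Γ φ χ a ha hχ hΓ _ _ ih₁ ih₂ =>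
    intro σ Δ F h₁ h₂
    obtain ⟨b, hb⟩ := exists_fresh (F ∪ ((φ.subst σ.lift).fv ∪ (χ.subst σ).fv))
    simp only [Finset.mem_union, not_or] at hb
    refine .exE b hb.2.1 hb.2.2 (fun ψ hψ h => hb.1 (h₂ ψ hψ h)) (ih₁ σ Δ F h₁ h₂) ?_
    rw [← IForm.inst_freeVar_subst ha]
    have := ih₂ (σ.upd a (freeVar b)) (insert ((φ.inst (freeVar a)).subst (σ.upd a (freeVar b))) Δ)
      _ (ins _ (upd _ hΓ h₁)) (fin _ h₂)
    rwa [IForm.subst_congr₀ χ (τ := σ)] at this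
    intro x hx
    exact Sub.upd_of_ne _ _ fun e => hχ (e ▸ hx)
  | eqRefl t => exact fun σ Δ F _ _ => .eqRefl _
  | eqSubst φ _ _ ih₁ ih₂ =>
    intro σ Δ F h₁ h₂
    rw [IForm.inst_subst]
    refine .eqSubst _ (ih₁ σ Δ F h₁ h₂) ?_
    rw [← IForm.inst_subst]
    exact ih₂ σ Δ F h₁ h₂

theorem IL.weaken {Γ Δ : Set (IForm L 0)} {φ : IForm L 0} (F : Finset ℕ) (h : IL Γ φ)
    (hs : Γ ⊆ Δ) (hF : ∀ ψ ∈ Δ, ψ.fv ⊆ F) : IL Δ φ := by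
  have := h.subst (Sub.ident 0) Δ F (fun ψ hψ => by rw [IForm.subst_ident]; exact hs hψ) hF
  rwa [IForm.subst_ident] at this

/-- All witnesses are supplied at once by `τ`. The substitution `σ` is arbitrary so that the
induction can absorb the quantifiers already instantiated. -/
theorem IL.exVars_intro {Γ : Set (IForm L 0)} {φ : IForm L 0} {τ : Sub L 0 0} (h : IL Γ (φ.subst τ)) :
    ∀ (l : List ℕ) (σ : Sub L 0 0), (∀ x ∉ l, τ (Sum.inl x) = σ (Sum.inl x)) →
      IL Γ ((l.foldr IForm.exVar φ).subst σ)
  | [], σ, hσ => by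
      rw [IForm.subst_congr₀ (τ := σ)] at h
      · exact h
      · exact fun x _ => hσ x (by simp)
  | x :: l, σ, hσ => by
      refine .exI (τ (Sum.inl x)) ?_
      rw [IForm.exVar_subst_inst]
      refine IL.exVars_intro h l _ fun y hy => ?_
      by_cases hyx : y = x
      · subst hyx; rw [Sub.upd_self]
      · rw [Sub.upd_of_ne _ _ hyx]
        exact hσ y (by simp [hy, hyx])

/-! ### Entailment between formulas modulo the constraint theory. -/

namespace ConstraintTheory

variable (CT : ConstraintTheory L User)

/-- Closed assumptions never obstruct an eigenvariable and are fixed by every substitution, so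
weakening and substitution hold relative to the theory. -/
theorem fv_sentences {φ : IForm L 0} (h : φ ∈ CT.sentences) : φ.fv = ∅ := by
  obtain ⟨_, _, _, _, _, _, rfl⟩ := CT.form φ h
  exact IForm.fv_allClosure _

variable {CT}

theorem Entails.weaken {φ : IForm L 0} (h : CT.Entails φ) (ψ : IForm L 0) :
    IL (insert ψ CT.sentences) φ := by
  refine IL.weaken ψ.fv h (Set.subset_insert _ _) ?_
  rintro χ (rfl | hχ)
  exacts [subset_rfl, by simp [CT.fv_sentences hχ]]

theorem Entails.weaken₂ {φ : IForm L 0} (h : CT.Entails φ) (ψ ψ' : IForm L 0) :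
    IL (insert ψ' (insert ψ CT.sentences)) φ := by
  refine IL.weaken (ψ'.fv ∪ ψ.fv) h (fun _ h => Or.inr (Or.inr h)) ?_
  rintro χ (rfl | rfl | hχ)
  exacts [Finset.subset_union_left, Finset.subset_union_right, by simp [CT.fv_sentences hχ]]

theorem Entails.subst {φ : IForm L 0} (h : CT.Entails φ) (σ : Sub L 0 0) :
    CT.Entails (φ.subst σ) := by
  refine IL.subst h σ _ ∅ (fun ψ hψ => ?_) (fun ψ hψ => by simp [CT.fv_sentences hψ])
  rw [IForm.subst_congr₀ (τ := Sub.ident 0), IForm.subst_ident]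
  · exact hψ
  · simp [CT.fv_sentences hψ]

/-- Entailment between two formulas, relative to the constraint theory. -/
def Le (CT : ConstraintTheory L User) (φ ψ : IForm L 0) : Prop := CT.Entails (φ.imp ψ)

theorem Le.refl (φ : IForm L 0) : CT.Le φ φ := .impI (.hyp (Or.inl rfl))

theorem Le.IL {φ ψ : IForm L 0} (h : CT.Le φ ψ) : IL (insert φ CT.sentences) ψ :=
  .impE (Entails.weaken h φ) (.hyp (Or.inl rfl))

theorem Le.mp {φ ψ χ : IForm L 0} (h : CT.Le ψ χ) (h' : CHRV.IL (insert φ CT.sentences) ψ) :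
    CHRV.IL (insert φ CT.sentences) χ := .impE (Entails.weaken h φ) h'

theorem Le.trans {φ ψ χ : IForm L 0} (h : CT.Le φ ψ) (h' : CT.Le ψ χ) : CT.Le φ χ :=
  .impI (h'.mp h.IL)

theorem Le.and_left (φ ψ : IForm L 0) : CT.Le (φ.and ψ) φ := .impI (.andE1 (.hyp (Or.inl rfl)))

theorem Le.and_right (φ ψ : IForm L 0) : CT.Le (φ.and ψ) ψ := .impI (.andE2 (.hyp (Or.inl rfl)))

theorem Le.and {φ ψ χ : IForm L 0} (h : CT.Le φ ψ) (h' : CT.Le φ χ) : CT.Le φ (ψ.and χ) :=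
  .impI (.andI h.IL h'.IL)

theorem Le.truth (φ : IForm L 0) : CT.Le φ IForm.truth := .impI .truthI

theorem Le.falsum (φ : IForm L 0) : CT.Le IForm.falsum φ := .impI (.falsumE (.hyp (Or.inl rfl)))

theorem Le.subst {φ ψ : IForm L 0} (h : CT.Le φ ψ) (σ : Sub L 0 0) :
    CT.Le (φ.subst σ) (ψ.subst σ) := Entails.subst h σ

theorem Le.ex {φ : IForm L 1} {χ : IForm L 0} {a : ℕ} (ha : a ∉ φ.fv) (hχ : a ∉ χ.fv)
    (h : CT.Le (φ.inst (freeVar a)) χ) : CT.Le φ.ex χ := by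
  refine .impI (.exE a ha hχ ?_ (.hyp (Or.inl rfl)) (.impE (Entails.weaken₂ h _ _) (.hyp (Or.inl rfl))))
  rintro ψ (rfl | hψ)
  exacts [ha, by simp [CT.fv_sentences hψ]]

/-- Here `ρ` names the eigenvariables, and `τ` follows `ρ` on `l` and `σ` elsewhere. A renaming
other than the identity is needed when the terms introduced by `σ` may contain the quantified names;
the last hypothesis keeps the eigenvariables out of those terms. -/
theorem Le.exVars_elim {φ χ : IForm L 0} {τ : Sub L 0 0} {ρ : ℕ → ℕ} (h : CT.Le (φ.subst τ) χ) :
    ∀ (l : List ℕ) (σ : Sub L 0 0), l.Nodup → (∀ x ∉ l, τ (Sum.inl x) = σ (Sum.inl x)) →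
      (∀ x ∈ l, τ (Sum.inl x) = freeVar (ρ x)) → (∀ x ∈ l, ∀ y ∈ l, ρ x = ρ y → x = y) →
      (∀ x ∈ l, ρ x ∉ χ.fv) →
      (∀ x ∈ l, ∀ z ∈ φ.fv, z ∉ l → ρ x ∉ (σ (Sum.inl z)).varFinsetLeft) →
      CT.Le ((l.foldr IForm.exVar φ).subst σ) χ
  | [], σ, _, hσ, _, _, _, _ => by
      rw [IForm.subst_congr₀ (τ := σ)] at h
      · exact h
      · exact fun x _ => hσ x (by simp)
  | x :: l, σ, hl, hσ, hρ, hinj, hχ, hfr => by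
      rw [List.nodup_cons] at hl
      refine Le.ex (a := ρ x) ?_ (hχ x (by simp)) ?_
      · intro hmem
        have hmem : ρ x ∈ ((IForm.exVar x (l.foldr IForm.exVar φ)).subst σ).fv := hmem
        rcases IForm.mem_fv_subst hmem with ⟨z, hz, hy⟩ | ⟨i, _⟩
        · have hz' : z ∈ ((x :: l).foldr IForm.exVar φ).fv := hz
          have hz' := IForm.fv_foldr_exVar hz'
          exact hfr x (by simp) z hz'.1 hz'.2 hy
        · exact i.elim0
      · rw [IForm.exVar_subst_inst]
        refine Le.exVars_elim h l _ hl.2 (fun y hy => ?_) (fun y hy => hρ y (by simp [hy]))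
          (fun y hy z hz => hinj y (by simp [hy]) z (by simp [hz]))
          (fun y hy => hχ y (by simp [hy])) (fun y hy z hz hzl => ?_)
        · by_cases hyx : y = x
          · subst hyx; rw [Sub.upd_self]; exact hρ y (by simp)
          · rw [Sub.upd_of_ne _ _ hyx]
            exact hσ y (by simp [hy, hyx])
        · by_cases hzx : z = x
          · subst hzx
            rw [Sub.upd_self]
            simp only [freeVar, Term.varFinsetLeft, Finset.mem_singleton]
            intro e
            -- The eigenvariable just substituted for `z` differs from those still to come: `ρ` is
            -- injective on the list and the list has no repetitions.
            exact hl.1 (hinj y (by simp [hy]) z (by simp) e ▸ hy)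
          · rw [Sub.upd_of_ne _ _ hzx]
            exact hfr y (by simp [hy]) z hz (by simp [hzx, hzl])

theorem Le.exSet_subst_intro {φ ψ : IForm L 0} {σ τ : Sub L 0 0} {s : Finset ℕ}
    (h : CT.Le φ (ψ.subst τ)) (hτ : ∀ x ∉ s, τ (Sum.inl x) = σ (Sum.inl x)) :
    CT.Le φ ((IForm.exSet s ψ).subst σ) :=
  .impI (CHRV.IL.exVars_intro h.IL _ σ fun x hx => hτ x (by simpa using hx))

theorem Le.exSet_intro {φ ψ : IForm L 0} (s : Finset ℕ) (τ : Sub L 0 0)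
    (h : CT.Le φ (ψ.subst τ)) (hτ : ∀ x ∉ s, τ (Sum.inl x) = freeVar x) :
    CT.Le φ (IForm.exSet s ψ) := by
  rw [← IForm.subst_ident (IForm.exSet s ψ)]
  exact Le.exSet_subst_intro h hτ

theorem Le.exSet_self {φ ψ : IForm L 0} (s : Finset ℕ) (h : CT.Le φ ψ) :
    CT.Le φ (IForm.exSet s ψ) :=
  Le.exSet_intro s (Sub.ident 0) (by rwa [IForm.subst_ident]) fun _ _ => rfl

theorem Le.exSet_elim {φ χ : IForm L 0} {s : Finset ℕ} (h : CT.Le φ χ)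
    (hs : ∀ x ∈ s, x ∉ χ.fv) : CT.Le (IForm.exSet s φ) χ := by
  rw [← IForm.subst_ident φ] at h
  rw [← IForm.subst_ident (IForm.exSet s φ)]
  refine Le.exVars_elim (ρ := id) h _ _ (Finset.sort_nodup _ _) (fun _ _ => rfl) (fun _ _ => rfl)
    (fun _ _ _ _ e => e) (fun x hx => hs x (by simpa using hx)) (fun x hx z _ hz => ?_)
  simp only [Sub.ident, id, Term.varFinsetLeft, Finset.mem_singleton]
  rintro rfl
  exact hz hx

end ConstraintTheory

/-! ### Formulas of linear logic -/

namespace LForm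

theorem subst_subst : ∀ {n : ℕ} (α : LForm L User n) {m k : ℕ} (σ : Sub L n m) (τ : Sub L m k),
    (α.subst σ).subst τ = α.subst (σ.comp τ)
  | _, user c ts, _, _, σ, τ => by simp only [subst, term_subst_subst]; rfl
  | _, rel R ts, _, _, σ, τ => by simp only [subst, term_subst_subst]; rfl
  | _, eq t s, _, _, σ, τ => by simp only [subst, term_subst_subst]; rfl
  | _, one, _, _, _, _ => rfl
  | _, zero, _, _, _, _ => rfl
  | _, top, _, _, _, _ => rfl
  | _, tensor α β, _, _, σ, τ => by simp [subst, subst_subst α, subst_subst β]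
  | _, lolli α β, _, _, σ, τ => by simp [subst, subst_subst α, subst_subst β]
  | _, amp α β, _, _, σ, τ => by simp [subst, subst_subst α, subst_subst β]
  | _, plus α β, _, _, σ, τ => by simp [subst, subst_subst α, subst_subst β]
  | _, bang α, _, _, σ, τ => by simp [subst, subst_subst α]
  | _, all α, _, _, σ, τ => by simp [subst, subst_subst α, Sub.lift_comp]
  | _, ex α, _, _, σ, τ => by simp [subst, subst_subst α, Sub.lift_comp]

theorem subst_ident : ∀ {n : ℕ} (α : LForm L User n), α.subst (Sub.ident n) = α
  | _, user c ts => by simp [subst, Sub.ident, term_subst_var]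
  | _, rel R ts => by simp [subst, Sub.ident, term_subst_var]
  | _, eq t s => by simp [subst, Sub.ident, term_subst_var]
  | _, one => rfl
  | _, zero => rfl
  | _, top => rfl
  | _, tensor α β => by simp [subst, subst_ident α, subst_ident β]
  | _, lolli α β => by simp [subst, subst_ident α, subst_ident β]
  | _, amp α β => by simp [subst, subst_ident α, subst_ident β]
  | _, plus α β => by simp [subst, subst_ident α, subst_ident β]
  | _, bang α => by simp [subst, subst_ident α]
  | _, all α => by simp [subst, Sub.lift_ident, subst_ident α]
  | _, ex α => by simp [subst, Sub.lift_ident, subst_ident α]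

theorem mem_fv_subst : ∀ {n : ℕ} {α : LForm L User n} {m : ℕ} {σ : Sub L n m} {y : ℕ},
    y ∈ (α.subst σ).fv → (∃ x ∈ α.fv, y ∈ (σ (Sum.inl x)).varFinsetLeft) ∨
      ∃ i, y ∈ (σ (Sum.inr i)).varFinsetLeft
  | _, one, _, _, _, h => by simp [subst, fv] at h
  | _, zero, _, _, _, h => by simp [subst, fv] at h
  | _, top, _, _, _, h => by simp [subst, fv] at h
  | _, eq t s, _, σ, y, h => by
      simp only [subst, fv, Finset.mem_union] at h ⊢
      rcases h with h | h <;> rcases mem_varFinsetLeft_subst h with ⟨x, hx, hy⟩ | h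
      exacts [Or.inl ⟨x, Or.inl hx, hy⟩, Or.inr h, Or.inl ⟨x, Or.inr hx, hy⟩, Or.inr h]
  | _, rel R ts, _, σ, y, h => by
      simp only [subst, fv, Finset.mem_biUnion, Finset.mem_univ, true_and] at h ⊢
      obtain ⟨i, h⟩ := h
      rcases mem_varFinsetLeft_subst h with ⟨x, hx, hy⟩ | h
      exacts [Or.inl ⟨x, ⟨i, hx⟩, hy⟩, Or.inr h]
  | _, user R ts, _, σ, y, h => by
      simp only [subst, fv, Finset.mem_biUnion, Finset.mem_univ, true_and] at h ⊢
      obtain ⟨i, h⟩ := h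
      rcases mem_varFinsetLeft_subst h with ⟨x, hx, hy⟩ | h
      exacts [Or.inl ⟨x, ⟨i, hx⟩, hy⟩, Or.inr h]
  | _, tensor α β, _, σ, y, h => by
      simp only [subst, fv, Finset.mem_union] at h ⊢
      rcases h with h | h <;> rcases mem_fv_subst h with ⟨x, hx, hy⟩ | h
      exacts [Or.inl ⟨x, Or.inl hx, hy⟩, Or.inr h, Or.inl ⟨x, Or.inr hx, hy⟩, Or.inr h]
  | _, lolli α β, _, σ, y, h => by
      simp only [subst, fv, Finset.mem_union] at h ⊢
      rcases h with h | h <;> rcases mem_fv_subst h with ⟨x, hx, hy⟩ | h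
      exacts [Or.inl ⟨x, Or.inl hx, hy⟩, Or.inr h, Or.inl ⟨x, Or.inr hx, hy⟩, Or.inr h]
  | _, amp α β, _, σ, y, h => by
      simp only [subst, fv, Finset.mem_union] at h ⊢
      rcases h with h | h <;> rcases mem_fv_subst h with ⟨x, hx, hy⟩ | h
      exacts [Or.inl ⟨x, Or.inl hx, hy⟩, Or.inr h, Or.inl ⟨x, Or.inr hx, hy⟩, Or.inr h]
  | _, plus α β, _, σ, y, h => by
      simp only [subst, fv, Finset.mem_union] at h ⊢
      rcases h with h | h <;> rcases mem_fv_subst h with ⟨x, hx, hy⟩ | h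
      exacts [Or.inl ⟨x, Or.inl hx, hy⟩, Or.inr h, Or.inl ⟨x, Or.inr hx, hy⟩, Or.inr h]
  | _, bang α, _, σ, y, h => by
      simp only [subst, fv] at h ⊢
      exact mem_fv_subst h
  | _, all α, _, σ, y, h => by
      simp only [subst, fv] at h ⊢
      rcases mem_fv_subst h with ⟨x, hx, hy⟩ | ⟨i, h⟩
      exacts [Or.inl ⟨x, hx, Sub.mem_left_lift_inl.1 hy⟩, Or.inr (Sub.mem_left_lift_inr h)]
  | _, ex α, _, σ, y, h => by
      simp only [subst, fv] at h ⊢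
      rcases mem_fv_subst h with ⟨x, hx, hy⟩ | ⟨i, h⟩
      exacts [Or.inl ⟨x, hx, Sub.mem_left_lift_inl.1 hy⟩, Or.inr (Sub.mem_left_lift_inr h)]

theorem fv_subst_close {x y : ℕ} {α : LForm L User 0} (h : y ∈ (α.subst (Sub.close x)).fv) :
    y ∈ α.fv ∧ y ≠ x := by
  rcases mem_fv_subst h with ⟨z, hz, hy⟩ | ⟨i, _⟩
  · by_cases hzx : z = x
    · simp [Sub.close, hzx] at hy
    · simp [Sub.close, hzx] at hy
      subst hy
      exact ⟨hz, hzx⟩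
  · exact i.elim0

theorem fv_foldr_exVar {l : List ℕ} {α : LForm L User 0} {y : ℕ}
    (h : y ∈ (l.foldr exVar α).fv) : y ∈ α.fv ∧ y ∉ l := by
  induction l with
  | nil => exact ⟨h, by simp⟩
  | cons x l ih =>
    obtain ⟨h, hx⟩ := fv_subst_close h
    have := ih h
    exact ⟨this.1, by simp [hx, this.2]⟩

theorem fv_exSet {s : Finset ℕ} {α : LForm L User 0} {y : ℕ} (h : y ∈ (exSet s α).fv) :
    y ∈ α.fv ∧ y ∉ s := by
  have := fv_foldr_exVar h
  simpa using this

theorem exVar_inst (α : LForm L User 0) (x : ℕ) (t : L.Term (ℕ ⊕ Fin 0)) :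
    (α.subst (Sub.close x)).inst t = α.subst ((Sub.ident 0).upd x t) := by
  rw [inst, subst_subst, Sub.close_inst]

theorem exVar_inst_self (α : LForm L User 0) (x : ℕ) :
    (α.subst (Sub.close x)).inst (freeVar x) = α := by
  rw [exVar_inst, Sub.upd_ident, subst_ident]

@[simp] theorem exSet_empty (α : LForm L User 0) : exSet ∅ α = α := by simp [exSet]

end LForm

@[simp] theorem IForm.exSet_empty (φ : IForm L 0) : exSet ∅ φ = φ := by simp [exSet]

/-! ### Goals -/

namespace Goal

theorem mem_vars_subst {σ : ℕ → L.Term ℕ} {y : ℕ} : ∀ {G : Goal L User},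
    y ∈ (G.subst σ).vars ↔ ∃ x ∈ G.vars, y ∈ (σ x).varFinset
  | top => by simp [subst, vars]
  | bot => by simp [subst, vars]
  | user _ ts => by
      simp only [subst, vars, Finset.mem_biUnion, Finset.mem_univ, true_and, mem_varFinset_subst]
      aesop
  | rel _ ts => by
      simp only [subst, vars, Finset.mem_biUnion, Finset.mem_univ, true_and, mem_varFinset_subst]
      aesop
  | eq t s => by
      simp only [subst, vars, Finset.mem_union, mem_varFinset_subst]
      aesop
  | and G G' => by
      simp only [subst, vars, Finset.mem_union, mem_vars_subst]
      aesop
  | or G G' => by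
      simp only [subst, vars, Finset.mem_union, mem_vars_subst]
      aesop

theorem fv_toL : ∀ G : Goal L User, G.toL.fv = G.vars
  | top => rfl
  | bot => rfl
  | user _ ts => by simp [toL, LForm.fv, vars, varFinsetLeft_emb]
  | rel _ ts => by simp [toL, LForm.fv, vars, varFinsetLeft_emb]
  | eq t s => by simp [toL, LForm.fv, vars, varFinsetLeft_emb]
  | and G G' => by simp [toL, LForm.fv, vars, fv_toL G, fv_toL G']
  | or G G' => by simp [toL, LForm.fv, vars, fv_toL G, fv_toL G']

theorem fv_toI : ∀ G : Goal L User, G.toI.fv ⊆ G.vars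
  | top => by simp [toI, IForm.fv]
  | bot => by simp [toI, IForm.fv]
  | user _ ts => by simp [toI, IForm.fv]
  | rel _ ts => by simp [toI, IForm.fv, vars, varFinsetLeft_emb]
  | eq t s => by simp [toI, IForm.fv, vars, varFinsetLeft_emb]
  | and G G' => Finset.union_subset_union (fv_toI G) (fv_toI G')
  | or G G' => Finset.union_subset_union (fv_toI G) (fv_toI G')

theorem toI_subst {σ : ℕ → L.Term ℕ} {τ : Sub L 0 0} : ∀ {G : Goal L User},
    (∀ x ∈ G.vars, τ (Sum.inl x) = emb (σ x)) → G.toI.subst τ = (G.subst σ).toI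
  | top, _ => rfl
  | bot, _ => rfl
  | user _ ts, _ => rfl
  | rel _ ts, h => by
      simp only [toI, subst, IForm.subst]
      congr 1
      funext i
      exact emb_subst_emb _ _ _ fun x hx => h x (by simpa [vars] using ⟨i, hx⟩)
  | eq t s, h => by
      simp only [toI, subst, IForm.subst]
      congr 1
      · exact emb_subst_emb _ _ _ fun x hx => h x (by simp [vars, hx])
      · exact emb_subst_emb _ _ _ fun x hx => h x (by simp [vars, hx])
  | and G G', h => by
      simp only [toI, subst, IForm.subst]
      rw [toI_subst fun x hx => h x (by simp [vars, hx]),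
        toI_subst fun x hx => h x (by simp [vars, hx])]
  | or G G', h => by
      simp only [toI, subst, IForm.subst]
      rw [toI_subst fun x hx => h x (by simp [vars, hx]),
        toI_subst fun x hx => h x (by simp [vars, hx])]

theorem subst_congr {σ τ : ℕ → L.Term ℕ} : ∀ {G : Goal L User}, (∀ x ∈ G.vars, σ x = τ x) →
    G.subst σ = G.subst τ
  | top, _ => rfl
  | bot, _ => rfl
  | user _ ts, h => by
      simp only [subst]
      congr 1
      funext i
      exact term_subst_congr fun x hx => h x (by simpa [vars] using ⟨i, hx⟩)
  | rel _ ts, h => by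
      simp only [subst]
      congr 1
      funext i
      exact term_subst_congr fun x hx => h x (by simpa [vars] using ⟨i, hx⟩)
  | eq t s, h => by
      simp only [subst]
      rw [term_subst_congr fun x hx => h x (by simp [vars, hx]),
        term_subst_congr fun x hx => h x (by simp [vars, hx])]
  | and G G', h => by
      simp only [subst]
      rw [subst_congr fun x hx => h x (by simp [vars, hx]),
        subst_congr fun x hx => h x (by simp [vars, hx])]
  | or G G', h => by
      simp only [subst]
      rw [subst_congr fun x hx => h x (by simp [vars, hx]),
        subst_congr fun x hx => h x (by simp [vars, hx])]

theorem subst_subst (σ τ : ℕ → L.Term ℕ) : ∀ G : Goal L User,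
    (G.subst σ).subst τ = G.subst fun x => (σ x).subst τ
  | top => rfl
  | bot => rfl
  | user _ ts => by simp [subst, term_subst_subst]
  | rel _ ts => by simp [subst, term_subst_subst]
  | eq t s => by simp [subst, term_subst_subst]
  | and G G' => by simp [subst, subst_subst σ τ G, subst_subst σ τ G']
  | or G G' => by simp [subst, subst_subst σ τ G, subst_subst σ τ G']

theorem subst_var : ∀ G : Goal L User, G.subst Term.var = G
  | top => rfl
  | bot => rfl
  | user _ ts => by simp [subst, term_subst_var]
  | rel _ ts => by simp [subst, term_subst_var]
  | eq t s => by simp [subst, term_subst_var]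
  | and G G' => by simp [subst, subst_var G, subst_var G']
  | or G G' => by simp [subst, subst_var G, subst_var G']

theorem subst_eq_self {σ : ℕ → L.Term ℕ} {G : Goal L User} (h : ∀ x ∈ G.vars, σ x = Term.var x) :
    G.subst σ = G := by
  rw [subst_congr h, subst_var]

theorem mem_vars_rename {ρ : ℕ → ℕ} {y : ℕ} {G : Goal L User} :
    y ∈ (G.rename ρ).vars ↔ ∃ x ∈ G.vars, ρ x = y := by
  simp [rename, mem_vars_subst, eq_comm]

end Goal

theorem GoalEquiv.vars_eq {G G' : Goal L User} (h : GoalEquiv G G') : G.vars = G'.vars := by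
  induction h with
  | refl => rfl
  | symm _ ih => exact ih.symm
  | trans _ _ ih₁ ih₂ => exact ih₁.trans ih₂
  | andCongr _ _ ih₁ ih₂ => simp [Goal.vars, ih₁, ih₂]
  | orCongr _ _ ih₁ ih₂ => simp [Goal.vars, ih₁, ih₂]
  | assoc => simp [Goal.vars]
  | comm => simp [Goal.vars, Finset.union_comm]
  | topAnd => simp [Goal.vars]
  | distrib => ext; simp [Goal.vars]; tauto

/-! ### Equality in intuitionistic logic -/

theorem IL.eq_symm {Γ : Set (IForm L 0)} {t s : L.Term (ℕ ⊕ Fin 0)} (h : IL Γ (IForm.eq t s)) :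
    IL Γ (IForm.eq s t) := by
  have := IL.eqSubst (Γ := Γ)
    (IForm.eq (Term.var (Sum.inr 0)) (t.relabel (Sum.map id Fin.succ))) h
    (by simpa only [IForm.inst, IForm.subst, Sub.relabel_inst, Term.subst, Sub.inst] using IL.eqRefl t)
  simpa only [IForm.inst, IForm.subst, Sub.relabel_inst, Term.subst, Sub.inst] using this

theorem IL.eq_trans {Γ : Set (IForm L 0)} {t s r : L.Term (ℕ ⊕ Fin 0)} (h : IL Γ (IForm.eq t s))
    (h' : IL Γ (IForm.eq s r)) : IL Γ (IForm.eq t r) := by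
  have := IL.eqSubst (Γ := Γ)
    (IForm.eq (t.relabel (Sum.map id Fin.succ)) (Term.var (Sum.inr 0))) h'
    (by simpa only [IForm.inst, IForm.subst, Sub.relabel_inst, Term.subst, Sub.inst] using h)
  simpa only [IForm.inst, IForm.subst, Sub.relabel_inst, Term.subst, Sub.inst] using this

/-- Leibniz's law for the formula `s ≐ s[x/·]`, starting from reflexivity. -/
theorem IL.eq_subst_term {Γ : Set (IForm L 0)} {x : ℕ} {t : L.Term (ℕ ⊕ Fin 0)}
    (h : IL Γ (IForm.eq (freeVar x) t)) (s : L.Term (ℕ ⊕ Fin 0)) :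
    IL Γ (IForm.eq s (s.subst ((Sub.ident 0).upd x t))) := by
  have := IL.eqSubst (Γ := Γ)
    (IForm.eq (s.relabel (Sum.map id Fin.succ)) (s.subst (Sub.close x))) h (by
      simp only [IForm.inst, IForm.subst, Sub.relabel_inst, term_subst_subst]
      change IL Γ (IForm.eq s (s.subst ((Sub.close x).comp (Sub.inst (freeVar x)))))
      rw [Sub.close_inst, Sub.upd_ident, Sub.ident, term_subst_var]
      exact .eqRefl s)
  simp only [IForm.inst, IForm.subst, Sub.relabel_inst, term_subst_subst] at this
  change IL Γ (IForm.eq s (s.subst ((Sub.close x).comp (Sub.inst t)))) at this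
  rwa [Sub.close_inst] at this

theorem IL.eq_subst_form {Γ : Set (IForm L 0)} {x : ℕ} {t s : L.Term (ℕ ⊕ Fin 0)} {φ : IForm L 0}
    (h : IL Γ (IForm.eq s t)) (h' : IL Γ (φ.subst ((Sub.ident 0).upd x s))) :
    IL Γ (φ.subst ((Sub.ident 0).upd x t)) := by
  have := IL.eqSubst (Γ := Γ) (φ.subst (Sub.close x)) h
  rw [IForm.inst, IForm.inst, IForm.subst_subst, IForm.subst_subst, Sub.close_inst,
    Sub.close_inst] at this
  exact this h'

theorem Sub.upd_ident_eq_emb (x : ℕ) (t : L.Term ℕ) (y : ℕ) :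
    (Sub.ident 0 : Sub L 0 0).upd x (emb t) (Sum.inl y) =
      emb (Function.update Term.var x t y) := by
  by_cases h : y = x
  · subst h; simp
  · rw [Sub.upd_of_ne _ _ h, Function.update_of_ne h]; rfl

theorem Goal.toI_subst1 (x : ℕ) (t : L.Term ℕ) (G : Goal L User) :
    G.toI.subst ((Sub.ident 0).upd x (emb t)) = (G.subst1 x t).toI :=
  Goal.toI_subst fun y _ => Sub.upd_ident_eq_emb x t y

/-! ### Derived rules of linear logic -/

namespace ILL

variable {P : Set (Sequent L User)}

/-- Derivability of a formula from a single formula. -/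
def Le (P : Set (Sequent L User)) (α β : LForm L User 0) : Prop := ILL P {α} β

variable {α β γ δ α' β' : LForm L User 0}

theorem Le.refl (α : LForm L User 0) : Le P α α := .id α

theorem Le.cons {Γ : Multiset (LForm L User 0)} (h : Le P α β) (h' : ILL P (β ::ₘ Γ) γ) :
    ILL P (α ::ₘ Γ) γ := .cut h h'

theorem Le.trans (h : Le P α β) (h' : Le P β γ) : Le P α γ := h.cons (Γ := 0) h'

theorem Le.of_tensor (h : Le P (α.tensor β) γ) : ILL P (α ::ₘ β ::ₘ 0) γ := by
  have := ILL.cut (Δ := 0) (.tensorR (.id α) (.id β)) h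
  simpa using this

theorem Le.tensor_of (h : ILL P (α ::ₘ β ::ₘ 0) γ) : Le P (α.tensor β) γ := .tensorL h

theorem Le.tensor (h : Le P α α') (h' : Le P β β') : Le P (α.tensor β) (α'.tensor β') :=
  .tensorL (Γ := 0) (.tensorR h h')

theorem Le.comm (α β : LForm L User 0) : Le P (α.tensor β) (β.tensor α) := by
  refine Le.tensor_of ?_
  rw [Multiset.cons_swap]
  exact Le.of_tensor (.refl _)

theorem Le.assoc (α β γ : LForm L User 0) :
    Le P ((α.tensor β).tensor γ) (α.tensor (β.tensor γ)) := by
  refine .tensorL (.tensorL (Γ := {γ}) ?_)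
  exact .tensorR (.id α) (Le.of_tensor (.refl _))

theorem Le.assoc' (α β γ : LForm L User 0) :
    Le P (α.tensor (β.tensor γ)) ((α.tensor β).tensor γ) := by
  refine Le.tensor_of ?_
  rw [Multiset.cons_swap]
  refine .tensorL ?_
  have : ILL P ((α ::ₘ β ::ₘ 0) + {γ}) ((α.tensor β).tensor γ) :=
    .tensorR (Le.of_tensor (.refl _)) (.id γ)
  convert this using 1
  rw [Multiset.cons_swap γ α, Multiset.cons_swap β α, Multiset.cons_add, Multiset.cons_add]
  rw [Multiset.cons_swap β γ]
  simp
  exact Multiset.cons_swap _ _ _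

theorem Le.one_tensor (α : LForm L User 0) : Le P (LForm.one.tensor α) α :=
  .tensorL (.oneL (.id α))

theorem Le.tensor_one (α : LForm L User 0) : Le P α (LForm.one.tensor α) := by
  have := ILL.tensorR (P := P) .oneR (.id α)
  rwa [zero_add] at this

/-- `zeroL` allows no side context, so the context is absorbed formula by formula: since `0` proves
`α ⊸ γ`, cut this against `α ⊸ γ, α ⊢ γ`. -/
theorem Le.cons_zero (Γ : Multiset (LForm L User 0)) (γ : LForm L User 0) :
    ILL P (LForm.zero ::ₘ Γ) γ := by
  induction Γ using Multiset.induction_on generalizing γ with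
  | empty => exact .zeroL γ
  | cons α Γ ih =>
    have h : ILL P (α.lolli γ ::ₘ ({α} + 0)) γ := .lolliL (.id α) (.id γ)
    have := ILL.cut (ih (α.lolli γ)) h
    simpa [Multiset.add_comm Γ] using this

theorem Le.tensor_zero (α γ : LForm L User 0) : Le P (α.tensor LForm.zero) γ :=
  (Le.comm _ _).trans (.tensor_of (Le.cons_zero _ _))

theorem Le.plus (h : Le P α γ) (h' : Le P β γ) : Le P (α.plus β) γ := .plusL (Γ := 0) h h'

theorem Le.plus_left (h : Le P γ α) (β : LForm L User 0) : Le P γ (α.plus β) := .plusR1 h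

theorem Le.plus_right (α : LForm L User 0) (h : Le P γ β) : Le P γ (α.plus β) := .plusR2 h

theorem Le.distrib (α β γ : LForm L User 0) :
    Le P (α.tensor (β.plus γ)) ((α.tensor β).plus (α.tensor γ)) := by
  refine (Le.comm _ _).trans (.tensor_of (.plusL ?_ ?_))
  · exact Le.of_tensor (.plus_left (.comm _ _) _)
  · exact Le.of_tensor (.plus_right _ (.comm _ _))

theorem exVars_left {Γ : Multiset (LForm L User 0)} (h : ILL P (α ::ₘ Γ) γ) :
    ∀ l : List ℕ, (∀ x ∈ l, x ∉ γ.fv ∧ ∀ β ∈ Γ, x ∉ β.fv) →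
      ILL P (l.foldr LForm.exVar α ::ₘ Γ) γ
  | [], _ => h
  | x :: l, hl => by
      refine .exL x (fun hx => (LForm.fv_subst_close hx).2 rfl) (hl x (by simp)).1
        (hl x (by simp)).2 ?_
      rw [LForm.exVar_inst_self]
      exact exVars_left h l fun y hy => hl y (by simp [hy])

theorem Le.exSet_left {s : Finset ℕ} (h : Le P α γ) (hs : ∀ x ∈ s, x ∉ γ.fv) :
    Le P (LForm.exSet s α) γ :=
  exVars_left (Γ := 0) h _ fun x hx => ⟨hs x (by simpa using hx), by simp⟩

theorem Le.exVars_right (h : Le P α β) : ∀ l : List ℕ, Le P α (l.foldr LForm.exVar β)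
  | [] => h
  | x :: l => by
      refine .exR (freeVar x) ?_
      rw [LForm.exVar_inst_self]
      exact h.exVars_right l

theorem Le.exSet_right (s : Finset ℕ) (h : Le P α β) : Le P α (LForm.exSet s β) :=
  h.exVars_right _

/-- Scope extrusion: the quantifier can be opened beside `α` because its variables serve as their
own eigenvariables. -/
theorem Le.tensor_exSet {s : Finset ℕ} (h : Le P (α.tensor β) γ) (hα : ∀ x ∈ s, x ∉ α.fv)
    (hγ : ∀ x ∈ s, x ∉ γ.fv) : Le P (α.tensor (LForm.exSet s β)) γ := by
  refine (Le.comm _ _).trans (.tensor_of (exVars_left ?_ _ fun x hx => ?_))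
  · exact Le.of_tensor ((Le.comm _ _).trans h)
  · have hx : x ∈ s := by simpa using hx
    exact ⟨hγ x hx, by simpa using hα x hx⟩

/-! ### Goals in linear logic -/

theorem Le.goalEquiv {G G' : Goal L User} (h : GoalEquiv G G') :
    Le P G.toL G'.toL ∧ Le P G'.toL G.toL := by
  induction h with
  | refl => exact ⟨.refl _, .refl _⟩
  | symm _ ih => exact ih.symm
  | trans _ _ ih₁ ih₂ => exact ⟨ih₁.1.trans ih₂.1, ih₂.2.trans ih₁.2⟩
  | andCongr _ _ ih₁ ih₂ => exact ⟨.tensor ih₁.1 ih₂.1, .tensor ih₁.2 ih₂.2⟩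
  | orCongr _ _ ih₁ ih₂ =>
    exact ⟨.plus (.plus_left ih₁.1 _) (.plus_right _ ih₂.1),
      .plus (.plus_left ih₁.2 _) (.plus_right _ ih₂.2)⟩
  | assoc => exact ⟨.assoc _ _ _, .assoc' _ _ _⟩
  | comm => exact ⟨.comm _ _, .comm _ _⟩
  | topAnd => exact ⟨.one_tensor _, .tensor_one _⟩
  | distrib =>
    exact ⟨.distrib _ _ _, .plus (.tensor (.refl _) (.plus_left (.refl _) _))
      (.tensor (.refl _) (.plus_right _ (.refl _)))⟩

end ILL

/-! ### Derivability of transitions and entailments -/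

/-- All proper axioms. -/
def sigma (CT : ConstraintTheory L User) (P : Program L User) : Set (Sequent L User) :=
  sigmaCT CT ∪ sigmaEq L User ∪ sigmaP P

theorem Goal.le_eq_subst1 (CT : ConstraintTheory L User) (x : ℕ) (t s : L.Term ℕ) :
    CT.Le (Goal.eq (Term.var x) t : Goal L User).toI
      (Goal.eq s (s.subst (Function.update Term.var x t)) : Goal L User).toI := by
  refine .impI ?_
  have h := IL.eq_subst_term (x := x) (t := emb t)
    (Γ := insert (Goal.eq (Term.var x) t : Goal L User).toI CT.sentences) (.hyp (Or.inl rfl))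
    (emb s)
  rwa [emb_subst_emb s (Function.update Term.var x t) _
    fun y _ => Sub.upd_ident_eq_emb x t y] at h

theorem Goal.le_eq_symm (CT : ConstraintTheory L User) (t s : L.Term ℕ) :
    CT.Le (Goal.eq t s : Goal L User).toI (Goal.eq s t : Goal L User).toI :=
  .impI (IL.eq_symm (.hyp (Or.inl rfl)))

theorem State.fv_toL {S : State L User} {y : ℕ} (h : y ∈ S.toL.fv) :
    y ∈ S.goal.vars ∧ y ∈ S.globals := by
  have h := LForm.fv_exSet h
  rw [Goal.fv_toL, State.locals, Finset.mem_sdiff, not_and_not_right] at h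
  exact ⟨h.1, h.2 h.1⟩

namespace ILL

variable {CT : ConstraintTheory L User} {P : Program L User}

theorem Le.builtin {B B' : Goal L User} (hB : B.IsBuiltin) (hB' : B'.IsBuiltin) {s s' : Finset ℕ}
    (h : CT.Le (IForm.exSet s B.toI) (IForm.exSet s' B'.toI)) :
    Le (sigma CT P) (LForm.exSet s B.toL) (LForm.exSet s' B'.toL) :=
  .proper (Or.inl (Or.inl ⟨s, s', B, B', hB, hB', h, rfl⟩))

theorem Le.builtin₀ {B B' : Goal L User} (hB : B.IsBuiltin) (hB' : B'.IsBuiltin)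
    (h : CT.Le B.toI B'.toI) : Le (sigma CT P) B.toL B'.toL := by
  simpa using Le.builtin (s := ∅) (s' := ∅) (P := P) hB hB' (by simpa using h)

/-- Σ_≐ replaces a single argument, so the induction is on the set of positions already replaced.
Each step extracts the required equation from `E` by Σ_CT while keeping `E`, and afterwards discards
the equation. -/
theorem Le.user_args {E : Goal L User} (hE : E.IsBuiltin) {k : ℕ} (c : User k)
    (ts ts' : Fin k → L.Term ℕ)
    (h : ∀ i, CT.Le E.toI (Goal.eq (ts i) (ts' i) : Goal L User).toI) :
    Le (sigma CT P) ((Goal.user c ts).and E).toL ((Goal.user c ts').and E).toL := by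
  have key : ∀ J : Finset (Fin k), Le (sigma CT P) ((Goal.user c ts).and E).toL
      ((Goal.user c fun i => if i ∈ J then ts' i else ts i).and E).toL := by
    intro J
    induction J using Finset.induction_on with
    | empty => simpa using Le.refl _
    | insert j J hj ih =>
      refine ih.trans ?_
      set f : Fin k → L.Term ℕ := fun i => if i ∈ J then ts' i else ts i with hf
      have hfj : f j = ts j := by simp [hf, hj]
      have h₁ : Le (sigma CT P) E.toL ((Goal.eq (ts j) (ts' j)).and E).toL :=
        Le.builtin₀ hE ⟨trivial, hE⟩ (.and (h j) (.refl _))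
      have h₂ : Le (sigma CT P) ((Goal.user c f).and (Goal.eq (ts j) (ts' j))).toL
          ((Goal.user c (Function.update f j (ts' j))).and (Goal.eq (ts j) (ts' j))).toL := by
        rw [← hfj]
        exact .proper (Or.inl (Or.inr ⟨k, c, f, j, ts' j, rfl⟩))
      have h₃ : Le (sigma CT P) ((Goal.eq (ts j) (ts' j)).and E).toL E.toL :=
        Le.builtin₀ ⟨trivial, hE⟩ hE (.and_right _ _)
      have h₄ : (fun i => if i ∈ insert j J then ts' i else ts i) =
          Function.update f j (ts' j) := by
        funext i
        by_cases hij : i = j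
        · subst hij; simp
        · simp [hf, hij]
      rw [h₄]
      exact ((Le.refl _).tensor h₁).trans ((Le.assoc' _ _ _).trans ((h₂.tensor (.refl _)).trans
        ((Le.assoc _ _ _).trans ((Le.refl _).tensor h₃))))
  simpa using key Finset.univ

/-- Σ_CT duplicates and merges built-in constraints, so each conjunct of `U` can be given its own
copy of the equation. -/
theorem Le.user_subst1 {U : Goal L User} (hU : U.IsUser) (x : ℕ) (t : L.Term ℕ) :
    Le (sigma CT P) (U.and (Goal.eq (Term.var x) t)).toL
        ((U.subst1 x t).and (Goal.eq (Term.var x) t)).toL ∧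
      Le (sigma CT P) ((U.subst1 x t).and (Goal.eq (Term.var x) t)).toL
        (U.and (Goal.eq (Term.var x) t)).toL := by
  induction U with
  | top => exact ⟨.refl _, .refl _⟩
  | bot | eq | rel | or => exact hU.elim
  | user c ts =>
    exact ⟨Le.user_args (E := Goal.eq (Term.var x) t) trivial c _ _ fun i => Goal.le_eq_subst1 CT x t _,
      Le.user_args (E := Goal.eq (Term.var x) t) trivial c _ _ fun i => (Goal.le_eq_subst1 CT x t _).trans
        (Goal.le_eq_symm CT _ _)⟩
  | and U₁ U₂ ih₁ ih₂ =>
    have ih₁ := ih₁ hU.1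
    have ih₂ := ih₂ hU.2
    set E : Goal L User := Goal.eq (Term.var x) t
    have dup : Le (sigma CT P) E.toL (E.and E).toL :=
      Le.builtin₀ trivial ⟨trivial, trivial⟩ (.and (.refl _) (.refl _))
    have undup : Le (sigma CT P) (E.and E).toL E.toL :=
      Le.builtin₀ ⟨trivial, trivial⟩ trivial (.and_left _ _)
    have shuffle : ∀ V₁ V₂ W₁ W₂ : Goal L User,
        Le (sigma CT P) ((V₁.and V₂).and (W₁.and W₂)).toL
          ((V₁.and W₁).and (V₂.and W₂)).toL := fun V₁ V₂ W₁ W₂ =>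
      (Le.goalEquiv <| .trans (.assoc _ _ _) <| .trans (.andCongr (.refl _) <|
        .trans (.symm (.assoc _ _ _)) <| .trans (.andCongr (.comm _ _) (.refl _)) (.assoc _ _ _))
        (.symm (.assoc _ _ _))).1
    have main : ∀ V₁ V₂ W₁ W₂ : Goal L User,
        Le (sigma CT P) (V₁.and E).toL (W₁.and E).toL →
        Le (sigma CT P) (V₂.and E).toL (W₂.and E).toL →
        Le (sigma CT P) ((V₁.and V₂).and E).toL ((W₁.and W₂).and E).toL :=
      fun V₁ V₂ W₁ W₂ h₁ h₂ => ((Le.refl _).tensor dup).trans <| (shuffle _ _ _ _).trans <|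
        (h₁.tensor h₂).trans <| (shuffle _ _ _ _).trans ((Le.refl _).tensor undup)
    exact ⟨main _ _ _ _ ih₁.1 ih₂.1, main _ _ _ _ ih₁.2 ih₂.2⟩

theorem Le.state_left {Q : Set (Sequent L User)} {G : Goal L User} {V : Finset ℕ}
    {γ : LForm L User 0} (h : Le Q G.toL γ) (hγ : ∀ x ∈ γ.fv, x ∈ G.vars → x ∈ V) :
    Le Q (State.toL ⟨G, V⟩) γ := by
  refine Le.exSet_left h fun x hx hx' => ?_
  simp only [State.locals, Finset.mem_sdiff] at hx
  exact hx.2 (hγ x hx' hx.1)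

theorem Le.state_right {Q : Set (Sequent L User)} {G : Goal L User} {γ : LForm L User 0}
    (V : Finset ℕ) (h : Le Q γ G.toL) : Le Q γ (State.toL ⟨G, V⟩) := Le.exSet_right _ h

theorem Le.state {Q : Set (Sequent L User)} {G G' : Goal L User} {V V' : Finset ℕ}
    (h : Le Q G.toL G'.toL) (hV : V' ⊆ V) : Le Q (State.toL ⟨G, V⟩) (State.toL ⟨G', V'⟩) :=
  Le.state_left (Le.state_right V' h) fun _ hx _ => hV (State.fv_toL hx).2

/-- Strictly local variables do not occur in `U`, so after the Σ_CT axiom has acted on the built-in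
factor its existential quantifier can be extruded over `U` and absorbed into that of the state. -/
theorem Le.applyCT {U B B' : Goal L User} (V : Finset ℕ) (hB : B.IsBuiltin) (hB' : B'.IsBuiltin)
    (h : CT.Le (IForm.exSet (strictLocals U B V) B.toI)
      (IForm.exSet (strictLocals U B' V) B'.toI)) :
    Le (sigma CT P) (State.toL ⟨U.and B, V⟩) (State.toL ⟨U.and B', V⟩) := by
  refine Le.state_left ?_ fun x hx _ => (State.fv_toL hx).2
  have h₁ : Le (sigma CT P) B.toL (LForm.exSet (strictLocals U B' V) B'.toL) :=
    (Le.exSet_right _ (.refl _)).trans (Le.builtin hB hB' h)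
  refine ((Le.refl U.toL).tensor h₁).trans (Le.tensor_exSet (Le.state_right V (.refl _)) ?_ ?_)
  · intro x hx
    rw [Goal.fv_toL]
    exact (Finset.mem_sdiff.1 hx).2
  · intro x hx hx'
    exact (Finset.mem_sdiff.1 (Finset.mem_sdiff.1 hx).1).2 (State.fv_toL hx').2

theorem Le.stateEquiv {S T : State L User} (h : StateEquiv CT S T) :
    Le (sigma CT P) S.toL T.toL ∧ Le (sigma CT P) T.toL S.toL := by
  induction h with
  | refl => exact ⟨.refl _, .refl _⟩
  | symm _ ih => exact ih.symm
  | trans _ _ ih₁ ih₂ => exact ⟨ih₁.1.trans ih₂.1, ih₂.2.trans ih₁.2⟩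
  | goal V h =>
    have h := Le.goalEquiv (P := sigma CT P) h
    exact ⟨Le.state h.1 subset_rfl, Le.state h.2 subset_rfl⟩
  | eqSubst x t V hU hB =>
    have h := Le.user_subst1 (CT := CT) (P := P) hU x t
    exact ⟨Le.state (h.1.tensor (.refl _)) subset_rfl, Le.state (h.2.tensor (.refl _)) subset_rfl⟩
  | applyCT V hU hB hB' h h' => exact ⟨Le.applyCT V hB hB' h, Le.applyCT V hB' hB h'⟩
  | @redundantGlobal G x V hx =>
    refine ⟨Le.state (.refl _) (Finset.subset_insert _ _),
      Le.state_left (Le.state_right _ (.refl _)) fun y hy hy' => ?_⟩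
    have := (State.fv_toL hy).2
    simp only [Finset.mem_insert] at this
    rcases this with rfl | h
    exacts [absurd hy' hx, h]
  | failed G G' V V' =>
    have key : ∀ (G G' : Goal L User) (V V' : Finset ℕ),
        Le (sigma CT P) (State.toL ⟨G.and Goal.bot, V⟩) (State.toL ⟨G'.and Goal.bot, V'⟩) :=
      fun G G' V V' => (Le.state_left (γ := LForm.zero) (Le.tensor_zero _ _)
        (by simp [LForm.fv])).trans (.zeroL _)
    exact ⟨key _ _ _ _, key _ _ _ _⟩

theorem Le.of_cls_eq {S T : State L User} (h : S.cls CT = T.cls CT) :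
    Le (sigma CT P) S.toL T.toL :=
  (Le.stateEquiv (Quotient.exact h)).1

theorem Le.stateEntails {a b : StateClass CT} (h : StateEntails CT a b) :
    ∀ S T : State L User, S.cls CT = a → T.cls CT = b → Le (sigma CT P) S.toL T.toL := by
  induction h with
  | refl => exact fun S T hS hT => Le.of_cls_eq (hS.trans hT.symm)
  | tail _ h ih =>
    intro S T hS hT
    cases h with
    | weaken V hU hB hB' h =>
      exact (ih S _ hS rfl).trans ((Le.applyCT V hB hB' h).trans (Le.of_cls_eq hT.symm))
    | omitGlobal x V hU hB =>
      exact (ih S _ hS rfl).trans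
        ((Le.state (.refl _) (Finset.subset_insert _ _)).trans (Le.of_cls_eq hT.symm))

/-! ### Configurations as iterated sums. -/

theorem Le.config_right {Q : Set (Sequent L User)} {S : State L User} :
    ∀ {C : Config L User}, S ∈ C → Le Q S.toL C.toL
  | [T], h => by
      rw [List.mem_singleton] at h
      subst h
      exact .refl _
  | T :: T' :: C, h => by
      rcases List.mem_cons.1 h with rfl | h
      · exact .plus_left (.refl _) _
      · exact .plus_right _ (Le.config_right h)

theorem Le.config_left {Q : Set (Sequent L User)} {γ : LForm L User 0} :
    ∀ {C : Config L User}, (∀ S ∈ C, Le Q S.toL γ) → Le Q C.toL γ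
  | [], _ => .zeroL _
  | [T], h => h T (by simp)
  | T :: T' :: C, h =>
      .plus (h T (by simp)) (Le.config_left fun S hS => h S (List.mem_cons_of_mem _ hS))

theorem Le.config {Q : Set (Sequent L User)} {C D : Config L User}
    (h : ∀ S ∈ C, Le Q S.toL D.toL) : Le Q C.toL D.toL := Le.config_left h

theorem Le.of_config_left {Q : Set (Sequent L User)} {C : Config L User} {γ : LForm L User 0}
    (h : Le Q C.toL γ) {S : State L User} (hS : S ∈ C) : Le Q S.toL γ :=
  (Le.config_right hS).trans h

theorem Le.config_append {Q : Set (Sequent L User)} {C C' D : Config L User}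
    (h : Le Q C.toL D.toL) (h' : Le Q C'.toL D.toL) : Le Q (C ++ C').toL D.toL :=
  Le.config fun _ hS => (List.mem_append.1 hS).elim (fun hS => h.of_config_left hS)
    fun hS => h'.of_config_left hS

/-- Up to derivability `⊕` depends only on the set of its summands, which reduces the structural
laws of configurations to list inclusions. -/
theorem Le.config_mono {Q : Set (Sequent L User)} {C D : Config L User} (h : C ⊆ D) :
    Le Q C.toL D.toL := Le.config fun _ hS => Le.config_right (h hS)

theorem Le.config_cons {Q : Set (Sequent L User)} {S : State L User} {T D : Config L User}
    (h : Le Q S.toL D.toL) (h' : T ⊆ D) : Le Q (Config.toL (S :: T)) D.toL :=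
  Le.config_append (C := [S]) h (Le.config_mono h')

theorem Le.configEquiv {C D : Config L User} (h : ConfigEquiv CT C D) :
    Le (sigma CT P) C.toL D.toL ∧ Le (sigma CT P) D.toL C.toL := by
  induction h with
  | refl => exact ⟨.refl _, .refl _⟩
  | symm _ ih => exact ih.symm
  | trans _ _ ih₁ ih₂ => exact ⟨ih₁.1.trans ih₂.1, ih₂.2.trans ih₁.2⟩
  | congr T _ ih =>
    exact ⟨Le.config_append (ih.1.trans (Le.config_mono (List.subset_append_left _ _)))
        (Le.config_mono (List.subset_append_right _ _)),
      Le.config_append (ih.2.trans (Le.config_mono (List.subset_append_left _ _)))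
        (Le.config_mono (List.subset_append_right _ _))⟩
  | comm S T =>
    exact ⟨Le.config_mono (by intro x; simp; tauto), Le.config_mono (by intro x; simp; tauto)⟩
  | state T h =>
    have h := Le.stateEquiv (P := P) h
    exact ⟨Le.config_cons (h.1.trans (Le.config_right (by simp))) (List.subset_cons_self _ _),
      Le.config_cons (h.2.trans (Le.config_right (by simp))) (List.subset_cons_self _ _)⟩
  | failed T =>
    exact ⟨Le.config_cons ((Le.state_left (γ := LForm.zero) (Le.tensor_zero _ _)
        (by simp [LForm.fv])).trans (.zeroL _)) (List.Subset.refl _),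
      Le.config_mono (List.subset_cons_self _ _)⟩
  | split G₁ G₂ V T =>
    refine ⟨Le.config_cons ?_ ?_, Le.config_append (C := [_, _]) (Le.config ?_)
      (Le.config_mono (List.subset_cons_self _ _))⟩
    · have h : Le (sigma CT P) (State.toL ⟨G₁.or G₂, V⟩) (Config.toL [⟨G₁, V⟩, ⟨G₂, V⟩]) := by
        refine Le.state_left (.plus (.plus_left (.state_right V (.refl _)) _)
          (.plus_right _ (.state_right V (.refl _)))) fun x hx _ => ?_
        rcases Finset.mem_union.1 hx with hx | hx
        exacts [(State.fv_toL hx).2, (State.fv_toL hx).2]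
      exact h.trans (Le.config_mono (by intro x; simp; tauto))
    · intro x; simp; tauto
    · intro S hS
      simp only [List.mem_cons, List.not_mem_nil, or_false] at hS
      rcases hS with rfl | rfl
      · exact (Le.state (G' := G₁.or G₂) (.plus_left (.refl _) _) subset_rfl).trans
          (Le.config_right (by simp))
      · exact (Le.state (G' := G₁.or G₂) (.plus_right _ (.refl _)) subset_rfl).trans
          (Le.config_right (by simp))

theorem Le.of_config_cls_eq {C D : Config L User} (h : C.cls CT = D.cls CT) :
    Le (sigma CT P) C.toL D.toL :=
  (Le.configEquiv (Quotient.exact h)).1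

theorem Le.configEntails {a b : ConfigClass CT} (h : ConfigEntails CT a b) :
    ∀ C D : Config L User, C.cls CT = a → D.cls CT = b → Le (sigma CT P) C.toL D.toL := by
  induction h with
  | refl => exact fun C D hC hD => Le.of_config_cls_eq (hC.trans hD.symm)
  | tail _ h ih =>
    intro C D hC hD
    cases h with
    | weaken S T =>
      exact (ih C _ hC rfl).trans
        ((Le.config_mono (List.subset_cons_self _ _)).trans (Le.of_config_cls_eq hD.symm))
    | stronger T h =>
      refine (ih C _ hC rfl).trans (Le.trans (Le.config_cons ?_ (List.Subset.refl _))
        (Le.of_config_cls_eq hD.symm))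
      exact (Le.stateEntails h _ _ rfl rfl).trans (Le.config_right (by simp))

/-- Freshness of the rule's local variables is what is needed to extrude the quantifier of the Σ_P
axiom over the kept head and `K`, and then, since they are not global, to absorb it into the
quantifier of the resulting state. -/
theorem Le.rule {r₀ r : Rule L User} (hr₀ : r₀ ∈ P) (hr : r.IsVariant r₀) (K : Goal L User)
    (V : Finset ℕ) (hd : Disjoint r.locals (r.kept.vars ∪ r.removed.vars ∪ K.vars ∪ V)) :
    Le (sigma CT P) (State.toL ⟨((r.kept.and r.removed).and r.guard).and K, V⟩)
      (State.toL ⟨((r.kept.and r.guard).and r.body).and K, V⟩) := by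
  refine Le.state_left ?_ fun x hx _ => (State.fv_toL hx).2
  have h : Le (sigma CT P) ((r.kept.and r.removed).and r.guard).toL (LForm.tensor r.kept.toL
      (LForm.exSet r.locals (LForm.tensor r.body.toL r.guard.toL))) :=
    .proper (Or.inr ⟨r₀, hr₀, r, hr, rfl⟩)
  have hd := Finset.disjoint_left.1 hd
  refine (h.tensor (.refl K.toL)).trans ((Le.comm _ _).trans ((Le.assoc' _ _ _).trans
    (Le.tensor_exSet ?_ ?_ ?_)))
  · refine Le.state_right V (Le.goalEquiv (G := (K.and r.kept).and (r.body.and r.guard)) ?_).1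
    refine .trans (.assoc _ _ _) (.trans (.comm _ _) (.andCongr ?_ (.refl _)))
    exact .trans (.andCongr (.refl _) (.comm _ _)) (.symm (.assoc _ _ _))
  · intro x hx hx'
    simp only [LForm.fv, Goal.fv_toL, Finset.mem_union] at hx'
    refine hd hx ?_
    simp only [Finset.mem_union]
    tauto
  · intro x hx hx'
    exact hd hx (by simp [(State.fv_toL hx').2])

theorem Le.step {a b : ConfigClass CT} (h : Step CT P a b) :
    ∀ C D : Config L User, C.cls CT = a → D.cls CT = b → Le (sigma CT P) C.toL D.toL := by
  cases h with
  | apply r₀ r K V T hr₀ hr hd hsat =>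
    intro C D hC hD
    refine (Le.of_config_cls_eq hC).trans (Le.trans (Le.config_cons ?_ (List.subset_cons_self _ _))
      (Le.of_config_cls_eq hD.symm))
    exact (Le.rule hr₀ hr K V hd).trans (Le.config_right (by simp))

theorem Le.steps {a b : ConfigClass CT} (h : Relation.ReflTransGen (Step CT P) a b) :
    ∀ C D : Config L User, C.cls CT = a → D.cls CT = b → Le (sigma CT P) C.toL D.toL := by
  induction h with
  | refl => exact fun C D hC hD => Le.of_config_cls_eq (hC.trans hD.symm)
  | @tail b c _ h ih =>
    intro C D hC hD
    obtain ⟨E, rfl⟩ : ∃ E : Config L User, E.cls CT = b := Quotient.exists_rep b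
    exact (ih C E hC rfl).trans (Le.step h E D rfl hD)

end ILL

/-! ### Stores -/

/-- Multisets of user-defined and of built-in constraints. -/
abbrev Store (L : FirstOrder.Language.{u, v}) (User : ℕ → Type w) : Type (max u v w) :=
  Multiset {G : Goal L User // G.IsUser} × Multiset {G : Goal L User // G.IsBuiltin}

namespace Store

/-- The store of one user-defined constraint. -/
def user (G : Goal L User) (h : G.IsUser) : Store L User := ({⟨G, h⟩}, 0)

/-- The store of one built-in constraint. -/
def builtin (G : Goal L User) (h : G.IsBuiltin) : Store L User := (0, {⟨G, h⟩})

end Store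

/-- The conjunction of a multiset of goals. -/
noncomputable def conj {p : Goal L User → Prop} (s : Multiset {G : Goal L User // p G}) :
    Goal L User :=
  (s.toList.map Subtype.val).foldr Goal.and Goal.top

theorem conj_isUser (s : Multiset {G : Goal L User // G.IsUser}) : (conj s).IsUser := by
  unfold conj
  induction s.toList with
  | nil => trivial
  | cons a l ih => exact ⟨a.2, ih⟩

theorem conj_isBuiltin (s : Multiset {G : Goal L User // G.IsBuiltin}) :
    (conj s).IsBuiltin := by
  unfold conj
  induction s.toList with
  | nil => trivial
  | cons a l ih => exact ⟨a.2, ih⟩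

namespace ConstraintTheory

variable {CT : ConstraintTheory L User} {p : Goal L User → Prop}

theorem Le.conj_left {s : Multiset {G : Goal L User // p G}} {a : {G : Goal L User // p G}}
    (h : a ∈ s) : CT.Le (conj s).toI a.1.toI := by
  rw [← Multiset.mem_toList] at h
  unfold conj
  generalize s.toList = l at h
  induction l with
  | nil => simp at h
  | cons b l ih =>
    rcases List.mem_cons.1 h with rfl | h
    · exact .and_left _ _
    · exact (Le.and_right _ _).trans (ih h)

theorem Le.conj_right {s : Multiset {G : Goal L User // p G}} {φ : IForm L 0}
    (h : ∀ a ∈ s, CT.Le φ a.1.toI) : CT.Le φ (conj s).toI := by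
  simp only [← Multiset.mem_toList] at h
  unfold conj
  generalize s.toList = l at h
  induction l with
  | nil => exact .truth _
  | cons b l ih => exact .and (h b (by simp)) (ih fun a ha => h a (by simp [ha]))

theorem Le.conj_mono {s t : Multiset {G : Goal L User // p G}} (h : t ⊆ s) :
    CT.Le (conj s).toI (conj t).toI := Le.conj_right fun _ ha => Le.conj_left (h ha)

theorem Le.conj_user (φ : IForm L 0) (s : Multiset {G : Goal L User // G.IsUser}) :
    CT.Le φ (conj s).toI := by
  have key : ∀ G : Goal L User, G.IsUser → CT.Le φ G.toI := by
    intro G hG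
    induction G with
    | top => exact .truth _
    | user => exact .truth _
    | and G G' ih ih' => exact .and (ih hG.1) (ih' hG.2)
    | bot | eq | rel | or => exact hG.elim
  exact key _ (conj_isUser s)

end ConstraintTheory

namespace Goal

/-- The stores of the disjuncts of the disjunctive normal form. -/
def dnf : Goal L User → List (Store L User)
  | top => [0]
  | user c ts => [Store.user (user c ts) trivial]
  | bot => [Store.builtin bot trivial]
  | eq t s => [Store.builtin (eq t s) trivial]
  | rel R ts => [Store.builtin (rel R ts) trivial]
  | and G G' => G.dnf.flatMap fun n => G'.dnf.map fun n' => n + n'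
  | or G G' => G.dnf ++ G'.dnf

/-- The store of a goal without disjunctions. -/
def atoms : Goal L User → Store L User
  | top => 0
  | user c ts => Store.user (user c ts) trivial
  | bot => Store.builtin bot trivial
  | eq t s => Store.builtin (eq t s) trivial
  | rel R ts => Store.builtin (rel R ts) trivial
  | and G G' => G.atoms + G'.atoms
  | or _ _ => 0

theorem mem_dnf_and {G G' : Goal L User} {n : Store L User} :
    n ∈ (G.and G').dnf ↔ ∃ a ∈ G.dnf, ∃ b ∈ G'.dnf, a + b = n := by
  simp [dnf, eq_comm]

theorem IsUser.dnf : ∀ {G : Goal L User}, G.IsUser → G.dnf = [G.atoms]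
  | top, _ => rfl
  | user _ _, _ => rfl
  | and G G', h => by simp [Goal.dnf, atoms, IsUser.dnf h.1, IsUser.dnf h.2]

theorem IsBuiltin.dnf : ∀ {G : Goal L User}, G.IsBuiltin → G.dnf = [G.atoms]
  | top, _ => rfl
  | bot, _ => rfl
  | eq _ _, _ => rfl
  | rel _ _, _ => rfl
  | and G G', h => by simp [Goal.dnf, atoms, IsBuiltin.dnf h.1, IsBuiltin.dnf h.2]

theorem IsBuiltin.atoms_fst : ∀ {G : Goal L User}, G.IsBuiltin → G.atoms.1 = 0
  | top, _ => rfl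
  | bot, _ => rfl
  | eq _ _, _ => rfl
  | rel _ _, _ => rfl
  | and G G', h => by simp [atoms, IsBuiltin.atoms_fst h.1, IsBuiltin.atoms_fst h.2]

theorem IsBuiltin.atoms_eq {G : Goal L User} (h : G.IsBuiltin) : G.atoms = (0, G.atoms.2) :=
  Prod.ext h.atoms_fst rfl

/-- A store may hold a built-in constraint as one element or split into atoms. This and
`IsBuiltin.atoms_le` show that the theory does not see the difference. -/
theorem IsBuiltin.le_atoms {CT : ConstraintTheory L User} :
    ∀ {G : Goal L User}, G.IsBuiltin → ∀ a ∈ G.atoms.2, CT.Le G.toI a.1.toI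
  | top, _ => by simp [atoms]
  | bot, _ => by
      intro a ha
      simp only [atoms, Store.builtin, Multiset.mem_singleton] at ha
      subst ha; exact .refl _
  | eq _ _, _ => by
      intro a ha
      simp only [atoms, Store.builtin, Multiset.mem_singleton] at ha
      subst ha; exact .refl _
  | rel _ _, _ => by
      intro a ha
      simp only [atoms, Store.builtin, Multiset.mem_singleton] at ha
      subst ha; exact .refl _
  | and G G', h => by
      intro a ha
      simp only [atoms, Prod.snd_add, Multiset.mem_add] at ha
      rcases ha with ha | ha
      · exact (ConstraintTheory.Le.and_left _ _).trans (le_atoms h.1 a ha)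
      · exact (ConstraintTheory.Le.and_right _ _).trans (le_atoms h.2 a ha)

theorem IsBuiltin.atoms_le {CT : ConstraintTheory L User} {φ : IForm L 0} :
    ∀ {G : Goal L User}, G.IsBuiltin → (∀ a ∈ G.atoms.2, CT.Le φ a.1.toI) → CT.Le φ G.toI
  | top, _, _ => .truth _
  | bot, _, h => h ⟨bot, trivial⟩ (Multiset.mem_singleton_self _)
  | eq t s, _, h => h ⟨eq t s, trivial⟩ (Multiset.mem_singleton_self _)
  | rel R ts, _, h => h ⟨rel R ts, trivial⟩ (Multiset.mem_singleton_self _)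
  | and G G', hG, h => by
      simp only [atoms, Prod.snd_add, Multiset.mem_add] at h
      exact .and (atoms_le hG.1 fun a ha => h a (Or.inl ha))
        (atoms_le hG.2 fun a ha => h a (Or.inr ha))

end Goal

/-! ### The covering relation -/

/-- Rename the variables of `s` by `ρ`, and apply `σ` to the others. -/
def freshen (σ : ℕ → L.Term ℕ) (s : Finset ℕ) (ρ : ℕ → ℕ) (x : ℕ) : L.Term ℕ :=
  if x ∈ s then Term.var (ρ x) else σ x

/-- `Cov CT P X m`: all runs of the program from the store `m` can be led into `X`, up to
additional built-in constraints. -/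
inductive Cov (CT : ConstraintTheory L User) (P : Program L User) (X : Set (Store L User)) :
    Store L User → Prop
  -- Dropping `b` is weakening for `!` on the logical side and state entailment on the operational
  -- side.
  | base {m : Store L User} (b : Multiset {G : Goal L User // G.IsBuiltin}) :
      m ∈ X → Cov CT P X (m + (0, b))
  | bot (m : Store L User) : Cov CT P X (m + Store.builtin Goal.bot trivial)
  -- The premise ranges over all injective namings of `s` that avoid some finite set `A`. It thus
  -- survives the addition of any context, and names fresh for the actual state are chosen only when
  -- the derivation is turned into a run.
  | ct (m : Store L User) (b : Multiset {G : Goal L User // G.IsBuiltin}) {B : Goal L User}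
      (hB : B.IsBuiltin) (s : Finset ℕ) (σ : ℕ → L.Term ℕ) (A : Finset ℕ) :
      CT.Le (conj b).toI ((IForm.exSet s B.toI).subst (Sub.ofTerms σ)) →
      (∀ ρ : ℕ → ℕ, Set.InjOn ρ s → (∀ x ∈ s, ρ x ∉ A) →
        Cov CT P X (m + (0, b) + Store.builtin (B.subst (freshen σ s ρ)) hB.subst)) →
      Cov CT P X (m + (0, b))
  -- The substitution `σ` instantiates the rule's local variables in the guard too. That instance of
  -- the guard persists, and a second copy with fresh local variables accompanies the body, as in
  -- `∃ȳ. (B ⊗ G)`. All disjuncts of the body must be covered.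
  | rule (k : Store L User) {r₀ r : Rule L User} (σ : ℕ → L.Term ℕ) (A : Finset ℕ) :
      r₀ ∈ P → r.IsVariant r₀ →
      (∀ ρ : ℕ → ℕ, Set.InjOn ρ r.locals → (∀ x ∈ r.locals, ρ x ∉ A) →
        ∀ n ∈ (r.body.subst (freshen σ r.locals ρ)).dnf,
          Cov CT P X (k + (r.kept.subst σ).atoms + (r.guard.subst σ).atoms +
            (r.guard.subst (freshen σ r.locals ρ)).atoms + n)) →
      Cov CT P X (k + (r.kept.subst σ).atoms + (r.removed.subst σ).atoms +
        (r.guard.subst σ).atoms)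
  | eq (k : Store L User) {i : ℕ} (c : User i) (ts : Fin i → L.Term ℕ) (j : Fin i)
      (s : L.Term ℕ) :
      Cov CT P X (k + Store.user (Goal.user c (Function.update ts j s)) trivial +
        Store.builtin (Goal.eq (ts j) s) trivial) →
      Cov CT P X (k + Store.user (Goal.user c ts) trivial +
        Store.builtin (Goal.eq (ts j) s) trivial)

namespace Cov

variable {CT : ConstraintTheory L User} {P : Program L User} {X Y Z : Set (Store L User)}
  {m k : Store L User}

/-- Every constructor is stable under adding `k`, so a derivation can be replayed beside `k` and
continued at its leaves. The leaves may carry extra built-ins, whence the quantifier over `b`. -/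
theorem bind' (h : Cov CT P X m)
    (hX : ∀ x ∈ X, ∀ b, Cov CT P Y (x + (0, b) + k)) : Cov CT P Y (m + k) := by
  induction h with
  | base b h => exact hX _ h b
  | bot m => rw [add_right_comm]; exact .bot _
  | ct m b hB s σ A h _ ih =>
    rw [add_right_comm]
    refine .ct _ b hB s σ A h fun ρ h₁ h₂ => ?_
    convert ih ρ h₁ h₂ using 1
    abel
  | rule l σ A hr₀ hr _ ih =>
    have := Cov.rule (X := Y) (CT := CT) (l + k) σ A hr₀ hr fun ρ h₁ h₂ n hn => by
      convert ih ρ h₁ h₂ n hn using 1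
      abel
    convert this using 1
    abel
  | eq l c ts j s _ ih =>
    have := Cov.eq (X := Y) (CT := CT) (P := P) (l + k) c ts j s (by convert ih using 1; abel)
    convert this using 1
    abel

theorem mono_builtin (h : Cov CT P X m) (b : Multiset {G : Goal L User // G.IsBuiltin}) :
    Cov CT P X (m + (0, b)) :=
  h.bind' fun x hx b' => by
    have := Cov.base (CT := CT) (P := P) (b' + b) hx
    convert this using 1
    rw [add_assoc]
    simp

theorem of_mem (h : m ∈ X) : Cov CT P X m := by
  have := Cov.base (CT := CT) (P := P) 0 h
  rwa [Prod.mk_zero_zero, add_zero] at this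

theorem bind (h : Cov CT P X m) (hX : ∀ x ∈ X, Cov CT P Y (x + k)) : Cov CT P Y (m + k) :=
  h.bind' fun x hx b => by
    rw [add_right_comm]
    exact (hX x hx).mono_builtin b

theorem trans (h : Cov CT P X m) (hX : ∀ x ∈ X, Cov CT P Y x) : Cov CT P Y m := by
  simpa using h.bind (k := 0) (Y := Y) (by simpa using hX)

theorem add (h : Cov CT P X m) (h' : Cov CT P Z k)
    (H : ∀ x ∈ X, ∀ z ∈ Z, Cov CT P Y (x + z)) : Cov CT P Y (m + k) :=
  h.bind fun x hx => by
    rw [add_comm]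
    exact h'.bind fun z hz => by
      rw [add_comm]
      exact H x hx z hz

theorem ofTerms_var : (Sub.ofTerms Term.var : Sub L 0 0) = Sub.ident 0 := by
  funext x
  cases x with
  | inl x => rfl
  | inr i => exact i.elim0

/-- Entailed constraints are supplied one at a time by `ct` with an empty set of quantified
variables. This is the semantic source of contraction. -/
theorem entail {b b' : Multiset {G : Goal L User // G.IsBuiltin}}
    (hb : ∀ a ∈ b', CT.Le (conj b).toI a.1.toI) (h : Cov CT P X (m + (0, b) + (0, b'))) :
    Cov CT P X (m + (0, b)) := by
  induction b' using Multiset.induction_on generalizing m with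
  | empty => rwa [Prod.mk_zero_zero, add_zero] at h
  | cons a b' ih =>
    refine .ct m b a.2 ∅ Term.var ∅ ?_ fun ρ _ _ => ?_
    · rw [ofTerms_var, IForm.subst_ident, IForm.exSet_empty]
      exact hb a (by simp)
    · have h₁ : a.1.subst (freshen Term.var ∅ ρ) = a.1 := by
        apply Goal.subst_eq_self
        simp [freshen]
      rw [add_right_comm]
      simp only [h₁]
      refine ih (fun a' ha' => hb a' (by simp [ha'])) ?_
      convert h using 1
      rw [add_right_comm m, add_assoc (m + (0, b))]
      congr 1

end Cov

/-! ### Phase semantics -/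

open scoped Pointwise

/-- The closure operator of the covering relation. -/
def cl (CT : ConstraintTheory L User) (P : Program L User) (X : Set (Store L User)) :
    Set (Store L User) := {m | Cov CT P X m}

/-- Extend a valuation under one more binder. -/
def extend {n : ℕ} (e : ℕ ⊕ Fin n → L.Term ℕ) (t : L.Term ℕ) : ℕ ⊕ Fin (n + 1) → L.Term ℕ
  | Sum.inl x => e (Sum.inl x)
  | Sum.inr i => Fin.cases (motive := fun _ => L.Term ℕ) t (fun j => e (Sum.inr j)) i

/-- The fact denoted by a formula of linear logic. -/
def sem (CT : ConstraintTheory L User) (P : Program L User) :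
    {n : ℕ} → LForm L User n → (ℕ ⊕ Fin n → L.Term ℕ) → Set (Store L User)
  | _, .user c ts, e => cl CT P {Store.user (Goal.user c fun i => (ts i).subst e) trivial}
  | _, .rel R ts, e => cl CT P {Store.builtin (Goal.rel R fun i => (ts i).subst e) trivial}
  | _, .eq t s, e => cl CT P {Store.builtin (Goal.eq (t.subst e) (s.subst e)) trivial}
  | _, .one, _ => cl CT P {0}
  | _, .zero, _ => cl CT P ∅
  | _, .top, _ => Set.univ
  | _, .tensor α β, e => cl CT P (sem CT P α e + sem CT P β e)
  | _, .lolli α β, e => {m | ∀ n ∈ sem CT P α e, m + n ∈ sem CT P β e}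
  | _, .amp α β, e => sem CT P α e ∩ sem CT P β e
  | _, .plus α β, e => cl CT P (sem CT P α e ∪ sem CT P β e)
  -- Stores consisting of built-in constraints can be duplicated and discarded, by `Cov.entail` and
  -- `Cov.base`.
  | _, .bang α, e => cl CT P {m ∈ sem CT P α e | m.1 = 0}
  | _, .all α, e => ⋂ t, sem CT P α (extend e t)
  | _, .ex α, e => cl CT P (⋃ t, sem CT P α (extend e t))

section Semantics

variable {CT : ConstraintTheory L User} {P : Program L User} {X Y Z : Set (Store L User)}

theorem subset_cl : X ⊆ cl CT P X := fun _ h => Cov.of_mem h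

theorem cl_subset_cl (h : X ⊆ cl CT P Y) : cl CT P X ⊆ cl CT P Y := fun _ hm => hm.trans h

theorem cl_mono (h : X ⊆ Y) : cl CT P X ⊆ cl CT P Y := cl_subset_cl (h.trans subset_cl)

theorem cl_cl_subset : cl CT P (cl CT P X) ⊆ cl CT P X := cl_subset_cl subset_rfl

/-- Atoms, constants other than `⊤` and positive connectives are closed by definition, intersections
of closed sets are closed, and for `⊸` the closure passes through the argument by `Cov.bind`. -/
theorem cl_sem_subset {n : ℕ} (α : LForm L User n) (e : ℕ ⊕ Fin n → L.Term ℕ) :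
    cl CT P (sem CT P α e) ⊆ sem CT P α e := by
  induction α with
  | user | rel | eq | one | zero | tensor | plus | bang | ex => exact cl_cl_subset
  | top => exact Set.subset_univ _
  | lolli α β _ ih =>
    intro m hm n hn
    exact ih e (Cov.bind hm fun x hx => subset_cl (hx n hn))
  | amp α β ih₁ ih₂ =>
    exact Set.subset_inter ((cl_mono Set.inter_subset_left).trans (ih₁ e))
      ((cl_mono Set.inter_subset_right).trans (ih₂ e))
  | all α ih =>
    exact Set.subset_iInter fun t => (cl_mono (Set.iInter_subset _ t)).trans (ih _)

theorem cl_subset_sem {n : ℕ} {α : LForm L User n} {e : ℕ ⊕ Fin n → L.Term ℕ}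
    (h : X ⊆ sem CT P α e) : cl CT P X ⊆ sem CT P α e :=
  (cl_mono h).trans (cl_sem_subset α e)

/-- For validating left rules: a closed generated set may be replaced by its generators, even beside
a context. -/
theorem add_subset_sem {α : LForm L User 0} {e : ℕ ⊕ Fin 0 → L.Term ℕ}
    (h : ∀ x ∈ X, ∀ z ∈ Z, x + z ∈ sem CT P α e) : cl CT P X + Z ⊆ sem CT P α e := by
  rintro _ ⟨x, hx, z, hz, rfl⟩
  exact cl_sem_subset _ _ (Cov.bind hx fun x hx => subset_cl (h x hx z hz))

theorem extend_lift {n m : ℕ} (σ : Sub L n m) (e : ℕ ⊕ Fin m → L.Term ℕ) (t : L.Term ℕ) :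
    (fun x => (σ.lift x).subst (extend e t)) = extend (fun x => (σ x).subst e) t := by
  have key : ∀ s : L.Term (ℕ ⊕ Fin m),
      (s.relabel (Sum.map id Fin.succ)).subst (extend e t) = s.subst e := by
    intro s
    rw [term_relabel_subst]
    congr 1
    funext x
    cases x <;> rfl
  funext x
  cases x with
  | inl x => exact key _
  | inr i => exact Fin.cases rfl (fun j => key _) i

theorem sem_subst {n : ℕ} (α : LForm L User n) : ∀ {m : ℕ} (σ : Sub L n m)
    (e : ℕ ⊕ Fin m → L.Term ℕ), sem CT P (α.subst σ) e = sem CT P α fun x => (σ x).subst e := by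
  induction α with
  | user | rel | eq => intro m σ e; simp only [LForm.subst, sem, term_subst_subst]
  | one | zero | top => intro m σ e; rfl
  | tensor α β ih₁ ih₂ => intro m σ e; simp only [LForm.subst, sem, ih₁, ih₂]
  | lolli α β ih₁ ih₂ => intro m σ e; simp only [LForm.subst, sem, ih₁, ih₂]
  | amp α β ih₁ ih₂ => intro m σ e; simp only [LForm.subst, sem, ih₁, ih₂]
  | plus α β ih₁ ih₂ => intro m σ e; simp only [LForm.subst, sem, ih₁, ih₂]
  | bang α ih => intro m σ e; simp only [LForm.subst, sem, ih]
  | all α ih => intro m σ e; simp only [LForm.subst, sem, ih, extend_lift]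
  | ex α ih => intro m σ e; simp only [LForm.subst, sem, ih, extend_lift]

theorem extend_agree {n : ℕ} {e e' : ℕ ⊕ Fin n → L.Term ℕ} (t : L.Term ℕ)
    (h : ∀ i, e (Sum.inr i) = e' (Sum.inr i)) (i : Fin (n + 1)) :
    extend e t (Sum.inr i) = extend e' t (Sum.inr i) := by
  refine Fin.cases rfl (fun j => ?_) i
  simp [extend, h]

theorem sem_congr {n : ℕ} (α : LForm L User n) : ∀ {e e' : ℕ ⊕ Fin n → L.Term ℕ},
    (∀ x ∈ α.fv, e (Sum.inl x) = e' (Sum.inl x)) → (∀ i, e (Sum.inr i) = e' (Sum.inr i)) →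
    sem CT P α e = sem CT P α e' := by
  induction α with
  | user c ts =>
    intro e e' h h'
    have : (fun i => (ts i).subst e) = fun i => (ts i).subst e' := funext fun i =>
      term_subst_congr_left (fun x hx => h x (by simpa [LForm.fv] using ⟨i, hx⟩)) h'
    simp only [sem, this]
  | rel R ts =>
    intro e e' h h'
    have : (fun i => (ts i).subst e) = fun i => (ts i).subst e' := funext fun i =>
      term_subst_congr_left (fun x hx => h x (by simpa [LForm.fv] using ⟨i, hx⟩)) h'
    simp only [sem, this]
  | eq t s =>
    intro e e' h h'
    have h₁ : t.subst e = t.subst e' :=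
      term_subst_congr_left (fun x hx => h x (by simp [LForm.fv, hx])) h'
    have h₂ : s.subst e = s.subst e' :=
      term_subst_congr_left (fun x hx => h x (by simp [LForm.fv, hx])) h'
    simp only [sem, h₁, h₂]
  | one | zero | top => intros; rfl
  | tensor α β ih₁ ih₂ | lolli α β ih₁ ih₂ | amp α β ih₁ ih₂ | plus α β ih₁ ih₂ =>
    intro e e' h h'
    simp only [sem]
    rw [ih₁ (fun x hx => h x (by simp [LForm.fv, hx])) h',
      ih₂ (fun x hx => h x (by simp [LForm.fv, hx])) h']
  | bang α ih =>
    intro e e' h h'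
    simp only [sem]
    rw [ih h h']
  | all α ih | ex α ih =>
    intro e e' h h'
    have : ∀ t, sem CT P α (extend e t) = sem CT P α (extend e' t) := fun t =>
      ih (fun x hx => h x hx) (extend_agree t h')
    simp only [sem, this]

/-- Change the value of a valuation at one free variable. -/
def updVal (e : ℕ ⊕ Fin 0 → L.Term ℕ) (x : ℕ) (t : L.Term ℕ) : ℕ ⊕ Fin 0 → L.Term ℕ :=
  Function.update e (Sum.inl x) t

theorem sem_updVal {α : LForm L User 0} {e : ℕ ⊕ Fin 0 → L.Term ℕ} {x : ℕ} (t : L.Term ℕ)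
    (h : x ∉ α.fv) : sem CT P α (updVal e x t) = sem CT P α e := by
  apply sem_congr
  · intro y hy
    have : y ≠ x := fun e => h (e ▸ hy)
    simp [updVal, this]
  · exact fun i => i.elim0

theorem sem_inst (α : LForm L User 1) (t : L.Term (ℕ ⊕ Fin 0)) (e : ℕ ⊕ Fin 0 → L.Term ℕ) :
    sem CT P (α.inst t) e = sem CT P α (extend e (t.subst e)) := by
  rw [LForm.inst, sem_subst]
  congr 1
  funext x
  cases x with
  | inl x => rfl
  | inr i => rw [Subsingleton.elim i 0]; rfl

theorem sem_inst_freeVar {α : LForm L User 1} {a : ℕ} (ha : a ∉ α.fv) (t : L.Term ℕ)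
    (e : ℕ ⊕ Fin 0 → L.Term ℕ) :
    sem CT P (α.inst (freeVar a)) (updVal e a t) = sem CT P α (extend e t) := by
  rw [sem_inst]
  apply sem_congr
  · intro y hy
    have : y ≠ a := fun e => ha (e ▸ hy)
    simp [updVal, extend, this]
  · intro i
    rw [Subsingleton.elim i 0]
    simp [extend, freeVar, updVal]

theorem sem_exVar (x : ℕ) (α : LForm L User 0) (e : ℕ ⊕ Fin 0 → L.Term ℕ) :
    sem CT P (LForm.exVar x α) e = cl CT P (⋃ t, sem CT P α (updVal e x t)) := by
  simp only [LForm.exVar, sem, sem_subst]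
  congr! 4 with t
  funext y
  cases y with
  | inr i => exact i.elim0
  | inl y => by_cases h : y = x <;> simp [Sub.close, extend, updVal, h]

/-- The valuation `e'` records the witnesses of the whole block of quantifiers; `sem_exVars_subset`
is the corresponding elimination. -/
theorem sem_subset_exVars {α : LForm L User 0} {e' : ℕ ⊕ Fin 0 → L.Term ℕ} :
    ∀ (l : List ℕ) (e : ℕ ⊕ Fin 0 → L.Term ℕ),
      (∀ x ∉ l, e' (Sum.inl x) = e (Sum.inl x)) →
      sem CT P α e' ⊆ sem CT P (l.foldr LForm.exVar α) e
  | [], e, h => (sem_congr α (fun x _ => h x (by simp)) fun i => i.elim0).subset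
  | x :: l, e, h => by
      rw [List.foldr_cons, sem_exVar]
      refine (sem_subset_exVars l (updVal e x (e' (Sum.inl x))) fun y hy => ?_).trans
        ((Set.subset_iUnion (fun t => sem CT P (l.foldr LForm.exVar α) (updVal e x t)) _).trans
          subset_cl)
      by_cases hyx : y = x
      · subst hyx; simp [updVal]
      · simpa [updVal, hyx] using h y (by simp [hy, hyx])

theorem sem_exVars_subset {α : LForm L User 0} (hX : cl CT P X ⊆ X) :
    ∀ (l : List ℕ) (e : ℕ ⊕ Fin 0 → L.Term ℕ),
      (∀ e', (∀ x ∉ l, e' (Sum.inl x) = e (Sum.inl x)) → sem CT P α e' ⊆ X) →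
      sem CT P (l.foldr LForm.exVar α) e ⊆ X
  | [], e, h => h e fun _ _ => rfl
  | x :: l, e, h => by
      rw [List.foldr_cons, sem_exVar]
      refine (cl_mono (Set.iUnion_subset fun t =>
        sem_exVars_subset hX l _ fun e' he' => ?_)).trans hX
      refine h e' fun y hy => ?_
      simp only [List.mem_cons, not_or] at hy
      rw [he' y hy.2]
      simp [updVal, hy.1]

theorem cl_add_cl : cl CT P (cl CT P X + cl CT P Y) = cl CT P (X + Y) := by
  apply Set.Subset.antisymm
  · refine cl_subset_cl ?_
    rintro _ ⟨x, hx, y, hy, rfl⟩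
    exact Cov.add hx hy fun x hx y hy => subset_cl (Set.add_mem_add hx hy)
  · exact cl_mono (Set.add_subset_add subset_cl subset_cl)

theorem cl_union_cl : cl CT P (cl CT P X ∪ cl CT P Y) = cl CT P (X ∪ Y) :=
  Set.Subset.antisymm
    (cl_subset_cl (Set.union_subset (cl_mono Set.subset_union_left)
      (cl_mono Set.subset_union_right)))
    (cl_mono (Set.union_subset_union subset_cl subset_cl))

/-- The generator `m` itself has no user-defined part, so restricting to such stores loses nothing
after closure. -/
theorem cl_bang_cl {m : Store L User} (h : m.1 = 0) :
    cl CT P {n ∈ cl CT P {m} | n.1 = 0} = cl CT P {m} := by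
  apply Set.Subset.antisymm
  · exact cl_subset_cl fun n hn => hn.1
  · refine cl_mono ?_
    rintro _ rfl
    exact ⟨subset_cl rfl, h⟩

/-- The closures of sums and unions depend only on generators, so conjunction adds the disjuncts
pairwise and disjunction collects them. For `⊥`, its store is already covered by the empty set. -/
theorem sem_toL (G : Goal L User) (e : ℕ ⊕ Fin 0 → L.Term ℕ) :
    sem CT P G.toL e = cl CT P {n | n ∈ (G.subst fun x => e (Sum.inl x)).dnf} := by
  induction G with
  | top => simp [Goal.toL, sem, Goal.subst, Goal.dnf]
  | user c ts => simp [Goal.toL, sem, Goal.subst, Goal.dnf, emb, term_relabel_subst]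
  | bot =>
    simp only [Goal.toL, sem, Goal.subst, Goal.dnf, List.mem_singleton, Set.ofPred_eq_eq_singleton]
    refine Set.Subset.antisymm (cl_mono (Set.empty_subset _)) (cl_subset_cl ?_)
    rintro _ rfl
    have := Cov.bot (CT := CT) (P := P) (X := ∅) 0
    rwa [zero_add] at this
  | eq t s =>
    simp only [Goal.toL, sem, Goal.subst, Goal.dnf, List.mem_singleton, Set.ofPred_eq_eq_singleton]
    rw [cl_bang_cl (by rfl)]
    simp [emb, term_relabel_subst]
  | rel R ts =>
    simp only [Goal.toL, sem, Goal.subst, Goal.dnf, List.mem_singleton, Set.ofPred_eq_eq_singleton]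
    rw [cl_bang_cl (by rfl)]
    simp [emb, term_relabel_subst]
  | and G G' ih ih' =>
    simp only [Goal.toL, sem, ih, ih', cl_add_cl]
    congr 1
    ext n
    simp only [Goal.subst, Goal.dnf, Set.mem_add, Set.mem_ofPred_eq, List.mem_flatMap,
      List.mem_map]
  | or G G' ih ih' =>
    simp only [Goal.toL, sem, ih, ih', cl_union_cl]
    congr 1
    ext n
    simp [Goal.subst, Goal.dnf]

end Semantics

/-! ### Soundness of the phase semantics -/

section Soundness

open scoped Pointwise

variable {CT : ConstraintTheory L User} {P : Program L User}

theorem mem_sem_toL {G : Goal L User} {e : ℕ ⊕ Fin 0 → L.Term ℕ} {n : Store L User}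
    (h : n ∈ (G.subst fun x => e (Sum.inl x)).dnf) : n ∈ sem CT P G.toL e := by
  rw [sem_toL]
  exact subset_cl h

theorem sem_toL_subset {G : Goal L User} {e : ℕ ⊕ Fin 0 → L.Term ℕ} {m : ℕ}
    {β : LForm L User m} {e' : ℕ ⊕ Fin m → L.Term ℕ}
    (h : ∀ n ∈ (G.subst fun x => e (Sum.inl x)).dnf, n ∈ sem CT P β e') :
    sem CT P G.toL e ⊆ sem CT P β e' := by
  rw [sem_toL]
  exact cl_subset_sem h

theorem sem_of_entail {n : ℕ} {α : LForm L User n} {e : ℕ ⊕ Fin n → L.Term ℕ} {m : Store L User}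
    {b b' : Multiset {G : Goal L User // G.IsBuiltin}}
    (hb : ∀ a ∈ b', CT.Le (conj b).toI a.1.toI) (h : m + (0, b) + (0, b') ∈ sem CT P α e) :
    m + (0, b) ∈ sem CT P α e :=
  cl_sem_subset _ _ (Cov.entail hb (subset_cl h))

theorem sem_mono_builtin {n : ℕ} {α : LForm L User n} {e : ℕ ⊕ Fin n → L.Term ℕ}
    {m k : Store L User} (hk : k.1 = 0) (h : m ∈ sem CT P α e) : m + k ∈ sem CT P α e := by
  have := Cov.mono_builtin (Cov.of_mem (CT := CT) (P := P) h) k.2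
  rw [← hk] at this
  exact cl_sem_subset _ _ this

/-- Validity comes from the constructor `ct`. The valuation `σ'` witnesses the left quantifier, the
hypothesis yields the right one at `σ`, and the fresh names provided by `ct` witness it. -/
theorem sem_sigmaCT {s s' : Finset ℕ} {B B' : Goal L User} (hB : B.IsBuiltin)
    (hB' : B'.IsBuiltin) (h : CT.Le (IForm.exSet s B.toI) (IForm.exSet s' B'.toI))
    (e : ℕ ⊕ Fin 0 → L.Term ℕ) :
    sem CT P (LForm.exSet s B.toL) e ⊆ sem CT P (LForm.exSet s' B'.toL) e := by
  refine sem_exVars_subset (cl_sem_subset _ _) _ e fun e' he' => sem_toL_subset fun n hn => ?_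
  set σ : ℕ → L.Term ℕ := fun x => e (Sum.inl x) with hσ
  set σ' : ℕ → L.Term ℕ := fun x => e' (Sum.inl x) with hσ'
  have hBσ : (B.subst σ').IsBuiltin := hB.subst
  rw [hBσ.dnf, List.mem_singleton] at hn
  subst hn
  rw [hBσ.atoms_eq, ← zero_add ((0, (B.subst σ').atoms.2) : Store L User)]
  refine cl_sem_subset _ _ (.ct 0 _ hB' s' σ ∅ ?_ fun ρ hρ _ => subset_cl ?_)
  · have h₁ : CT.Le (conj (B.subst σ').atoms.2).toI (B.subst σ').toI :=
      hBσ.atoms_le fun a ha => .conj_left ha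
    have h₂ : CT.Le (conj (B.subst σ').atoms.2).toI
        ((IForm.exSet s B.toI).subst (Sub.ofTerms σ)) := by
      refine ConstraintTheory.Le.exSet_subst_intro (τ := Sub.ofTerms σ') ?_ fun x hx => ?_
      · rwa [Goal.toI_subst fun x _ => rfl]
      · simp only [Sub.ofTerms_inl, hσ, hσ']
        rw [he' x (by simpa using hx)]
    exact h₂.trans (h.subst _)
  · have hBτ : (B'.subst (freshen σ s' ρ)).IsBuiltin := hB'.subst
    have h₁ : (B'.subst (freshen σ s' ρ)).atoms ∈ sem CT P (LForm.exSet s' B'.toL) e := by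
      refine sem_subset_exVars (e' := Sum.elim (freshen σ s' ρ) Fin.elim0) _ e (fun x hx => ?_)
        (mem_sem_toL ?_)
      · have : x ∉ s' := by simpa using hx
        simp [freshen, this, hσ]
      · simp only [Sum.elim_inl]
        rw [hBτ.dnf, List.mem_singleton]
    -- The constructor `ct` adds the instance of `B'` as a single constraint, while the denotation
    -- is generated by its atoms; these are entailed.
    refine sem_of_entail (m := 0 + (0, (B.subst σ').atoms.2)) ?_ (b' :=
      (B'.subst (freshen σ s' ρ)).atoms.2) ?_
    · intro a ha
      exact (ConstraintTheory.Le.conj_left (Multiset.mem_singleton_self _)).trans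
        (hBτ.le_atoms a ha)
    · have := sem_mono_builtin (k := (0, (B.subst σ').atoms.2) +
        Store.builtin (B'.subst (freshen σ s' ρ)) hBτ) rfl h₁
      rw [← hBτ.atoms_eq, add_comm]
      simpa [Store.builtin] using this

theorem sem_sigmaEq {k : ℕ} (c : User k) (ts : Fin k → L.Term ℕ) (j : Fin k) (s : L.Term ℕ)
    (e : ℕ ⊕ Fin 0 → L.Term ℕ) :
    sem CT P ((Goal.user c ts).and (Goal.eq (ts j) s)).toL e ⊆
      sem CT P ((Goal.user c (Function.update ts j s)).and (Goal.eq (ts j) s)).toL e := by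
  refine sem_toL_subset fun n hn => cl_sem_subset _ _ ?_
  simp only [Goal.subst, Goal.dnf, List.flatMap_cons, List.flatMap_nil, List.map_cons,
    List.map_nil, List.append_nil, List.mem_singleton] at hn
  subst hn
  set σ : ℕ → L.Term ℕ := fun x => e (Sum.inl x)
  have := Cov.eq (CT := CT) (P := P) 0 c (fun i => (ts i).subst σ) j (s.subst σ) (X := sem CT P
    ((Goal.user c (Function.update ts j s)).and (Goal.eq (ts j) s)).toL e) (Cov.of_mem ?_)
  · rwa [zero_add] at this
  · refine mem_sem_toL ?_
    have hu : (fun i => (Function.update ts j s i).subst σ) =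
        Function.update (fun i => (ts i).subst σ) j (s.subst σ) := by
      funext i
      by_cases hij : i = j
      · subst hij; simp
      · simp [hij]
    simp only [Goal.subst, Goal.dnf, List.flatMap_cons, List.flatMap_nil, List.map_cons,
      List.map_nil, List.append_nil, List.mem_singleton, zero_add]
    rw [← hu]

theorem sem_sigmaP {r₀ r : Rule L User} (hr₀ : r₀ ∈ P) (hr : r.IsVariant r₀)
    (e : ℕ ⊕ Fin 0 → L.Term ℕ) :
    sem CT P (LForm.tensor (LForm.tensor r.kept.toL r.removed.toL) r.guard.toL) e ⊆
      sem CT P (LForm.tensor r.kept.toL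
        (LForm.exSet r.locals (LForm.tensor r.body.toL r.guard.toL))) e := by
  refine sem_toL_subset (G := (r.kept.and r.removed).and r.guard) fun n hn => ?_
  set σ : ℕ → L.Term ℕ := fun x => e (Sum.inl x) with hσ
  have hk : (r.kept.subst σ).IsUser := r.kept_user.subst
  have hd : (r.removed.subst σ).IsUser := r.removed_user.subst
  have hg : (r.guard.subst σ).IsBuiltin := r.guard_builtin.subst
  simp only [Goal.subst, Goal.dnf, hk.dnf, hd.dnf, hg.dnf, List.flatMap_cons, List.flatMap_nil,
    List.map_cons, List.map_nil, List.append_nil, List.mem_singleton] at hn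
  subst hn
  rw [← zero_add (r.kept.subst σ).atoms]
  refine cl_sem_subset _ _ (.rule 0 σ ∅ hr₀ hr fun ρ _ _ n hn => subset_cl ?_)
  have hgτ : (r.guard.subst (freshen σ r.locals ρ)).IsBuiltin := r.guard_builtin.subst
  have h₁ : n + (r.guard.subst (freshen σ r.locals ρ)).atoms ∈
      sem CT P (LForm.exSet r.locals (LForm.tensor r.body.toL r.guard.toL)) e := by
    refine sem_subset_exVars (e' := Sum.elim (freshen σ r.locals ρ) Fin.elim0) _ e
      (fun x hx => ?_) ?_
    · have : x ∉ r.locals := by simpa using hx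
      simp [freshen, this, hσ]
    · refine mem_sem_toL (G := r.body.and r.guard) (Goal.mem_dnf_and.2 ?_)
      refine ⟨n, hn, _, ?_, rfl⟩
      change _ ∈ (r.guard.subst (freshen σ r.locals ρ)).dnf
      rw [hgτ.dnf, List.mem_singleton]
  have h₂ : (r.kept.subst σ).atoms ∈ sem CT P r.kept.toL e := by
    refine mem_sem_toL ?_
    rw [hk.dnf, List.mem_singleton]
  -- The `σ`-instance of the guard is left over beside the required store; being built-in, it does
  -- no harm.
  have h₃ := sem_mono_builtin (α := LForm.tensor r.kept.toL
    (LForm.exSet r.locals (LForm.tensor r.body.toL r.guard.toL))) (e := e) hg.atoms_fst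
    (subset_cl (CT := CT) (P := P) (Set.add_mem_add h₂ h₁))
  convert h₃ using 1
  abel

/-- The set of stores denoted by a multiset of formulas. -/
def semCtx (CT : ConstraintTheory L User) (P : Program L User)
    (Γ : Multiset (LForm L User 0)) (e : ℕ ⊕ Fin 0 → L.Term ℕ) : Set (Store L User) :=
  (Γ.map fun α => sem CT P α e).sum

/-! ### Interpretation of contexts and validity of the sequent rules. -/

@[simp] theorem semCtx_zero (e : ℕ ⊕ Fin 0 → L.Term ℕ) : semCtx CT P 0 e = {0} := by
  simp [semCtx, Set.singleton_zero]

@[simp] theorem semCtx_cons (α : LForm L User 0) (Γ : Multiset (LForm L User 0))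
    (e : ℕ ⊕ Fin 0 → L.Term ℕ) :
    semCtx CT P (α ::ₘ Γ) e = sem CT P α e + semCtx CT P Γ e := by simp [semCtx]

@[simp] theorem semCtx_singleton (α : LForm L User 0) (e : ℕ ⊕ Fin 0 → L.Term ℕ) :
    semCtx CT P {α} e = sem CT P α e := by simp [semCtx]

@[simp] theorem semCtx_add (Γ Δ : Multiset (LForm L User 0)) (e : ℕ ⊕ Fin 0 → L.Term ℕ) :
    semCtx CT P (Γ + Δ) e = semCtx CT P Γ e + semCtx CT P Δ e := by simp [semCtx]

theorem semCtx_updVal {Γ : Multiset (LForm L User 0)} {a : ℕ} (h : ∀ γ ∈ Γ, a ∉ γ.fv)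
    (e : ℕ ⊕ Fin 0 → L.Term ℕ) (t : L.Term ℕ) :
    semCtx CT P Γ (updVal e a t) = semCtx CT P Γ e := by
  unfold semCtx
  rw [Multiset.map_congr rfl fun γ hγ => sem_updVal t (h γ hγ)]

/-- Sums of stores without user-defined constraints are again such stores; this is what promotion
needs. -/
theorem semCtx_bang (Γ : Multiset (LForm L User 0)) (e : ℕ ⊕ Fin 0 → L.Term ℕ) :
    semCtx CT P (Γ.map LForm.bang) e ⊆
      cl CT P {m ∈ semCtx CT P (Γ.map LForm.bang) e | m.1 = 0} := by
  induction Γ using Multiset.induction_on with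
  | empty => exact fun m hm => subset_cl ⟨hm, by simp at hm; rw [hm]; rfl⟩
  | cons α Γ ih =>
    rw [Multiset.map_cons, semCtx_cons]
    rintro _ ⟨x, hx, y, hy, rfl⟩
    refine Cov.add hx (ih hy) fun x hx y hy => subset_cl ⟨Set.add_mem_add (subset_cl hx) hy.1, ?_⟩
    simp [hx.2, hy.2]

theorem add_subset {A B C : Set (Store L User)} (h : ∀ x ∈ A, ∀ y ∈ B, x + y ∈ C) :
    A + B ⊆ C := by
  rintro _ ⟨x, hx, y, hy, rfl⟩
  exact h x hx y hy

/-- Left rules for generated connectives are tested on generators; eigenvariable rules hold because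
validity at every valuation allows the eigenvariable to be redirected; cut is composition of
inclusions together with monotonicity of addition. -/
theorem ILL.sound {Γ : Multiset (LForm L User 0)} {α : LForm L User 0}
    (h : ILL (sigma CT P) Γ α) : ∀ e, semCtx CT P Γ e ⊆ sem CT P α e := by
  induction h with
  | proper h =>
    intro e
    rcases h with (⟨s, s', B, B', hB, hB', h, hq⟩ | ⟨k, c, ts, j, s, hq⟩) | ⟨r₀, hr₀, r, hr, hq⟩
    all_goals
      rw [Prod.mk.injEq] at hq
      obtain ⟨rfl, rfl⟩ := hq
      rw [semCtx_singleton]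
    · exact sem_sigmaCT hB hB' h e
    · exact sem_sigmaEq c ts j s e
    · exact sem_sigmaP hr₀ hr e
  | id α => exact fun e => by simp
  | cut _ _ ih₁ ih₂ =>
    intro e
    rw [semCtx_add]
    refine (Set.add_subset_add_right (ih₁ e)).trans ?_
    rw [← semCtx_cons]
    exact ih₂ e
  | tensorL _ ih =>
    intro e
    rw [semCtx_cons]
    refine add_subset_sem fun x hx z hz => ih e ?_
    rw [semCtx_cons, semCtx_cons, ← add_assoc]
    exact Set.add_mem_add hx hz
  | tensorR _ _ ih₁ ih₂ =>
    intro e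
    rw [semCtx_add]
    exact (Set.add_subset_add (ih₁ e) (ih₂ e)).trans subset_cl
  | oneL _ ih =>
    intro e
    rw [semCtx_cons]
    refine add_subset_sem fun x hx z hz => ih e ?_
    rw [Set.mem_singleton_iff.1 hx, zero_add]
    exact hz
  | oneR =>
    intro e
    rw [semCtx_zero]
    exact subset_cl
  | lolliL _ _ ih₁ ih₂ =>
    intro e
    rw [semCtx_cons, semCtx_add]
    refine add_subset fun x hx y hy => ?_
    obtain ⟨g, hg, d, hd, rfl⟩ := hy
    refine ih₂ e ?_
    rw [semCtx_cons]
    exact ⟨x + g, hx g (ih₁ e hg), d, hd, add_assoc _ _ _⟩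
  | lolliR _ ih =>
    intro e m hm n hn
    refine ih e ?_
    rw [semCtx_cons]
    exact ⟨n, hn, m, hm, add_comm _ _⟩
  | @bangR Γ α _ ih =>
    intro e
    exact (semCtx_bang Γ e).trans (cl_mono fun m hm => ⟨ih e hm.1, hm.2⟩)
  | dereliction _ ih =>
    intro e
    rw [semCtx_cons]
    refine add_subset_sem fun x hx z hz => ih e ?_
    rw [semCtx_cons]
    exact Set.add_mem_add hx.1 hz
  | contraction _ ih =>
    intro e
    rw [semCtx_cons]
    refine add_subset_sem fun x hx z hz => ?_
    have h₁ : x + (x + z) ∈ _ := ih e (by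
      rw [semCtx_cons, semCtx_cons]
      exact Set.add_mem_add (subset_cl hx) (Set.add_mem_add (subset_cl hx) hz))
    -- Since `x` is purely built-in, its second copy is entailed by the first.
    have hx' : x = (0, x.2) := Prod.ext hx.2 rfl
    rw [add_comm]
    rw [← add_assoc, add_comm, ← add_assoc, hx'] at h₁
    rw [hx']
    exact sem_of_entail (fun a ha => .conj_left ha) h₁
  | weakening _ ih =>
    intro e
    rw [semCtx_cons]
    refine add_subset_sem fun x hx z hz => ?_
    rw [add_comm]
    exact sem_mono_builtin hx.2 (ih e hz)
  | ampL1 _ ih =>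
    intro e
    refine Set.Subset.trans ?_ (ih e)
    rw [semCtx_cons, semCtx_cons]
    exact Set.add_subset_add_right Set.inter_subset_left
  | ampL2 _ ih =>
    intro e
    refine Set.Subset.trans ?_ (ih e)
    rw [semCtx_cons, semCtx_cons]
    exact Set.add_subset_add_right Set.inter_subset_right
  | ampR _ _ ih₁ ih₂ => exact fun e => Set.subset_inter (ih₁ e) (ih₂ e)
  | topR => exact fun e => Set.subset_univ _
  | plusL _ _ ih₁ ih₂ =>
    intro e
    rw [semCtx_cons]
    refine add_subset_sem fun x hx z hz => ?_
    rcases hx with hx | hx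
    · exact ih₁ e (by rw [semCtx_cons]; exact Set.add_mem_add hx hz)
    · exact ih₂ e (by rw [semCtx_cons]; exact Set.add_mem_add hx hz)
  | plusR1 _ ih => exact fun e => (ih e).trans (Set.subset_union_left.trans subset_cl)
  | plusR2 _ ih => exact fun e => (ih e).trans (Set.subset_union_right.trans subset_cl)
  | zeroL α =>
    intro e
    rw [semCtx_singleton]
    exact cl_subset_sem (Set.empty_subset _)
  | allL t _ ih =>
    intro e
    refine Set.Subset.trans ?_ (ih e)
    rw [semCtx_cons, semCtx_cons, sem_inst]
    exact Set.add_subset_add_right (Set.iInter_subset _ _)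
  | allR a ha hΓ _ ih =>
    intro e
    refine Set.subset_iInter fun t => ?_
    have := ih (updVal e a t)
    rwa [semCtx_updVal hΓ, sem_inst_freeVar ha] at this
  | exL a ha hβ hΓ _ ih =>
    intro e
    rw [semCtx_cons]
    refine add_subset_sem fun x hx z hz => ?_
    obtain ⟨t, hx⟩ := Set.mem_iUnion.1 hx
    have := ih (updVal e a t)
    rw [semCtx_cons, semCtx_updVal hΓ, sem_inst_freeVar ha, sem_updVal t hβ] at this
    exact this (Set.add_mem_add hx hz)
  | exR t _ ih =>
    intro e
    refine (ih e).trans ?_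
    rw [sem_inst]
    exact (Set.subset_iUnion (fun t => sem CT P _ (extend e t)) _).trans subset_cl

end Soundness

/-! ### Stores as goals -/

theorem GoalEquiv.subst {G G' : Goal L User} (h : GoalEquiv G G') (σ : ℕ → L.Term ℕ) :
    GoalEquiv (G.subst σ) (G'.subst σ) := by
  induction h with
  | refl => exact .refl _
  | symm _ ih => exact ih.symm
  | trans _ _ ih₁ ih₂ => exact ih₁.trans ih₂
  | andCongr _ _ ih₁ ih₂ => exact .andCongr ih₁ ih₂
  | orCongr _ _ ih₁ ih₂ => exact .orCongr ih₁ ih₂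
  | assoc => exact .assoc _ _ _
  | comm => exact .comm _ _
  | topAnd => exact .topAnd _
  | distrib => exact .distrib _ _ _

theorem GoalEquiv.andTop (G : Goal L User) : GoalEquiv (G.and Goal.top) G :=
  (GoalEquiv.comm _ _).trans (.topAnd _)

theorem GoalEquiv.and_left_comm (G₁ G₂ G₃ : Goal L User) :
    GoalEquiv (G₁.and (G₂.and G₃)) (G₂.and (G₁.and G₃)) :=
  (GoalEquiv.assoc _ _ _).symm.trans ((GoalEquiv.andCongr (.comm _ _) (.refl _)).trans
    (.assoc _ _ _))

theorem GoalEquiv.and_and_and_comm (G₁ G₂ G₃ G₄ : Goal L User) :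
    GoalEquiv ((G₁.and G₂).and (G₃.and G₄)) ((G₁.and G₃).and (G₂.and G₄)) :=
  (GoalEquiv.assoc _ _ _).trans ((GoalEquiv.andCongr (.refl _) (.and_left_comm _ _ _)).trans
    (GoalEquiv.assoc _ _ _).symm)

section Conj

variable {p : Goal L User → Prop}

theorem GoalEquiv.foldr_perm {l l' : List (Goal L User)} (h : l.Perm l') :
    GoalEquiv (l.foldr Goal.and Goal.top) (l'.foldr Goal.and Goal.top) := by
  induction h with
  | nil => exact .refl _
  | cons _ _ ih => exact .andCongr (.refl _) ih
  | swap => exact .and_left_comm _ _ _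
  | trans _ _ ih₁ ih₂ => exact ih₁.trans ih₂

theorem conj_zero : conj (0 : Multiset {G : Goal L User // p G}) = Goal.top := by simp [conj]

theorem conj_cons (a : {G : Goal L User // p G}) (s : Multiset {G : Goal L User // p G}) :
    GoalEquiv (conj (a ::ₘ s)) (a.1.and (conj s)) := by
  have h : (a ::ₘ s).toList.Perm (a :: s.toList) := by
    rw [← Multiset.coe_eq_coe, Multiset.coe_toList, ← Multiset.cons_coe, Multiset.coe_toList]
  exact GoalEquiv.foldr_perm (h.map Subtype.val)

theorem conj_add (s t : Multiset {G : Goal L User // p G}) :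
    GoalEquiv (conj (s + t)) ((conj s).and (conj t)) := by
  induction s using Multiset.induction_on with
  | empty => rw [zero_add, conj_zero]; exact (GoalEquiv.topAnd _).symm
  | cons a s ih =>
    rw [Multiset.cons_add]
    exact (conj_cons _ _).trans ((GoalEquiv.andCongr (.refl _) ih).trans
      ((GoalEquiv.assoc _ _ _).symm.trans (.andCongr (conj_cons _ _).symm (.refl _))))

theorem conj_singleton (a : {G : Goal L User // p G}) : conj {a} = a.1.and Goal.top := by
  simp [conj]

theorem mem_vars_conj {s : Multiset {G : Goal L User // p G}} {x : ℕ} :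
    x ∈ (conj s).vars ↔ ∃ a ∈ s, x ∈ a.1.vars := by
  simp only [← Multiset.mem_toList]
  unfold conj
  induction s.toList with
  | nil => simp [Goal.vars]
  | cons a l ih =>
    simp only [List.map_cons, List.foldr_cons, Goal.vars, Finset.mem_union, ih, List.mem_cons,
      exists_eq_or_imp]

theorem ConstraintTheory.Le.conj_subst_right {CT : ConstraintTheory L User}
    {s : Multiset {G : Goal L User // p G}} {φ : IForm L 0} {σ : ℕ → L.Term ℕ}
    (h : ∀ a ∈ s, CT.Le φ (a.1.subst σ).toI) : CT.Le φ ((conj s).subst σ).toI := by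
  simp only [← Multiset.mem_toList] at h
  unfold conj
  generalize s.toList = l at h
  induction l with
  | nil => exact .truth _
  | cons b l ih => exact .and (h b (by simp)) (ih fun a ha => h a (by simp [ha]))

theorem conj_map_subst {σ : ℕ → L.Term ℕ} (f : {G : Goal L User // p G} → {G : Goal L User // p G})
    (hf : ∀ a, (f a).1 = a.1.subst σ) (s : Multiset {G : Goal L User // p G}) :
    GoalEquiv (conj (s.map f)) ((conj s).subst σ) := by
  induction s using Multiset.induction_on with
  | empty => rw [Multiset.map_zero, conj_zero]; exact .refl _
  | cons a s ih =>
    rw [Multiset.map_cons]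
    refine (conj_cons _ _).trans ?_
    rw [hf]
    exact (GoalEquiv.andCongr (.refl _) ih).trans ((conj_cons a s).subst σ).symm

end Conj

namespace Store

/-- The goal described by a store. -/
noncomputable def goal (m : Store L User) : Goal L User := (conj m.1).and (conj m.2)

theorem goal_add (m n : Store L User) : GoalEquiv (m + n).goal (m.goal.and n.goal) :=
  (GoalEquiv.andCongr (conj_add _ _) (conj_add _ _)).trans (.and_and_and_comm _ _ _ _)

/-- The variables of a store. -/
noncomputable def vars (m : Store L User) : Finset ℕ := m.goal.vars

theorem vars_eq (m : Store L User) : m.vars = (conj m.1).vars ∪ (conj m.2).vars := rfl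

theorem vars_add (m n : Store L User) : (m + n).vars = m.vars ∪ n.vars := (goal_add m n).vars_eq

theorem goal_user (G : Goal L User) (h : G.IsUser) : GoalEquiv (user G h).goal G := by
  unfold goal user
  rw [conj_zero, conj_singleton]
  exact (GoalEquiv.andTop _).trans (.andTop _)

theorem goal_builtin (G : Goal L User) (h : G.IsBuiltin) : GoalEquiv (builtin G h).goal G := by
  unfold goal builtin
  rw [conj_zero, conj_singleton]
  exact (GoalEquiv.topAnd _).trans (.andTop _)

theorem goal_zero : GoalEquiv (0 : Store L User).goal Goal.top := by
  unfold goal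
  rw [Prod.fst_zero, Prod.snd_zero, conj_zero, conj_zero]
  exact .topAnd _

theorem vars_user (G : Goal L User) (h : G.IsUser) : (user G h).vars = G.vars :=
  (goal_user G h).vars_eq

theorem vars_builtin (G : Goal L User) (h : G.IsBuiltin) : (builtin G h).vars = G.vars :=
  (goal_builtin G h).vars_eq

/-- Substitution in a store. -/
def subst (σ : ℕ → L.Term ℕ) (m : Store L User) : Store L User :=
  (m.1.map fun a => ⟨a.1.subst σ, a.2.subst⟩, m.2.map fun a => ⟨a.1.subst σ, a.2.subst⟩)

theorem subst_add (σ : ℕ → L.Term ℕ) (m n : Store L User) :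
    (m + n).subst σ = m.subst σ + n.subst σ := by simp [subst]

theorem subst_user (σ : ℕ → L.Term ℕ) (G : Goal L User) (h : G.IsUser) :
    (user G h).subst σ = user (G.subst σ) h.subst := by simp [subst, user]

theorem subst_builtin (σ : ℕ → L.Term ℕ) (G : Goal L User) (h : G.IsBuiltin) :
    (builtin G h).subst σ = builtin (G.subst σ) h.subst := by simp [subst, builtin]

theorem subst_subst (σ τ : ℕ → L.Term ℕ) (m : Store L User) :
    (m.subst σ).subst τ = m.subst fun x => (σ x).subst τ := by
  simp [subst, Goal.subst_subst]

theorem mem_vars_of_fst {m : Store L User} {a : {G : Goal L User // G.IsUser}} {x : ℕ}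
    (ha : a ∈ m.1) (hx : x ∈ a.1.vars) : x ∈ m.vars := by
  rw [vars_eq, Finset.mem_union]
  exact Or.inl (mem_vars_conj.2 ⟨a, ha, hx⟩)

theorem mem_vars_of_snd {m : Store L User} {a : {G : Goal L User // G.IsBuiltin}} {x : ℕ}
    (ha : a ∈ m.2) (hx : x ∈ a.1.vars) : x ∈ m.vars := by
  rw [vars_eq, Finset.mem_union]
  exact Or.inr (mem_vars_conj.2 ⟨a, ha, hx⟩)

theorem subst_congr {σ τ : ℕ → L.Term ℕ} {m : Store L User} (h : ∀ x ∈ m.vars, σ x = τ x) :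
    m.subst σ = m.subst τ := by
  refine Prod.ext (Multiset.map_congr rfl fun a ha => ?_) (Multiset.map_congr rfl fun a ha => ?_)
  · exact Subtype.ext (Goal.subst_congr fun x hx => h x (mem_vars_of_fst ha hx))
  · exact Subtype.ext (Goal.subst_congr fun x hx => h x (mem_vars_of_snd ha hx))

theorem subst_var (m : Store L User) : m.subst Term.var = m := by
  simp [subst, Goal.subst_var]

theorem subst_eq_self {σ : ℕ → L.Term ℕ} {m : Store L User}
    (h : ∀ x ∈ m.vars, σ x = Term.var x) : m.subst σ = m := by
  rw [subst_congr h, subst_var]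

theorem goal_subst (σ : ℕ → L.Term ℕ) (m : Store L User) :
    GoalEquiv (m.subst σ).goal (m.goal.subst σ) :=
  .andCongr (conj_map_subst _ (fun _ => rfl) _) (conj_map_subst _ (fun _ => rfl) _)

theorem mem_vars_subst {σ : ℕ → L.Term ℕ} {m : Store L User} {y : ℕ} :
    y ∈ (m.subst σ).vars ↔ ∃ x ∈ m.vars, y ∈ (σ x).varFinset := by
  rw [vars, (goal_subst σ m).vars_eq, Goal.mem_vars_subst, vars]

end Store

namespace Goal

theorem atoms_subst (σ : ℕ → L.Term ℕ) : ∀ G : Goal L User,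
    (G.subst σ).atoms = G.atoms.subst σ
  | top => rfl
  | user c ts => (Store.subst_user σ (user c ts) trivial).symm
  | bot => (Store.subst_builtin σ bot trivial).symm
  | eq t s => (Store.subst_builtin σ (eq t s) trivial).symm
  | rel R ts => (Store.subst_builtin σ (rel R ts) trivial).symm
  | and G G' => by simp [subst, atoms, atoms_subst σ G, atoms_subst σ G', Store.subst_add]
  | or G G' => rfl

theorem dnf_subst (σ : ℕ → L.Term ℕ) : ∀ G : Goal L User,
    (G.subst σ).dnf = G.dnf.map (Store.subst σ)
  | top => rfl
  | user c ts => congrArg (fun n => [n]) (atoms_subst σ (user c ts))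
  | bot => congrArg (fun n => [n]) (atoms_subst σ bot)
  | eq t s => congrArg (fun n => [n]) (atoms_subst σ (eq t s))
  | rel R ts => congrArg (fun n => [n]) (atoms_subst σ (rel R ts))
  | and G G' => by
      simp [subst, dnf, dnf_subst σ G, dnf_subst σ G', List.flatMap_map, List.map_flatMap,
        Function.comp_def, Store.subst_add]
  | or G G' => by simp [subst, dnf, dnf_subst σ G, dnf_subst σ G']

theorem IsUser.goal_atoms : ∀ {G : Goal L User}, G.IsUser → GoalEquiv G.atoms.goal G
  | top, _ => Store.goal_zero
  | user _ _, _ => Store.goal_user _ _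
  | and _ _, h => (Store.goal_add _ _).trans (.andCongr (goal_atoms h.1) (goal_atoms h.2))

theorem IsBuiltin.goal_atoms : ∀ {G : Goal L User}, G.IsBuiltin → GoalEquiv G.atoms.goal G
  | top, _ => Store.goal_zero
  | bot, _ => Store.goal_builtin _ _
  | eq _ _, _ => Store.goal_builtin _ _
  | rel _ _, _ => Store.goal_builtin _ _
  | and _ _, h => (Store.goal_add _ _).trans (.andCongr (goal_atoms h.1) (goal_atoms h.2))

theorem vars_of_mem_dnf : ∀ {G : Goal L User} {n : Store L User}, n ∈ G.dnf → n.vars ⊆ G.vars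
  | top, n, h => by
      rw [dnf, List.mem_singleton] at h; subst h
      exact Store.goal_zero.vars_eq.subset
  | user _ _, n, h => by
      rw [dnf, List.mem_singleton] at h; subst h
      exact (Store.vars_user _ _).subset
  | bot, n, h => by
      rw [dnf, List.mem_singleton] at h; subst h
      exact (Store.vars_builtin _ _).subset
  | eq _ _, n, h => by
      rw [dnf, List.mem_singleton] at h; subst h
      exact (Store.vars_builtin _ _).subset
  | rel _ _, n, h => by
      rw [dnf, List.mem_singleton] at h; subst h
      exact (Store.vars_builtin _ _).subset
  | and G G', n, h => by
      obtain ⟨a, ha, b, hb, rfl⟩ := mem_dnf_and.1 h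
      rw [Store.vars_add]
      exact Finset.union_subset_union (vars_of_mem_dnf ha) (vars_of_mem_dnf hb)
  | or G G', n, h => by
      rcases List.mem_append.1 h with h | h
      · exact (vars_of_mem_dnf h).trans Finset.subset_union_left
      · exact (vars_of_mem_dnf h).trans Finset.subset_union_right

end Goal

/-! ### Equivalence of states -/

namespace StateEquiv

variable {CT : ConstraintTheory L User}

/-- The state with a given store. -/
noncomputable def _root_.CHRV.Store.state (m : Store L User) (V : Finset ℕ) : State L User :=
  ⟨m.goal, V⟩

/-- The quantifiers over strictly local variables need not match any chosen list of witnesses: a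
variable outside `U` and `V` is either bound on the right or absent from `B'`, so both `Y` and the
left quantifiers can be eliminated. -/
theorem le_strictLocals {U B B' : Goal L User} {V : Finset ℕ} (Y : Finset ℕ)
    (h : CT.Le B.toI (IForm.exSet Y B'.toI)) (hY : ∀ y ∈ Y, y ∉ U.vars ∧ y ∉ V) :
    CT.Le (IForm.exSet (strictLocals U B V) B.toI) (IForm.exSet (strictLocals U B' V) B'.toI) := by
  have key : ∀ z, z ∉ U.vars → z ∉ V → z ∉ (IForm.exSet (strictLocals U B' V) B'.toI).fv := by
    intro z hU hV hz
    have hz := IForm.fv_exSet hz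
    have := Goal.fv_toI B' hz.1
    exact hz.2 (by simp [strictLocals, hU, hV, this])
  refine .exSet_elim (h.trans (.exSet_elim (.exSet_self _ (.refl _)) fun y hy => ?_)) fun x hx => ?_
  · exact key y (hY y hy).1 (hY y hy).2
  · simp only [strictLocals, Finset.mem_sdiff] at hx
    exact key x hx.2 hx.1.2

theorem builtin {u : Multiset {G : Goal L User // G.IsUser}}
    {b b' : Multiset {G : Goal L User // G.IsBuiltin}} {V : Finset ℕ} (Y : Finset ℕ)
    (hY : ∀ y ∈ Y, y ∉ (conj u).vars ∧ y ∉ V)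
    (h : CT.Le (conj b).toI (IForm.exSet Y (conj b').toI)) (h' : CT.Le (conj b').toI (conj b).toI) :
    StateEquiv CT (Store.state (u, b) V) (Store.state (u, b') V) :=
  .applyCT V (conj_isUser u) (conj_isBuiltin b) (conj_isBuiltin b') (le_strictLocals Y h hY)
    (le_strictLocals ∅ (by simpa using h') (by simp))

/-- Only one direction needs an argument, since a larger store is stronger. The variables of `Y` are
new to the state and play the role of existential witnesses. -/
theorem add_builtin {m : Store L User} {b : Multiset {G : Goal L User // G.IsBuiltin}}
    {V : Finset ℕ} (Y : Finset ℕ) (hY : ∀ y ∈ Y, y ∉ m.vars ∧ y ∉ V)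
    (h : CT.Le (conj m.2).toI (IForm.exSet Y (conj (m.2 + b)).toI)) :
    StateEquiv CT (m.state V) ((m + (0, b)).state V) := by
  have e : m + (0, b) = (m.1, m.2 + b) := Prod.ext (by simp) rfl
  rw [e]
  refine builtin Y (fun y hy => ⟨fun h => (hY y hy).1 ?_, (hY y hy).2⟩) h
    (.conj_mono (Multiset.subset_of_le (Multiset.le_add_right _ _)))
  rw [Store.vars_eq]
  exact Finset.mem_union_left _ h

theorem goal_congr {G : Goal L User} {m : Store L User} (V : Finset ℕ) (h : GoalEquiv m.goal G) :
    StateEquiv CT (m.state V) ⟨G, V⟩ := .goal V h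

/-! ### Trading substitutions for equations. -/

theorem le_subst1 {φ : IForm L 0} {x : ℕ} {t : L.Term ℕ} {G : Goal L User}
    (h : CT.Le φ (Goal.eq (Term.var x) t : Goal L User).toI) :
    (CT.Le φ G.toI → CT.Le φ (G.subst1 x t).toI) ∧
      (CT.Le φ (G.subst1 x t).toI → CT.Le φ G.toI) := by
  have e : G.toI.subst ((Sub.ident 0).upd x (freeVar x)) = G.toI := by
    rw [Sub.upd_ident, IForm.subst_ident]
  constructor <;> intro h'
  · rw [← Goal.toI_subst1]
    refine .impI (IL.eq_subst_form h.IL ?_)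
    rw [emb_var, e]
    exact h'.IL
  · rw [← Goal.toI_subst1] at h'
    rw [← e]
    exact .impI (IL.eq_subst_form (IL.eq_symm h.IL) h'.IL)

/-- After the substitution `x` has disappeared, so `x ≐ t` may be added with witness `t` (`h₁`).
Then the substitution is undone, in the user-defined part by the equation law (`h₂`) and in the
built-in part by the theory (`h₃`). -/
theorem subst1 (n : Store L User) {x : ℕ} {t : L.Term ℕ} {V : Finset ℕ} (hx : x ∉ t.varFinset)
    (hV : x ∉ V) :
    StateEquiv CT ((n.subst (Function.update Term.var x t)).state V)
      ((n + Store.builtin (Goal.eq (Term.var x) t) trivial).state V) := by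
  set σ : ℕ → L.Term ℕ := Function.update Term.var x t with hσ
  set E : {G : Goal L User // G.IsBuiltin} := ⟨Goal.eq (Term.var x) t, trivial⟩ with hE
  have hxn : x ∉ (n.subst σ).vars := by
    rw [Store.mem_vars_subst]
    rintro ⟨y, _, hy⟩
    by_cases hyx : y = x
    · subst hyx; simp [hσ] at hy; exact hx hy
    · rw [hσ, Function.update_of_ne hyx] at hy; simp at hy; exact hyx hy.symm
  have h₁ : StateEquiv CT ((n.subst σ).state V) ((n.subst σ + (0, {E})).state V) := by
    refine add_builtin {x} (by simpa using ⟨hxn, hV⟩) ?_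
    refine .exSet_intro {x} ((Sub.ident 0).upd x (emb t)) ?_ fun y hy => ?_
    · rw [Goal.toI_subst1]
      refine .conj_subst_right fun a ha => ?_
      rcases Multiset.mem_add.1 ha with ha | ha
      · have : a.1.subst (Function.update Term.var x t) = a.1 :=
          Goal.subst_eq_self fun y hy => Function.update_of_ne
            (fun e : y = x => hxn (e ▸ Store.mem_vars_of_snd ha hy)) _ _
        rw [this]
        exact .conj_left ha
      · rw [Multiset.mem_singleton] at ha
        subst ha
        have : t.subst σ = t := by
          conv_rhs => rw [← term_subst_var t]
          exact term_subst_congr fun y hy => Function.update_of_ne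
            (fun e : y = x => hx (e ▸ hy)) _ _
        refine .impI ?_
        change IL _ (IForm.eq (emb ((Function.update Term.var x t : ℕ → L.Term ℕ) x))
          (emb (t.subst σ)))
        rw [this, Function.update_self]
        exact .eqRefl _
    · exact Sub.upd_of_ne _ _ (by simpa using hy)
  have h₂ : StateEquiv CT ((n.subst σ + (0, {E})).state V)
      (Store.state (n.1, (n.subst σ).2 + {E}) V) := by
    have e₁ : GoalEquiv (n.subst σ + (0, {E})).goal
        ((((conj n.1).subst1 x t).and E.1).and (conj (n.subst σ).2)) := by
      refine (GoalEquiv.andCongr (G₁' := (conj n.1).subst1 x t)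
        (G₂' := E.1.and (conj (n.subst σ).2)) ?_ ?_).trans (GoalEquiv.assoc _ _ _).symm
      · rw [Prod.fst_add, add_zero]
        exact conj_map_subst _ (fun _ => rfl) _
      · rw [Prod.snd_add, add_comm, Multiset.singleton_add]
        exact conj_cons _ _
    have e₂ : GoalEquiv (Store.goal (n.1, (n.subst σ).2 + {E}))
        (((conj n.1).and E.1).and (conj (n.subst σ).2)) := by
      refine (GoalEquiv.andCongr (.refl _) ?_).trans (GoalEquiv.assoc _ _ _).symm
      rw [add_comm, Multiset.singleton_add]
      exact conj_cons _ _
    exact (goal_congr V e₁).trans ((StateEquiv.eqSubst x t V (conj_isUser _)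
      (conj_isBuiltin _)).symm.trans (goal_congr V e₂).symm)
  have h₃ : StateEquiv CT (Store.state (n.1, (n.subst σ).2 + {E}) V)
      ((n + (0, {E})).state V) := by
    have e : n + (0, {E}) = (n.1, n.2 + {E}) := Prod.ext (by simp) rfl
    rw [e]
    refine builtin ∅ (by simp) ?_ ?_
    · rw [IForm.exSet_empty]
      refine .conj_right fun a ha => ?_
      rcases Multiset.mem_add.1 ha with ha | ha
      · refine (le_subst1 (x := x) (t := t) (.conj_left (a := E) (by simp))).2
          (.conj_left (a := ⟨a.1.subst1 x t, a.2.subst⟩) ?_)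
        exact Multiset.mem_add.2 (Or.inl (Multiset.mem_map.2 ⟨a, ha, rfl⟩))
      · exact .conj_left (Multiset.mem_add.2 (Or.inr ha))
    · refine .conj_right fun a ha => ?_
      rcases Multiset.mem_add.1 ha with ha | ha
      · obtain ⟨c, hc, rfl⟩ := Multiset.mem_map.1 ha
        exact (le_subst1 (x := x) (t := t) (.conj_left (a := E) (by simp))).1
          (.conj_left (Multiset.mem_add.2 (Or.inl hc)))
      · exact .conj_left (Multiset.mem_add.2 (Or.inr ha))
  exact h₁.trans (h₂.trans h₃)

/-- The equations `x ≐ σ x` for `x ∈ s`. -/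
def _root_.CHRV.eqs (σ : ℕ → L.Term ℕ) (s : Finset ℕ) :
    Multiset {G : Goal L User // G.IsBuiltin} :=
  s.val.map fun x => ⟨Goal.eq (Term.var x) (σ x), trivial⟩

theorem _root_.CHRV.mem_vars_eqs {σ : ℕ → L.Term ℕ} {s : Finset ℕ} {y : ℕ}
    (h : y ∈ Store.vars ((0, eqs σ s) : Store L User)) :
    ∃ x ∈ s, y = x ∨ y ∈ (σ x).varFinset := by
  rw [Store.vars_eq, conj_zero, Finset.mem_union] at h
  rcases h with h | h
  · simp [Goal.vars] at h
  · obtain ⟨a, ha, hy⟩ := mem_vars_conj.1 h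
    obtain ⟨x, hx, rfl⟩ := Multiset.mem_map.1 ha
    exact ⟨x, hx, by simpa [Goal.vars] using hy⟩

/-- The values of `σ` on `s` avoid `s`, so the equations are in solved form and the variables can be
treated one after the other by `subst1`. -/
theorem subst (σ : ℕ → L.Term ℕ) {V : Finset ℕ} {s : Finset ℕ} (n : Store L User)
    (hσ : ∀ x ∉ s, σ x = Term.var x) (hs : ∀ x ∈ s, ∀ y ∈ s, y ∉ (σ x).varFinset)
    (hV : ∀ x ∈ s, x ∉ V) :
    StateEquiv CT ((n.subst σ).state V) ((n + (0, eqs σ s)).state V) := by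
  induction s using Finset.induction_on generalizing n σ with
  | empty =>
    rw [Store.subst_eq_self fun x _ => hσ x (by simp)]
    have : n + (0, eqs σ ∅) = n := by
      simp only [eqs, Finset.empty_val, Multiset.map_zero, Prod.mk_zero_zero, add_zero]
    rw [this]
    exact .refl _
  | insert x s hx ih =>
    set σ' : ℕ → L.Term ℕ := Function.update σ x (Term.var x) with hσ'
    have ne : ∀ y ∈ s, y ≠ x := fun y hy e => hx (e ▸ hy)
    have hxσ : x ∉ (σ x).varFinset := hs x (by simp) x (by simp)
    -- Simultaneous substitution factors through substituting for `x` first, because `σ'` does not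
    -- act on the variables of `σ x`.
    have e₁ : n.subst σ = (n.subst (Function.update Term.var x (σ x))).subst σ' := by
      rw [Store.subst_subst]
      refine Store.subst_congr fun y _ => ?_
      by_cases hyx : y = x
      · subst hyx
        rw [Function.update_self]
        conv_lhs => rw [← term_subst_var (σ y)]
        refine term_subst_congr fun z hz => ?_
        by_cases hzy : z = y
        · subst hzy; simp [hσ']
        · rw [hσ', Function.update_of_ne hzy, hσ]
          intro hz'
          exact hs y (by simp) z hz' hz
      · rw [Function.update_of_ne hyx, Term.subst, hσ', Function.update_of_ne hyx]
    have e₂ : (eqs σ' s : Multiset {G : Goal L User // G.IsBuiltin}) = eqs σ s :=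
      Multiset.map_congr rfl fun y hy => by
        have : σ' y = σ y := Function.update_of_ne (ne y hy) _ _
        rw [this]
    have h₁ := ih σ' (n.subst (Function.update Term.var x (σ x))) (fun y hy => by
        by_cases hyx : y = x
        · subst hyx; simp [hσ']
        · rw [hσ', Function.update_of_ne hyx]
          exact hσ y (by simp [hyx, hy]))
      (fun y hy z hz => by
        rw [hσ', Function.update_of_ne (ne y hy)]
        exact hs y (by simp [hy]) z (by simp [hz]))
      (fun y hy => hV y (by simp [hy]))
    have e₃ : Store.subst (Function.update Term.var x (σ x)) ((0, eqs σ s) : Store L User) =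
        (0, eqs σ s) := by
      refine Store.subst_eq_self fun z hz => ?_
      obtain ⟨y, hy, hz⟩ := mem_vars_eqs hz
      refine Function.update_of_ne ?_ _ _
      rintro rfl
      rcases hz with rfl | hz
      · exact hx hy
      · exact hs y (by simp [hy]) z (by simp) hz
    have h₂ := StateEquiv.subst1 (CT := CT) (n + (0, eqs σ s)) hxσ (hV x (by simp))
    rw [Store.subst_add, e₃] at h₂
    rw [e₂] at h₁
    rw [e₁]
    refine h₁.trans ?_
    convert h₂ using 2
    rw [add_assoc]
    congr 1
    refine Prod.ext (by simp [Store.builtin]) ?_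
    simp [eqs, Store.builtin, Finset.insert_val_of_notMem hx, add_comm]

/-! ### Changing global variables and renaming local ones. -/

theorem globals_union (G : Goal L User) (V D : Finset ℕ) (h : ∀ x ∈ D, x ∉ G.vars) :
    StateEquiv CT ⟨G, D ∪ V⟩ ⟨G, V⟩ := by
  induction D using Finset.induction_on with
  | empty => rw [Finset.empty_union]; exact .refl _
  | insert x D _ ih =>
    rw [Finset.insert_union]
    exact (StateEquiv.redundantGlobal _ (h x (by simp))).trans
      (ih fun y hy => h y (by simp [hy]))

theorem globals {G : Goal L User} {V V' : Finset ℕ} (h : ∀ x ∈ G.vars, x ∈ V ↔ x ∈ V') :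
    StateEquiv CT ⟨G, V⟩ ⟨G, V'⟩ := by
  have key : ∀ W : Finset ℕ, StateEquiv CT ⟨G, W⟩ ⟨G, W ∩ G.vars⟩ := by
    intro W
    have := globals_union (CT := CT) G (W ∩ G.vars) (W \ G.vars)
      fun x hx => (Finset.mem_sdiff.1 hx).2
    rwa [Finset.sdiff_union_inter] at this
  have e : V ∩ G.vars = V' ∩ G.vars := by
    ext x
    simp only [Finset.mem_inter]
    constructor <;> rintro ⟨h₁, h₂⟩
    exacts [⟨(h x h₂).1 h₁, h₂⟩, ⟨(h x h₂).2 h₁, h₂⟩]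
  exact (key V).trans (e ▸ (key V').symm)

theorem _root_.CHRV.exists_inverse_renaming {ρ : ℕ → ℕ} {s : Finset ℕ} (hρ : Set.InjOn ρ s)
    (f : ℕ → L.Term ℕ) : ∃ σ : ℕ → L.Term ℕ, (∀ x ∈ s, σ (ρ x) = f x) ∧
      ∀ z ∉ s.image ρ, σ z = Term.var z := by
  classical
  refine ⟨fun z => if z ∈ s.image ρ then f (Function.invFunOn ρ s z) else Term.var z,
    fun x hx => ?_, fun z hz => by simp only [if_neg hz]⟩
  have hx' : ρ x ∈ s.image ρ := Finset.mem_image_of_mem ρ hx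
  simp only [if_pos hx']
  rw [hρ.leftInvOn_invFunOn (Finset.mem_coe.2 hx)]

theorem _root_.CHRV.exists_fresh_renaming (A : Finset ℕ) :
    ∃ ρ : ℕ → ℕ, Function.Injective ρ ∧ ∀ x, ρ x ∉ A := by
  -- A shift past the maximum of `A`; the `+ 1` makes the inequality strict even at `x = 0`.
  refine ⟨fun x => x + (A.sup id + 1), fun x y h => by simpa using h, fun x hx => ?_⟩
  have := Finset.le_sup (f := id) hx
  simp only [id] at this
  omega

/-- The renamed store is the original one together with the equations `x ≐ ρ x`. The names `ρ x`
occur nowhere else, so these equations are redundant, with `x` as witness for `ρ x`. -/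
theorem freshen {n : Store L User} {s V : Finset ℕ} {ρ : ℕ → ℕ} (hρ : Set.InjOn ρ s)
    (hn : ∀ x ∈ s, ρ x ∉ n.vars) (hs : ∀ x ∈ s, ρ x ∉ s) (hV : ∀ x ∈ s, x ∉ V)
    (hρV : ∀ x ∈ s, ρ x ∉ V) :
    StateEquiv CT ((n.subst (freshen Term.var s ρ)).state V) (n.state V) := by
  refine (StateEquiv.subst (s := s) _ n (fun x hx => by simp [CHRV.freshen, hx])
    (fun x hx y hy => ?_) hV).trans (.symm (add_builtin (s.image ρ) ?_ ?_))
  · simp only [CHRV.freshen, hx, if_true, Term.varFinset, Finset.mem_singleton]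
    exact fun e => hs x hx (e ▸ hy)
  · intro y hy
    obtain ⟨x, hx, rfl⟩ := Finset.mem_image.1 hy
    exact ⟨hn x hx, hρV x hx⟩
  · obtain ⟨τ, hτ, hτ'⟩ := exists_inverse_renaming (L := L) hρ Term.var
    refine .exSet_intro _ (Sub.ofTerms τ) ?_ fun z hz => by
      rw [Sub.ofTerms_inl, hτ' z hz, emb_var]
    rw [Goal.toI_subst (σ := τ) fun _ _ => rfl]
    refine .conj_subst_right fun a ha => ?_
    rcases Multiset.mem_add.1 ha with ha | ha
    · rw [Goal.subst_eq_self]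
      · exact .conj_left ha
      · intro z hz
        refine hτ' z fun hz' => ?_
        obtain ⟨x, hx, rfl⟩ := Finset.mem_image.1 hz'
        exact hn x hx (Store.mem_vars_of_snd ha hz)
    · obtain ⟨x, hx, rfl⟩ := Multiset.mem_map.1 ha
      have hx : x ∈ s := hx
      have hx' : x ∉ s.image ρ := by
        intro h
        obtain ⟨y, hy, e⟩ := Finset.mem_image.1 h
        exact hs y hy (e ▸ hx)
      refine .impI ?_
      change IL _ (IForm.eq (emb (τ x)) (emb ((CHRV.freshen Term.var s ρ x).subst τ)))
      simp only [CHRV.freshen, hx, if_true, Term.subst, hτ x hx, hτ' x hx']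
      exact .eqRefl _

end StateEquiv

/-! ### Equivalence of configurations -/

section Config

variable {CT : ConstraintTheory L User} {P : Program L User}

namespace ConfigEquiv

theorem append_left (T : Config L User) {S S' : Config L User} (h : ConfigEquiv CT S S') :
    ConfigEquiv CT (T ++ S) (T ++ S') :=
  (ConfigEquiv.comm _ _).trans ((h.congr T).trans (.comm _ _))

theorem of_perm {C D : Config L User} (h : C.Perm D) : ConfigEquiv CT C D := by
  induction h with
  | nil => exact .refl _
  | cons x _ ih => exact append_left [x] ih
  | swap x y l => exact (ConfigEquiv.comm [y] [x]).congr l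
  | trans _ _ ih₁ ih₂ => exact ih₁.trans ih₂

theorem map_congr {ι : Type*} {f g : ι → State L User} (C : Config L User) {l : List ι}
    (h : ∀ n ∈ l, StateEquiv CT (f n) (g n)) : ConfigEquiv CT (l.map f ++ C) (l.map g ++ C) := by
  induction l with
  | nil => exact .refl _
  | cons a l ih =>
    exact (ConfigEquiv.state _ (h a (by simp))).trans
      (append_left [g a] (ih fun n hn => h n (by simp [hn])))

theorem flatMap_congr {ι : Type*} {f : ι → State L User} {g : ι → Config L User}
    (C : Config L User) {l : List ι}
    (h : ∀ n ∈ l, ∀ D, ConfigEquiv CT (f n :: D) (g n ++ D)) :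
    ConfigEquiv CT (l.map f ++ C) (l.flatMap g ++ C) := by
  induction l with
  | nil => exact .refl _
  | cons a l ih =>
    rw [List.flatMap_cons, List.append_assoc]
    exact (h a (by simp) _).trans (append_left _ (ih fun n hn => h n (by simp [hn])))

/-- The accompanying goal `K` makes the induction pass conjunctions: while one factor is split, the
other waits inside `K`. -/
theorem dnf_and : ∀ (G K : Goal L User) (V : Finset ℕ) (C : Config L User),
    ConfigEquiv CT (⟨G.and K, V⟩ :: C)
      (G.dnf.map (fun n => (⟨n.goal.and K, V⟩ : State L User)) ++ C)
  | .top, K, V, C => .state C (.goal V (.andCongr Store.goal_zero.symm (.refl _)))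
  | .user c ts, K, V, C =>
      .state C (.goal V (.andCongr (Store.goal_user (.user c ts) trivial).symm (.refl _)))
  | .bot, K, V, C =>
      .state C (.goal V (.andCongr (Store.goal_builtin .bot trivial).symm (.refl _)))
  | .eq t s, K, V, C =>
      .state C (.goal V (.andCongr (Store.goal_builtin (.eq t s) trivial).symm (.refl _)))
  | .rel R ts, K, V, C =>
      .state C (.goal V (.andCongr (Store.goal_builtin (.rel R ts) trivial).symm (.refl _)))
  | .or G G', K, V, C => by
      have h : GoalEquiv ((G.or G').and K) ((G.and K).or (G'.and K)) :=
        (GoalEquiv.comm _ _).trans ((GoalEquiv.distrib _ _ _).trans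
          (.orCongr (.comm _ _) (.comm _ _)))
      refine (ConfigEquiv.state C (.goal V h)).trans ((ConfigEquiv.split _ _ V C).trans ?_)
      rw [Goal.dnf, List.map_append, List.append_assoc]
      exact (dnf_and G K V _).trans (append_left _ (dnf_and G' K V C))
  | .and G G', K, V, C => by
      refine (ConfigEquiv.state C (.goal V (.assoc _ _ _))).trans ((dnf_and G _ V C).trans ?_)
      rw [Goal.dnf, List.map_flatMap]
      refine flatMap_congr C fun n _ D => ?_
      refine (ConfigEquiv.state D (.goal V (.and_left_comm _ _ _))).trans
        ((dnf_and G' _ V D).trans ?_)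
      rw [List.map_map]
      refine map_congr D fun n' _ => .goal V ?_
      exact (GoalEquiv.and_left_comm _ _ _).trans ((GoalEquiv.assoc _ _ _).symm.trans
        (.andCongr (Store.goal_add _ _).symm (.refl _)))

theorem dnf_add (G : Goal L User) (k : Store L User) (V : Finset ℕ) (C : Config L User) :
    ConfigEquiv CT (⟨G.and k.goal, V⟩ :: C)
      (G.dnf.map (fun n => (n + k).state V) ++ C) :=
  (dnf_and G k.goal V C).trans (map_congr C fun n _ => .goal V (Store.goal_add n k).symm)

theorem dnf (G : Goal L User) (V : Finset ℕ) (C : Config L User) :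
    ConfigEquiv CT (⟨G, V⟩ :: C) (G.dnf.map (fun n => n.state V) ++ C) :=
  (ConfigEquiv.state C (.goal V (GoalEquiv.andTop G).symm)).trans
    ((dnf_and G _ V C).trans (map_congr C fun _ _ => .goal V (GoalEquiv.andTop _)))

/-- The disjunctive normal form of a configuration. -/
noncomputable def _root_.CHRV.Config.normalize (C : Config L User) : Config L User :=
  C.flatMap fun S => S.goal.dnf.map fun n => n.state S.globals

theorem normalize (C : Config L User) : ConfigEquiv CT C C.normalize := by
  have := flatMap_congr (CT := CT) (f := id)
    (g := fun S => S.goal.dnf.map fun n => n.state S.globals) [] (l := C)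
    fun S _ D => dnf S.goal S.globals D
  simpa [Config.normalize] using this

theorem cls_eq {C D : Config L User} (h : ConfigEquiv CT C D) : C.cls CT = D.cls CT :=
  Quotient.sound h

end ConfigEquiv

/-! ### Reachability -/

theorem Config.exists_cls (a : ConfigClass CT) : ∃ C : Config L User, C.cls CT = a :=
  Quotient.exists_rep a

theorem Config.cls_append {C C' : Config L User} (h : C.cls CT = C'.cls CT) (E : Config L User) :
    Config.cls CT (C ++ E) = Config.cls CT (C' ++ E) :=
  Quotient.sound ((Quotient.exact h : ConfigEquiv CT C C').congr E)

theorem Step.append {a b : ConfigClass CT} (h : Step CT P a b) (E : Config L User) :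
    ∀ C D : Config L User, C.cls CT = a → D.cls CT = b →
      Step CT P (Config.cls CT (C ++ E)) (Config.cls CT (D ++ E)) := by
  cases h with
  | apply r₀ r K V T hr₀ hr hd hsat =>
    intro C D hC hD
    rw [Config.cls_append hC, Config.cls_append hD]
    exact .apply r₀ r K V (T ++ E) hr₀ hr hd hsat

theorem steps_append {a b : ConfigClass CT} (h : Relation.ReflTransGen (Step CT P) a b)
    (E : Config L User) : ∀ C D : Config L User, C.cls CT = a → D.cls CT = b →
      Relation.ReflTransGen (Step CT P) (Config.cls CT (C ++ E)) (Config.cls CT (D ++ E)) := by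
  induction h with
  | refl =>
    intro C D hC hD
    rw [Config.cls_append (hC.trans hD.symm)]
  | @tail b c _ h ih =>
    intro C D hC hD
    obtain ⟨D', hD'⟩ := Config.exists_cls b
    exact (ih C D' hC hD').tail (h.append E D' D hD' hD)

theorem ConfigEntailStep.append {a b : ConfigClass CT} (h : ConfigEntailStep CT a b)
    (E : Config L User) : ∀ C D : Config L User, C.cls CT = a → D.cls CT = b →
      ConfigEntailStep CT (Config.cls CT (C ++ E)) (Config.cls CT (D ++ E)) := by
  cases h with
  | weaken S T =>
    intro C D hC hD
    rw [Config.cls_append hC, Config.cls_append hD]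
    exact .weaken S (T ++ E)
  | stronger T h =>
    intro C D hC hD
    rw [Config.cls_append hC, Config.cls_append hD]
    exact .stronger (T ++ E) h

theorem ConfigEntails.append {a b : ConfigClass CT} (h : ConfigEntails CT a b)
    (E : Config L User) : ∀ C D : Config L User, C.cls CT = a → D.cls CT = b →
      ConfigEntails CT (Config.cls CT (C ++ E)) (Config.cls CT (D ++ E)) := by
  induction h with
  | refl =>
    intro C D hC hD
    rw [Config.cls_append (hC.trans hD.symm)]
    exact .refl
  | @tail b c _ h ih =>
    intro C D hC hD
    obtain ⟨D', hD'⟩ := Config.exists_cls b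
    exact (ih C D' hC hD').tail (h.append E D' D hD' hD)

theorem ConfigEntails.weaken (C : Config L User) :
    ∀ A : Config L User, ConfigEntails CT (C.cls CT) (Config.cls CT (A ++ C))
  | [] => .refl
  | S :: A => (ConfigEntails.weaken C A).tail (.weaken S (A ++ C))

/-- Permute `S'` next to `S`, where the generating law removes the stronger state. -/
theorem ConfigEntails.absorb {S S' : State L User} {T : Config L User} (hS' : S' ∈ T)
    (h : StateEntails CT (S.cls CT) (S'.cls CT)) :
    ConfigEntails CT (Config.cls CT (S :: T)) (T.cls CT) := by
  obtain ⟨l, l', rfl⟩ := List.append_of_mem hS'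
  have hp : ConfigEquiv CT (l ++ S' :: l') (S' :: (l ++ l')) := .of_perm List.perm_middle
  have hp' : ConfigEquiv CT (S :: (l ++ S' :: l')) (S :: S' :: (l ++ l')) := hp.append_left [S]
  rw [hp.cls_eq, hp'.cls_eq]
  exact .single (.stronger (l ++ l') h)

theorem ConfigEntails.absorb_append {T : Config L User} :
    ∀ {A : Config L User}, A ⊆ T → ConfigEntails CT (Config.cls CT (A ++ T)) (T.cls CT)
  | [], _ => .refl
  | S :: A, h => by
      rw [List.cons_subset] at h
      exact (ConfigEntails.absorb (List.mem_append_right A h.1) .refl).trans (absorb_append h.2)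

/-- Some configuration that entails `T` is reachable from `C`. -/
def Reach (CT : ConstraintTheory L User) (P : Program L User) (C T : Config L User) : Prop :=
  ∃ U : Config L User, Relation.ReflTransGen (Step CT P) (C.cls CT) (U.cls CT) ∧
    ConfigEntails CT (U.cls CT) (T.cls CT)

namespace Reach

variable {C D T : Config L User}

theorem of_equiv (h : ConfigEquiv CT C D) (h' : Reach CT P D T) : Reach CT P C T := by
  unfold Reach at *
  rwa [h.cls_eq]

theorem to_equiv (h : Reach CT P C D) (h' : ConfigEquiv CT D T) : Reach CT P C T := by
  unfold Reach at *
  rwa [← h'.cls_eq]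

theorem of_state {S S' : State L User} (h : StateEquiv CT S S') (h' : Reach CT P [S'] T) :
    Reach CT P [S] T := h'.of_equiv (.state [] h)

theorem of_step (h : Step CT P (C.cls CT) (D.cls CT)) (h' : Reach CT P D T) : Reach CT P C T := by
  obtain ⟨U, h₁, h₂⟩ := h'
  exact ⟨U, .head h h₁, h₂⟩

theorem nil (T : Config L User) : Reach CT P [] T := by
  refine ⟨[], .refl, ?_⟩
  have := ConfigEntails.weaken (CT := CT) [] T
  rwa [List.append_nil] at this

/-- A failed state is neutral for `∨`, and the empty configuration entails every configuration. -/
theorem of_failed {S : State L User} (h : StateEquiv CT S failedState) : Reach CT P [S] T :=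
  (nil T).of_equiv ((ConfigEquiv.state [] h).trans (.failed []))

theorem of_entails {S S' : State L User} (hS' : S' ∈ T)
    (h : StateEntails CT (S.cls CT) (S'.cls CT)) : Reach CT P [S] T := by
  refine ⟨[S], .refl, (ConfigEntails.weaken [S] T).trans ?_⟩
  rw [(ConfigEquiv.comm T [S]).cls_eq]
  exact ConfigEntails.absorb hS' h

/-- Both parts run independently inside the disjunction; the two resulting copies of `T` collapse
because every state entails itself. -/
theorem append (h : Reach CT P C T) (h' : Reach CT P D T) : Reach CT P (C ++ D) T := by
  obtain ⟨U, h₁, h₂⟩ := h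
  obtain ⟨U', h₁', h₂'⟩ := h'
  refine ⟨U' ++ U, (steps_append h₁ D C U rfl rfl).trans ?_, ?_⟩
  · rw [(ConfigEquiv.comm U D).cls_eq]
    exact steps_append h₁' U D U' rfl rfl
  · refine (h₂'.append U U' T rfl rfl).trans ?_
    rw [(ConfigEquiv.comm T U).cls_eq]
    exact (h₂.append T U T rfl rfl).trans (ConfigEntails.absorb_append (List.Subset.refl T))

theorem of_forall : ∀ {C : Config L User}, (∀ S ∈ C, Reach CT P [S] T) → Reach CT P C T
  | [], _ => nil T
  | S :: C, h => append (C := [S]) (h S (by simp)) (of_forall fun S' hS' => h S' (by simp [hS']))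

end Reach

end Config

/-! ### Runs from covered stores -/

section Runs

variable {CT : ConstraintTheory L User} {P : Program L User}

/-- Currying: the quantifier is eliminated into the implication `φ → ∃Y. (φ ∧ ψ)`, so that `φ`
remains available under it. -/
theorem ConstraintTheory.Le.exSet_and {φ ψ : IForm L 0} {Y : Finset ℕ}
    (h : CT.Le φ (IForm.exSet Y ψ)) (hY : ∀ y ∈ Y, y ∉ φ.fv) :
    CT.Le φ (IForm.exSet Y (φ.and ψ)) := by
  have h₁ : CT.Le ψ (φ.imp (IForm.exSet Y (φ.and ψ))) :=
    .impI (.impI (.impE (Entails.weaken₂ (Le.exSet_self Y (.refl (φ.and ψ))) ψ φ)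
      (.andI (.hyp (Or.inl rfl)) (.hyp (Or.inr (Or.inl rfl))))))
  have h₂ : CT.Le (IForm.exSet Y ψ) (φ.imp (IForm.exSet Y (φ.and ψ))) := by
    refine .exSet_elim h₁ fun y hy hmem => ?_
    rcases Finset.mem_union.1 hmem with hmem | hmem
    · exact hY y hy hmem
    · exact (IForm.fv_exSet hmem).2 hy
  exact .impI (.impE (h₂.mp h.IL) (.hyp (Or.inl rfl)))

/-- The fresh names serve as eigenvariables for `∃s. B`. They are not global and do not occur in the
old store, so the new constraint is existentially quantified in the state. -/
theorem StateEquiv.add_ct {m : Store L User} {b : Multiset {G : Goal L User // G.IsBuiltin}}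
    {B : Goal L User} (hB : B.IsBuiltin) {s : Finset ℕ} {σ : ℕ → L.Term ℕ} {ρ : ℕ → ℕ}
    {V : Finset ℕ} (h : CT.Le (conj b).toI ((IForm.exSet s B.toI).subst (Sub.ofTerms σ)))
    (hρ : Function.Injective ρ) (hV : ∀ x, ρ x ∉ V) (hm : ∀ x, ρ x ∉ (m + (0, b)).vars)
    (hσ : ∀ x, ∀ z ∈ B.vars, ρ x ∉ (σ z).varFinset) :
    StateEquiv CT ((m + (0, b)).state V)
      ((m + (0, b) + Store.builtin (B.subst (CHRV.freshen σ s ρ)) hB.subst).state V) := by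
  set τ := CHRV.freshen σ s ρ with hτ
  refine add_builtin (s.image ρ) (fun y hy => ?_) ?_
  · obtain ⟨x, _, rfl⟩ := Finset.mem_image.1 hy
    exact ⟨hm x, hV x⟩
  have h₁ : CT.Le ((IForm.exSet s B.toI).subst (Sub.ofTerms σ))
      (IForm.exSet (s.image ρ) (B.subst τ).toI) := by
    refine .exVars_elim (τ := Sub.ofTerms τ) (ρ := ρ) ?_ _ _ (Finset.sort_nodup _ _)
      (fun x hx => ?_) (fun x hx => ?_) (fun x _ y _ e => hρ e) (fun x hx hmem => ?_)
      (fun x _ z hz _ => ?_)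
    · rw [Goal.toI_subst (σ := τ) fun _ _ => rfl]
      exact .exSet_self _ (.refl _)
    · have : x ∉ s := by simpa using hx
      simp [hτ, CHRV.freshen, this]
    · have : x ∈ s := by simpa using hx
      simp [hτ, CHRV.freshen, this, emb_var]
    · have : x ∈ s := by simpa using hx
      exact (IForm.fv_exSet hmem).2 (Finset.mem_image_of_mem _ this)
    · rw [Sub.ofTerms_inl, varFinsetLeft_emb]
      exact hσ x z (Goal.fv_toI B hz)
  have h₂ : CT.Le (conj (m + (0, b)).2).toI (conj b).toI :=
    .conj_mono (Multiset.subset_of_le (Multiset.le_add_left _ _))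
  have h₃ := ConstraintTheory.Le.exSet_and (h₂.trans (h.trans h₁)) fun y hy hmem => by
    obtain ⟨x, _, rfl⟩ := Finset.mem_image.1 hy
    refine hm x ?_
    rw [Store.vars_eq]
    exact Finset.mem_union_right _ (Goal.fv_toI _ hmem)
  refine h₃.trans (.exSet_elim (.exSet_self _ (.conj_right fun a ha => ?_))
    fun y hy hmem => (IForm.fv_exSet hmem).2 hy)
  rcases Multiset.mem_add.1 ha with ha | ha
  · exact (ConstraintTheory.Le.and_left _ _).trans (.conj_left ha)
  · rw [Multiset.mem_singleton] at ha
    subst ha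
    exact .and_right _ _

theorem StateEquiv.failed_of_bot (m : Store L User) (V : Finset ℕ) :
    StateEquiv CT ((m + Store.builtin Goal.bot trivial).state V) failedState :=
  (goal_congr V ((Store.goal_add _ _).trans (.andCongr (.refl _) (Store.goal_builtin _ _)))).trans
    (.failed _ _ _ _)

theorem StateEquiv.failed_of_le {m : Store L User} (V : Finset ℕ)
    (h : CT.Le (conj m.2).toI IForm.falsum) : StateEquiv CT (m.state V) failedState :=
  (add_builtin (b := {⟨Goal.bot, trivial⟩}) ∅ (by simp) (by
    rw [IForm.exSet_empty]
    exact h.trans (.falsum _))).trans (failed_of_bot m V)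

/-- The equation law substitutes for variables only. Hence the `j`-th argument is abstracted to a
fresh `z` with `z ≐ ts j`, the theory turns this into `z ≐ s` by means of `ts j ≐ s`, and `z` is
eliminated again. -/
theorem StateEquiv.swap_eq {k : Store L User} {i : ℕ} (c : User i) (ts : Fin i → L.Term ℕ)
    (j : Fin i) (s : L.Term ℕ) (V : Finset ℕ) :
    StateEquiv CT
      ((k + Store.user (Goal.user c ts) trivial +
        Store.builtin (Goal.eq (ts j) s) trivial).state V)
      ((k + Store.user (Goal.user c (Function.update ts j s)) trivial +
        Store.builtin (Goal.eq (ts j) s) trivial).state V) := by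
  obtain ⟨z, hz⟩ := exists_fresh (V ∪ (k + Store.user (Goal.user c ts) trivial +
        Store.builtin (Goal.eq (ts j) s) trivial).vars)
  rw [Store.vars_add, Store.vars_add, Store.vars_user (Goal.user c ts) trivial,
    Store.vars_builtin (Goal.eq (ts j) s) trivial] at hz
  simp only [Finset.mem_union, not_or, Goal.vars, Finset.mem_biUnion, Finset.mem_univ, true_and,
    not_exists] at hz
  obtain ⟨hzV, ⟨hzk, hzts⟩, hzj, hzs⟩ := hz
  set E := Store.builtin (Goal.eq (ts j) s : Goal L User) trivial with hE
  set m := k + Store.user (Goal.user c (Function.update ts j (Term.var z))) trivial + E with hm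
  have key : ∀ t : L.Term ℕ, m.subst (Function.update Term.var z t) =
      k + Store.user (Goal.user c (Function.update ts j t)) trivial + E := by
    intro t
    have ht : ∀ r : L.Term ℕ, z ∉ r.varFinset → r.subst (Function.update Term.var z t) = r := by
      intro r hr
      conv_rhs => rw [← term_subst_var r]
      exact term_subst_congr fun y hy => Function.update_of_ne (fun e : y = z => hr (e ▸ hy)) _ _
    have h₁ : k.subst (Function.update Term.var z t) = k := Store.subst_eq_self fun y hy =>
      Function.update_of_ne (fun e : y = z => hzk (e ▸ hy)) _ _
    have h₂ : E.subst (Function.update Term.var z t) = E := by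
      rw [hE]
      refine (Store.subst_builtin _ (Goal.eq (ts j) s) trivial).trans ?_
      congr 1
      simp only [Goal.subst, ht _ hzj, ht _ hzs]
    have h₃ : (fun l => (Function.update ts j (Term.var z) l).subst
        (Function.update Term.var z t)) = Function.update ts j t := by
      funext l
      by_cases hl : l = j
      · subst hl; simp
      · simp only [Function.update_of_ne hl, ht _ (hzts l)]
    rw [hm, Store.subst_add, Store.subst_add, h₁, h₂]
    congr 2
    refine (Store.subst_user _ (Goal.user c (Function.update ts j (Term.var z))) trivial).trans ?_
    congr 1
    simp only [Goal.subst, h₃]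
  have e₁ := StateEquiv.subst1 (CT := CT) m hzj hzV
  have e₂ := StateEquiv.subst1 (CT := CT) m hzs hzV
  rw [key] at e₁ e₂
  rw [Function.update_eq_self] at e₁
  refine e₁.trans (StateEquiv.trans ?_ e₂.symm)
  have split : ∀ t : L.Term ℕ, m + Store.builtin (Goal.eq (Term.var z) t) trivial =
      (m.1, m.2 + {⟨Goal.eq (Term.var z) t, trivial⟩}) := fun t =>
    Prod.ext (by simp [Store.builtin]) rfl
  have hmE : (⟨Goal.eq (ts j) s, trivial⟩ : {G : Goal L User // G.IsBuiltin}) ∈ m.2 :=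
    Multiset.mem_add.2 (Or.inr (Multiset.mem_singleton_self _))
  have le : ∀ t t' : L.Term ℕ, CT.Le (conj m.2).toI (Goal.eq t t' : Goal L User).toI →
      CT.Le (conj (m.2 + {⟨Goal.eq (Term.var z) t, trivial⟩})).toI
        (conj (m.2 + {⟨Goal.eq (Term.var z) t', trivial⟩})).toI := by
    intro t t' h
    refine .conj_right fun a ha => ?_
    rcases Multiset.mem_add.1 ha with ha | ha
    · exact .conj_left (Multiset.mem_add.2 (Or.inl ha))
    · rw [Multiset.mem_singleton] at ha
      subst ha
      refine .impI (IL.eq_trans (s := emb t) ?_ ?_)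
      · exact (ConstraintTheory.Le.conj_left (CT := CT) (a := ⟨Goal.eq (Term.var z) t, trivial⟩)
          (Multiset.mem_add.2 (Or.inr (Multiset.mem_singleton_self _)))).IL
      · exact ((ConstraintTheory.Le.conj_mono
          (Multiset.subset_of_le (Multiset.le_add_right _ _))).trans h).IL
  rw [split, split]
  refine builtin ∅ (by simp) ?_ ?_
  · rw [IForm.exSet_empty]
    exact le _ _ (.conj_left hmE)
  · exact le _ _ ((ConstraintTheory.Le.conj_left hmE).trans (Goal.le_eq_symm CT _ _))

theorem Rule.mem_vars_iff {r : Rule L User} {x : ℕ} :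
    x ∈ r.vars ↔ (x ∈ r.kept.vars ∪ r.removed.vars) ∨ x ∈ r.locals := by
  simp only [Rule.vars, Rule.locals, Finset.mem_union, Finset.mem_sdiff]
  tauto

theorem Rule.vars_rename (ρ : ℕ → ℕ) (r : Rule L User) : (r.rename ρ).vars = r.vars.image ρ := by
  ext y
  simp only [Rule.vars, Rule.rename, Finset.mem_union, Goal.mem_vars_rename, Finset.mem_image]
  constructor
  · rintro (((⟨x, h, rfl⟩ | ⟨x, h, rfl⟩) | ⟨x, h, rfl⟩) | ⟨x, h, rfl⟩)
    all_goals exact ⟨x, by tauto, rfl⟩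
  · rintro ⟨x, h, rfl⟩
    rcases h with ((h | h) | h) | h
    exacts [Or.inl (Or.inl (Or.inl ⟨x, h, rfl⟩)), Or.inl (Or.inl (Or.inr ⟨x, h, rfl⟩)),
      Or.inl (Or.inr ⟨x, h, rfl⟩), Or.inr ⟨x, h, rfl⟩]

theorem Rule.IsVariant.rename {r r₀ : Rule L User} (h : r.IsVariant r₀) {ρ : ℕ → ℕ}
    (hρ : Function.Injective ρ) : (r.rename ρ).IsVariant r₀ := by
  obtain ⟨ρ₀, h₀, rfl⟩ := h
  refine ⟨ρ ∘ ρ₀, fun x hx y hy e => h₀ hx hy (hρ e), ?_⟩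
  have key : ∀ G : Goal L User, (G.rename ρ₀).rename ρ = G.rename (ρ ∘ ρ₀) := fun G =>
    Goal.subst_subst _ _ G
  simp [Rule.rename, key]

/-- Completeness concerns built-in constraints, whereas the applicability condition reads the
built-in content of a goal containing user-defined atoms. The constraint `B` mediates between the
two formulas. -/
theorem ConstraintTheory.Complete.cases (hCT : CT.Complete) {B : Goal L User} (hB : B.IsBuiltin)
    {φ ψ : IForm L 0} (h : CT.Le B.toI φ) (h' : CT.Le ψ B.toI) :
    CT.Entails φ.exClosure ∨ CT.Le ψ IForm.falsum := by
  rcases hCT B hB with hs | hs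
  · left
    have : CT.Le B.toI.exClosure φ.exClosure :=
      .exSet_elim (.exSet_self _ h) fun x _ hx => by simp [IForm.fv_exClosure] at hx
    exact .impE this hs
  · right
    exact h'.trans ((ConstraintTheory.Le.exSet_self _ (.refl _)).trans hs)

/-- The variant `r.rename ρ` has entirely fresh variables. Its heads agree with the instantiated
heads up to equations sending `ρ x` to `σ x`; with these equations in the store the transition
applies verbatim, and solving them afterwards recovers the stores of the hypothesis. -/
theorem Reach.rule (hCT : CT.Complete) {r₀ r : Rule L User} (hr₀ : r₀ ∈ P) (hr : r.IsVariant r₀)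
    {k : Store L User} {σ : ℕ → L.Term ℕ} {ρ : ℕ → ℕ} {V : Finset ℕ} {T : Config L User}
    (hρ : Function.Injective ρ) (hV : ∀ x, ρ x ∉ V)
    (hk : ∀ x, ρ x ∉ (k + (r.kept.subst σ).atoms + (r.removed.subst σ).atoms +
      (r.guard.subst σ).atoms).vars)
    (hσ : ∀ x, ∀ z ∈ r.vars, ρ x ∉ (σ z).varFinset)
    (h : ∀ n ∈ (r.body.subst (CHRV.freshen σ r.locals ρ)).dnf,
      Reach CT P [(k + (r.kept.subst σ).atoms + (r.guard.subst σ).atoms +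
        (r.guard.subst (CHRV.freshen σ r.locals ρ)).atoms + n).state V] T) :
    Reach CT P [(k + (r.kept.subst σ).atoms + (r.removed.subst σ).atoms +
      (r.guard.subst σ).atoms).state V] T := by
  set τ := CHRV.freshen σ r.locals ρ with hτ
  set H := r.kept.vars ∪ r.removed.vars with hH
  set s := H.image ρ with hs
  have hHl : ∀ x ∈ H, x ∉ r.locals := fun x hx hx' => (Finset.mem_sdiff.1 hx').2 hx
  -- Only renamed head variables are sent back to `σ`; renamed local variables stay as fresh names,
  -- so that renaming by `ρ` and then applying `υ` amounts to `τ` on the rule.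
  obtain ⟨υ, hυ, hυ'⟩ := exists_inverse_renaming (s := H) hρ.injOn σ
  have hτH : ∀ x ∈ H, τ x = σ x := fun x hx => by simp [hτ, CHRV.freshen, hHl x hx]
  have hτl : ∀ x ∈ r.locals, τ x = Term.var (ρ x) := fun x hx => by simp [hτ, CHRV.freshen, hx]
  have ren : ∀ G : Goal L User, G.vars ⊆ r.vars → (G.rename ρ).subst υ = G.subst τ := by
    intro G hG
    rw [Goal.rename, Goal.subst_subst]
    refine Goal.subst_congr fun x hx => ?_
    rw [Term.subst]
    rcases Rule.mem_vars_iff.1 (hG hx) with hx | hx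
    · rw [hυ x hx, hτH x hx]
    · rw [hτl x hx, hυ']
      intro hmem
      obtain ⟨y, hy, e⟩ := Finset.mem_image.1 hmem
      exact hHl y hy (hρ e ▸ hx)
  have keptτ : r.kept.subst τ = r.kept.subst σ :=
    Goal.subst_congr fun x hx => hτH x (Finset.mem_union_left _ hx)
  have removedτ : r.removed.subst τ = r.removed.subst σ :=
    Goal.subst_congr fun x hx => hτH x (Finset.mem_union_right _ hx)
  have keptV : r.kept.vars ⊆ r.vars := fun x hx => by simp [Rule.vars, hx]
  have removedV : r.removed.vars ⊆ r.vars := fun x hx => by simp [Rule.vars, hx]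
  have guardV : r.guard.vars ⊆ r.vars := fun x hx => by simp [Rule.vars, hx]
  have bodyV : r.body.vars ⊆ r.vars := fun x hx => by simp [Rule.vars, hx]
  set r' := r.rename ρ with hr'
  set n₀ : Store L User := k + (r.guard.subst σ).atoms with hn₀
  have hn₀V : ∀ x, ρ x ∉ n₀.vars := fun x hx => hk x (by
    simp only [hn₀, Store.vars_add, Finset.mem_union] at hx ⊢
    tauto)
  have n₀υ : n₀.subst υ = n₀ := Store.subst_eq_self fun z hz => hυ' z fun hmem => by
    obtain ⟨y, _, rfl⟩ := Finset.mem_image.1 hmem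
    exact hn₀V y hz
  have keptυ : r'.kept.atoms.subst υ = (r.kept.subst σ).atoms := by
    rw [← Goal.atoms_subst, ← keptτ, ← ren _ keptV]; rfl
  have removedυ : r'.removed.atoms.subst υ = (r.removed.subst σ).atoms := by
    rw [← Goal.atoms_subst, ← removedτ, ← ren _ removedV]; rfl
  have guardυ : r'.guard.atoms.subst υ = (r.guard.subst τ).atoms := by
    rw [← Goal.atoms_subst, ← ren _ guardV]; rfl
  have solve : ∀ m : Store L User,
      StateEquiv CT ((m.subst υ).state V) ((m + (0, eqs υ s)).state V) := fun m => by
    refine StateEquiv.subst υ m hυ' (fun x hx y hy => ?_) fun x hx => ?_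
    · obtain ⟨x, hx', rfl⟩ := Finset.mem_image.1 hx
      obtain ⟨y, _, rfl⟩ := Finset.mem_image.1 hy
      rw [hυ x hx']
      exact hσ y x (Rule.mem_vars_iff.2 (Or.inl hx'))
    · obtain ⟨x, _, rfl⟩ := Finset.mem_image.1 hx
      exact hV x
  set m := k + (r.kept.subst σ).atoms + (r.removed.subst σ).atoms + (r.guard.subst σ).atoms with hm
  have gb : (r.guard.subst τ).IsBuiltin := r.guard_builtin.subst
  -- instantiate the guard with the fresh local variables
  have h₁ : StateEquiv CT (m.state V) ((m + (r.guard.subst τ).atoms).state V) := by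
    rw [gb.atoms_eq]
    refine StateEquiv.add_builtin (r.locals.image ρ) (fun y hy => ?_) ?_
    · obtain ⟨x, _, rfl⟩ := Finset.mem_image.1 hy
      exact ⟨hk x, hV x⟩
    · obtain ⟨ξ, hξ, hξ'⟩ := exists_inverse_renaming (s := r.locals) hρ.injOn σ
      refine .exSet_intro _ (Sub.ofTerms ξ) ?_ fun z hz => by
        rw [Sub.ofTerms_inl, hξ' z hz, emb_var]
      rw [Goal.toI_subst (σ := ξ) fun _ _ => rfl]
      have fresh : ∀ z, (∀ x, ρ x ≠ z) → ξ z = Term.var z := fun z hz => hξ' z fun hmem => by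
        obtain ⟨y, _, e⟩ := Finset.mem_image.1 hmem
        exact hz y e
      have gξ : (r.guard.subst τ).atoms.subst ξ = (r.guard.subst σ).atoms := by
        rw [← Goal.atoms_subst, Goal.subst_subst]
        congr 1
        refine Goal.subst_congr fun x hx => ?_
        rcases Rule.mem_vars_iff.1 (guardV hx) with hx' | hx'
        · rw [hτH x hx']
          conv_rhs => rw [← term_subst_var (σ x)]
          exact term_subst_congr fun z hz => fresh z fun y e => hσ y x (guardV hx) (e ▸ hz)
        · rw [hτl x hx', Term.subst, hξ x hx']
      refine .conj_subst_right fun a ha => ?_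
      rcases Multiset.mem_add.1 ha with ha | ha
      · rw [Goal.subst_eq_self fun z hz => fresh z fun x e =>
          hk x (e ▸ Store.mem_vars_of_snd ha hz)]
        exact .conj_left ha
      · refine .conj_left (a := ⟨a.1.subst ξ, a.2.subst⟩) ?_
        rw [hm]
        refine Multiset.mem_add.2 (Or.inr ?_)
        rw [← gξ]
        exact Multiset.mem_map.2 ⟨a, ha, rfl⟩
  -- abstract the arguments of the head
  set K : Store L User := n₀ + (0, eqs υ s) with hK
  have h₂ : StateEquiv CT ((m + (r.guard.subst τ).atoms).state V)
      ((r'.kept.atoms + r'.removed.atoms + r'.guard.atoms + K).state V) := by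
    have := solve (r'.kept.atoms + r'.removed.atoms + r'.guard.atoms + n₀)
    simp only [Store.subst_add, keptυ, removedυ, guardυ, n₀υ] at this
    convert this using 2
    · rw [hm, hn₀]; abel
    · rw [hK]; abel
  have h₃ : StateEquiv CT ((r'.kept.atoms + r'.removed.atoms + r'.guard.atoms + K).state V)
      ⟨((r'.kept.and r'.removed).and r'.guard).and K.goal, V⟩ :=
    StateEquiv.goal_congr V ((Store.goal_add _ _).trans (.andCongr ((Store.goal_add _ _).trans
      (.andCongr ((Store.goal_add _ _).trans (.andCongr r'.kept_user.goal_atoms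
        r'.removed_user.goal_atoms)) r'.guard_builtin.goal_atoms)) (.refl _)))
  have hB : (r'.guard.and (conj K.2)).IsBuiltin := ⟨r'.guard_builtin, conj_isBuiltin _⟩
  -- Either the transition is applicable, or the theory refutes the built-in store and the state is
  -- failed.
  rcases hCT.cases hB (φ := (r'.guard.and K.goal).toI)
    (ψ := (conj (r'.kept.atoms + r'.removed.atoms + r'.guard.atoms + K).2).toI)
    (.and (.and_left _ _) (.and (.conj_user _ _) (.and_right _ _)))
    (.and (r'.guard_builtin.atoms_le fun a ha => .conj_left
      (Multiset.mem_add.2 (Or.inl (Multiset.mem_add.2 (Or.inr ha)))))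
      (.conj_mono (Multiset.subset_of_le (Multiset.le_add_left _ _)))) with hsat | hunsat
  swap
  · exact Reach.of_failed (h₁.trans (h₂.trans (StateEquiv.failed_of_le V hunsat)))
  refine Reach.of_state (h₁.trans (h₂.trans h₃)) ?_
  have hdisj : Disjoint r'.locals (r'.kept.vars ∪ r'.removed.vars ∪ K.goal.vars ∪ V) := by
    rw [Finset.disjoint_left]
    intro z hz hz'
    have hzv : z ∈ r'.vars := Rule.mem_vars_iff.2 (Or.inr hz)
    rw [hr', Rule.vars_rename] at hzv
    -- A local variable of the variant is a fresh name `ρ x`. It can meet `K` only on the left of an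
    -- equation, but those sides are renamed head variables.
    obtain ⟨x, _, rfl⟩ := Finset.mem_image.1 hzv
    have hnot := (Finset.mem_sdiff.1 hz).2
    rcases Finset.mem_union.1 hz' with hz' | hz'
    · rcases Finset.mem_union.1 hz' with hz' | hz'
      · exact hnot hz'
      · have hz' : ρ x ∈ K.vars := hz'
        rw [hK, Store.vars_add, Finset.mem_union] at hz'
        rcases hz' with hz' | hz'
        · exact hn₀V x hz'
        · obtain ⟨y, hy, hz'⟩ := mem_vars_eqs hz'
          obtain ⟨y, hy', rfl⟩ := Finset.mem_image.1 hy
          rcases hz' with e | hz'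
          · apply hnot
            rw [e]
            rcases Finset.mem_union.1 hy' with hy' | hy'
            · exact Finset.mem_union_left _ (Goal.mem_vars_rename.2 ⟨y, hy', rfl⟩)
            · exact Finset.mem_union_right _ (Goal.mem_vars_rename.2 ⟨y, hy', rfl⟩)
          · rw [hυ y hy'] at hz'
            exact hσ x y (Rule.mem_vars_iff.2 (Or.inl hy')) hz'
    · exact hV x hz'
  refine Reach.of_step (Step.apply r₀ r' K.goal V [] hr₀ (hr.rename hρ) hdisj hsat) ?_
  -- decompose the body and instantiate the arguments of the head again
  have h₄ : GoalEquiv (((r'.kept.and r'.guard).and r'.body).and K.goal)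
      (r'.body.and (r'.kept.atoms + r'.guard.atoms + K).goal) := by
    refine (GoalEquiv.andCongr (.comm _ _) (.refl _)).trans ((GoalEquiv.assoc _ _ _).trans
      (.andCongr (.refl _) (GoalEquiv.symm ?_)))
    exact (Store.goal_add _ _).trans (.andCongr ((Store.goal_add _ _).trans
      (.andCongr r'.kept_user.goal_atoms r'.guard_builtin.goal_atoms)) (.refl _))
  refine Reach.of_equiv ((ConfigEquiv.state [] (.goal V h₄)).trans (ConfigEquiv.dnf_add _ _ V []))
    (Reach.of_forall fun S hS => ?_)
  rw [List.append_nil, List.mem_map] at hS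
  obtain ⟨n, hn, rfl⟩ := hS
  have hn' : n.subst υ ∈ (r.body.subst τ).dnf := by
    rw [← ren _ bodyV, Goal.dnf_subst]
    exact List.mem_map_of_mem hn
  have h₅ := solve (n + (r'.kept.atoms + r'.guard.atoms + n₀))
  simp only [Store.subst_add, keptυ, guardυ, n₀υ] at h₅
  refine Reach.of_state (StateEquiv.symm ?_) (h _ hn')
  convert h₅ using 2
  · rw [hn₀]; abel
  · rw [hK]; abel

/-- Induction on the covering: `ct` and `eq` become state equivalences, `bot` a failed state, and
`rule` a transition unless the built-ins are refuted. The finite set `A` of each cofinite premise is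
avoided together with the variables of the current state and of the substitution. -/
theorem Cov.reach (hCT : CT.Complete) {X : Set (Store L User)} {m : Store L User}
    {V : Finset ℕ} {T : Config L User}
    (hX : ∀ x ∈ X, ∀ b, Reach CT P [(x + (0, b)).state V] T) (h : Cov CT P X m) :
    Reach CT P [m.state V] T := by
  induction h with
  | base b h => exact hX _ h b
  | bot m => exact Reach.of_failed (StateEquiv.failed_of_bot m V)
  | @ct m b B hB s σ A h _ ih =>
    obtain ⟨ρ, hρ, hfr⟩ := exists_fresh_renaming (A ∪ V ∪ (m + (0, b)).vars ∪
      B.vars.biUnion fun z => (σ z).varFinset)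
    simp only [Finset.mem_union, Finset.mem_biUnion, not_or, not_exists, not_and] at hfr
    exact Reach.of_state (StateEquiv.add_ct hB h hρ (fun x => (hfr x).1.1.2)
      (fun x => (hfr x).1.2) fun x => (hfr x).2)
      (ih ρ hρ.injOn fun x _ => (hfr x).1.1.1)
  | @rule k r₀ r σ A hr₀ hr _ ih =>
    obtain ⟨ρ, hρ, hfr⟩ := exists_fresh_renaming (A ∪ V ∪
      (k + (r.kept.subst σ).atoms + (r.removed.subst σ).atoms + (r.guard.subst σ).atoms).vars ∪
      r.vars.biUnion fun z => (σ z).varFinset)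
    simp only [Finset.mem_union (a := ρ _), Finset.mem_biUnion, not_or, not_exists, not_and] at hfr
    exact Reach.rule hCT hr₀ hr hρ (fun x => (hfr x).1.1.2) (fun x => (hfr x).1.2)
      (fun x => (hfr x).2) fun n hn => ih ρ hρ.injOn (fun x _ => (hfr x).1.1.1) n hn
  | eq k c ts j s _ ih => exact Reach.of_state (StateEquiv.swap_eq c ts j s V) ih

/-! ### Completeness -/

/-- The instances of the disjuncts of a configuration. -/
def Config.instances (T : Config L User) : Set (Store L User) :=
  {m | ∃ S ∈ T, ∃ n ∈ S.goal.dnf, ∃ σ : ℕ → L.Term ℕ,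
    (∀ x ∉ S.locals, σ x = Term.var x) ∧ m = n.subst σ}

/-- Evaluated at the identity valuation, the witnesses of the local quantifiers form a substitution
that fixes everything except the local variables. -/
theorem State.sem_toL_subset {S : State L User} {T : Config L User} (hS : S ∈ T) :
    sem CT P S.toL (Sum.elim Term.var Fin.elim0) ⊆ cl CT P T.instances := by
  refine sem_exVars_subset cl_cl_subset _ _ fun e he => ?_
  rw [sem_toL]
  refine cl_mono fun m hm => ?_
  have hm : m ∈ (S.goal.subst fun x => e (Sum.inl x)).dnf := hm
  rw [Goal.dnf_subst, List.mem_map] at hm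
  obtain ⟨n, hn, rfl⟩ := hm
  exact ⟨S, hS, n, hn, _, fun x hx => he x (by simpa using hx), rfl⟩

theorem Config.sem_toL_subset {X : Set (Store L User)} {e : ℕ ⊕ Fin 0 → L.Term ℕ}
    (hX : cl CT P X ⊆ X) : ∀ {T : Config L User}, (∀ S ∈ T, sem CT P S.toL e ⊆ X) →
      sem CT P T.toL e ⊆ X
  | [], _ => (cl_mono (Set.empty_subset _)).trans hX
  | [S], h => h S (by simp)
  | S :: S' :: T, h =>
      (cl_mono (Set.union_subset (h S (by simp))
        (sem_toL_subset hX fun S'' hS => h S'' (List.mem_cons_of_mem _ hS)))).trans hX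

/-- Rename the local variables of the disjunct apart, turn the substitution into equations on the
new names, and drop these equations by entailment. The rest is the disjunct itself up to renaming
local variables and changing redundant globals. -/
theorem Reach.of_instance {T : Config L User} {V : Finset ℕ} (hV : ∀ S ∈ T, S.globals ⊆ V)
    {m : Store L User} (hm : m ∈ T.instances) (b : Multiset {G : Goal L User // G.IsBuiltin}) :
    Reach CT P [(m + (0, b)).state V] T := by
  obtain ⟨S, hS, n, hn, σ, hσ, rfl⟩ := hm
  have weaken : ∀ (m : Store L User) (b : Multiset {G : Goal L User // G.IsBuiltin}),
      StateEntails CT (((m + (0, b)).state V).cls CT) ((m.state V).cls CT) := by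
    intro m b
    have e : m + (0, b) = (m.1, m.2 + b) := Prod.ext (by simp) rfl
    rw [e]
    refine .single (.weaken V (conj_isUser m.1) (conj_isBuiltin _) (conj_isBuiltin _)
      (StateEquiv.le_strictLocals ∅ ?_ (by simp)))
    rw [IForm.exSet_empty]
    exact .conj_mono (Multiset.subset_of_le (Multiset.le_add_right _ _))
  have cls_eq : ∀ {S S' : State L User}, StateEquiv CT S S' → S.cls CT = S'.cls CT :=
    fun h => Quotient.sound h
  have hnS := Goal.vars_of_mem_dnf hn
  have hloc : ∀ x ∈ S.locals, x ∉ S.globals := fun x hx => (Finset.mem_sdiff.1 hx).2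
  obtain ⟨ρ, hρ, hfr⟩ := exists_fresh_renaming (V ∪ S.goal.vars ∪
    S.locals.biUnion fun z => (σ z).varFinset)
  simp only [Finset.mem_union, Finset.mem_biUnion, not_or, not_exists, not_and] at hfr
  obtain ⟨υ, hυ, hυ'⟩ := exists_inverse_renaming (s := S.locals) hρ.injOn σ
  set n' := n.subst (freshen Term.var S.locals ρ) with hn'
  have e₁ : n.subst σ = n'.subst υ := by
    rw [hn', Store.subst_subst]
    refine Store.subst_congr fun x hx => ?_
    by_cases hxl : x ∈ S.locals
    · simp only [freshen, hxl, if_true, Term.subst, hυ x hxl]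
    · simp only [freshen, hxl, if_false, Term.subst]
      rw [hσ x hxl, hυ' x]
      intro hmem
      obtain ⟨y, _, rfl⟩ := Finset.mem_image.1 hmem
      exact (hfr y).1.2 (hnS hx)
  have h₁ : StateEquiv CT ((n.subst σ).state V) ((n' + (0, eqs υ (S.locals.image ρ))).state V) := by
    rw [e₁]
    refine StateEquiv.subst υ n' hυ' (fun x hx y hy => ?_) fun x hx => ?_
    · obtain ⟨x, hx', rfl⟩ := Finset.mem_image.1 hx
      obtain ⟨y, _, rfl⟩ := Finset.mem_image.1 hy
      rw [hυ x hx']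
      exact (hfr y).2 x hx'
    · obtain ⟨x, _, rfl⟩ := Finset.mem_image.1 hx
      exact (hfr x).1.1
  have h₂ : StateEquiv CT (n'.state V) (n'.state S.globals) := by
    refine StateEquiv.globals fun y hy => ⟨fun hyV => ?_, fun hy => hV S hS hy⟩
    obtain ⟨x, hx, hy⟩ := Store.mem_vars_subst.1 hy
    by_cases hxl : x ∈ S.locals
    · simp only [freshen, hxl, if_true, Term.varFinset, Finset.mem_singleton] at hy
      exact absurd (hy ▸ hyV) (hfr x).1.1
    · simp only [freshen, hxl, if_false, Term.varFinset, Finset.mem_singleton] at hy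
      rw [State.locals, Finset.mem_sdiff, not_and_not_right] at hxl
      exact hy ▸ hxl (hnS hx)
  have h₃ : StateEquiv CT (n'.state S.globals) (n.state S.globals) :=
    StateEquiv.freshen hρ.injOn (fun x _ h => (hfr x).1.2 (hnS h))
      (fun x _ h => (hfr x).1.2 (Finset.mem_sdiff.1 h).1) hloc
      fun x _ h => (hfr x).1.1 (hV S hS h)
  refine Reach.to_equiv (Reach.of_entails (S' := n.state S.globals) ?_ ?_)
    (ConfigEquiv.normalize T).symm
  · exact List.mem_flatMap.2 ⟨S, hS, List.mem_map.2 ⟨n, hn, rfl⟩⟩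
  · have h₄ := weaken n' (eqs υ (S.locals.image ρ))
    rw [← cls_eq h₁, cls_eq (h₂.trans h₃)] at h₄
    exact (weaken _ b).trans h₄

theorem Reach.of_ILL (hCT : CT.Complete) {S T : Config L User}
    (h : ILL.Le (sigma CT P) S.toL T.toL) : Reach CT P S T := by
  classical
  refine Reach.of_equiv (ConfigEquiv.normalize S) (Reach.of_forall fun S₀ hS₀ => ?_)
  obtain ⟨S', hS', hS₀⟩ := List.mem_flatMap.1 hS₀
  obtain ⟨n, hn, rfl⟩ := List.mem_map.1 hS₀
  have hnS := Goal.vars_of_mem_dnf hn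
  -- The run keeps all globals of `T` global, so that each disjunct of `T` has its globals among
  -- those of the state reached.
  set V := T.toFinset.biUnion State.globals with hV
  -- Local variables of the starting state might coincide with globals of `T`; once they are
  -- renamed, adding `V` to the globals stays within the equivalence class.
  obtain ⟨ρ, hρ, hfr⟩ := exists_fresh_renaming (V ∪ S'.goal.vars ∪ S'.globals)
  simp only [Finset.mem_union, not_or] at hfr
  set n' := n.subst (freshen Term.var S'.locals ρ) with hn'
  have hmem : n' ∈ sem CT P S'.toL (Sum.elim Term.var Fin.elim0) := by
    refine sem_subset_exVars (e' := Sum.elim (freshen Term.var S'.locals ρ) Fin.elim0) _ _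
      (fun x hx => ?_) (mem_sem_toL ?_)
    · have : x ∉ S'.locals := by simpa using hx
      simp [freshen, this]
    · simp only [Sum.elim_inl, Goal.dnf_subst]
      exact List.mem_map_of_mem hn
  -- The identity valuation keeps the free variables of both sides as they are.
  have hsound := (h.of_config_left hS').sound (Sum.elim Term.var Fin.elim0)
  rw [semCtx_singleton] at hsound
  have hcov : Cov CT P T.instances n' :=
    Config.sem_toL_subset cl_cl_subset (fun _ hS => State.sem_toL_subset hS) (hsound hmem)
  have hreach : Reach CT P [n'.state (V ∪ S'.globals)] T :=
    hcov.reach hCT fun m hm b => Reach.of_instance (fun S hS x hx => Finset.mem_union_left _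
      (Finset.mem_biUnion.2 ⟨S, List.mem_toFinset.2 hS, hx⟩)) hm b
  have h₁ : StateEquiv CT (n'.state S'.globals) (n'.state (V ∪ S'.globals)) := by
    refine StateEquiv.globals fun y hy => ⟨fun h => Finset.mem_union_right _ h, fun h => ?_⟩
    obtain ⟨x, hx, hy⟩ := Store.mem_vars_subst.1 hy
    by_cases hxl : x ∈ S'.locals
    · simp only [freshen, hxl, if_true, Term.varFinset, Finset.mem_singleton] at hy
      rcases Finset.mem_union.1 h with h | h
      · exact absurd (hy ▸ h) (hfr x).1.1
      · exact h
    · simp only [freshen, hxl, if_false, Term.varFinset, Finset.mem_singleton] at hy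
      rw [State.locals, Finset.mem_sdiff, not_and_not_right] at hxl
      exact hy ▸ hxl (hnS hx)
  have h₂ : StateEquiv CT (n'.state S'.globals) (n.state S'.globals) :=
    StateEquiv.freshen hρ.injOn (fun x _ h => (hfr x).1.2 (hnS h))
      (fun x _ h => (hfr x).1.2 (Finset.mem_sdiff.1 h).1)
      (fun x hx => (Finset.mem_sdiff.1 hx).2) fun x _ h => (hfr x).2 h
  exact Reach.of_state (h₂.symm.trans h₁) hreach

end Runs

end CHRV

theorem mainTheorem6 {L : FirstOrder.Language.{u, v}} {User : ℕ → Type w}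
    (CT : CHRV.ConstraintTheory L User) (hCT : CT.Complete) (P : CHRV.Program L User)
    (S T : CHRV.Config L User) :
    CHRV.ILL (CHRV.sigmaCT CT ∪ CHRV.sigmaEq L User ∪ CHRV.sigmaP P)
        {CHRV.Config.toL S} (CHRV.Config.toL T) ↔
      ∃ U : CHRV.Config L User,
        Relation.ReflTransGen (CHRV.Step CT P) (CHRV.Config.cls CT S) (CHRV.Config.cls CT U) ∧
          CHRV.ConfigEntails CT (CHRV.Config.cls CT U) (CHRV.Config.cls CT T) := by
  constructor
  · exact fun h => CHRV.Reach.of_ILL hCT h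
  · rintro ⟨U, h₁, h₂⟩
    exact (CHRV.ILL.Le.steps h₁ S U rfl rfl).trans (CHRV.ILL.Le.configEntails h₂ U T rfl rfl)
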